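/- Let $\mathbb{F}_q$ be a finite field with $q$ elements, let $g\ge 2$, and let $n\ge 2$ be even. Curves are smooth, projective and geometrically irreducible. A curve $C$ of genus $g$ over $\mathbb{F}_q$ is hyperelliptic if it admits a separable morphism of degree $2$ over $\mathbb{F}_q$ to $\mathbb{P}^1$. For such a $C$ put $$s_n(C)=\sum_{C'}\frac{(q+1-\#C'(\mathbb{F}_q))^n}{\#\mathrm{Aut}_{\mathbb{F}_q}(C')},$$ where $C'$ runs over the twists of $C$ (the curves over $\mathbb{F}_q$ that become isomorphic to $C$ over $\overline{\mathbb{F}}_q$; they are again hyperelliptic of genus $g$), one from each $\mathbb{F}_q$-isomorphism class. Let $S_n(q,\mathcal{H}_g)$ be the sum of $s_n(C)$ over the hyperelliptic curves $C$ of genus $g$ over $\mathbb{F}_q$, one from each $\overline{\mathbb{F}}_q$-isomorphism class, and put $$a_q=\left(\frac{S_n(q,\mathcal{H}_g)}{q^{2g-1+n/2}}\right)^{1/n}.$$ All these sums have finitely many terms, the groups $\mathrm{Aut}_{\mathbb{F}_q}(C')$ and the sets $C'(\mathbb{F}_q)$ are finite, and there exist hyperelliptic curves $C$ and $C'$ of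 genus $g$ over $\mathbb{F}_q$ with $$\#C(\mathbb{F}_q)\ge 1+q+a_q\sqrt q\qquad\text{and}\qquad \#C'(\mathbb{F}_q)\le 1+q-a_q\sqrt q.$$ -/

import Mathlib

open scoped TensorProduct

universe u

namespace CurveCount

/-- A smooth projective geometrically irreducible curve over a perfect (for us: finite) field `F`,
given by its function field: a field `K` over `F`, finite over `F(x)` for some `x` transcendental
over `F`, in which `F` is algebraically closed. Isomorphisms of curves over `F` are the
`F`-isomorphisms of function fields, and the closed points of the curve are the valuation rings of
`K` that contain `F` and are different from `K`. -/
structure Curve (F : Type u) [Field F] : Type (u + 1) where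
  /-- the function field -/
  K : Type u
  [field : Field K]
  [algebra : Algebra F K]
  finite_over_rational : ∃ x : K, Transcendental F x ∧
    FiniteDimensional (IntermediateField.adjoin F {x}) K
  constants : ∀ z : K, IsAlgebraic F z → ∃ a : F, algebraMap F K a = z

attribute [instance] Curve.field Curve.algebra

namespace Curve

variable {F : Type u} [Field F]

/-- The closed points (places) of `C`, given by their local rings. -/
def IsPlace (C : Curve F) (O : ValuationSubring C.K) : Prop :=
  (∀ a : F, algebraMap F C.K a ∈ O) ∧ O ≠ ⊤

/-- The local rings of the points in `C(F)`: the places whose residue field is `F`, that is, every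
function regular at the place is congruent to a constant modulo the maximal ideal. -/
def IsRationalPlace (C : Curve F) (O : ValuationSubring C.K) : Prop :=
  C.IsPlace O ∧ ∀ z ∈ O, ∃ a : F, O.valuation (z - algebraMap F C.K a) < 1

/-- The set `C(F)` of rational points. -/
def RationalPoint (C : Curve F) : Type u :=
  {O : ValuationSubring C.K // C.IsRationalPlace O}

/-- The number `#C(F)` of rational points. -/
noncomputable def numPoints (C : Curve F) : ℕ := Nat.card C.RationalPoint

/-- The space `H⁰(C, Ω)` of regular differentials: the differentials of `K/F` which, for the local
ring `O` of every closed point, lie in the `O`-module generated by the `dt`, `t ∈ O`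
(as `F ⊆ O`, this module is the `F`-span of all `s dt` with `s, t ∈ O`). -/
noncomputable def regularDifferentials (C : Curve F) : Submodule F (Ω[C.K⁄F]) :=
  ⨅ (O : ValuationSubring C.K) (_ : C.IsPlace O),
    Submodule.span F {ω | ∃ s ∈ O, ∃ t ∈ O, ω = s • KaehlerDifferential.D F C.K t}

/-- The genus, `dim H⁰(C, Ω)`. -/
noncomputable def genus (C : Curve F) : ℕ := Module.finrank F C.regularDifferentials

/-- `C` admits a separable morphism of degree 2 to the projective line: for some function `x`,
the function field is a separable quadratic extension of `F(x)`. (When the genus is at least 2,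
a morphism of degree 2 to the projective line is always separable.) -/
def IsHyperelliptic (C : Curve F) : Prop :=
  ∃ x : C.K, Transcendental F x ∧
    Module.finrank (IntermediateField.adjoin F {x}) C.K = 2 ∧
    Algebra.IsSeparable (IntermediateField.adjoin F {x}) C.K

/-- The group `Aut_F(C)` of automorphisms of `C` defined over `F`. -/
abbrev Aut (C : Curve F) : Type u := C.K ≃ₐ[F] C.K

/-- `C` and `C'` are isomorphic over `F`. -/
def Iso (C C' : Curve F) : Prop := Nonempty (C.K ≃ₐ[F] C'.K)

/-- `C` and `C'` are isomorphic over the algebraic closure `F̄` of `F`, i.e. they are twists of each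
other. (For `F` perfect, `F̄ ⊗ K` is a field, the function field of the base change of the
curve.) -/
def GeomIso (C C' : Curve F) : Prop :=
  Nonempty ((AlgebraicClosure F ⊗[F] C.K) ≃ₐ[AlgebraicClosure F] (AlgebraicClosure F ⊗[F] C'.K))

end Curve

/-- Hyperelliptic curves of genus `g` over `F`. -/
def HypCurve (F : Type u) [Field F] (g : ℕ) : Type (u + 1) :=
  {C : Curve F // C.IsHyperelliptic ∧ C.genus = g}

variable (F : Type u) [Field F] (g : ℕ)

/-- Isomorphism over `F` of hyperelliptic curves of genus `g`. -/
def isoSetoid : Setoid (HypCurve F g) where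
  r C C' := C.1.Iso C'.1
  iseqv := ⟨fun _ => ⟨AlgEquiv.refl⟩, fun ⟨e⟩ => ⟨e.symm⟩, fun ⟨e⟩ ⟨f⟩ => ⟨e.trans f⟩⟩

/-- Isomorphism over the algebraic closure of `F` of hyperelliptic curves of genus `g` over `F`. -/
def geomSetoid : Setoid (HypCurve F g) where
  r C C' := C.1.GeomIso C'.1
  iseqv := ⟨fun _ => ⟨AlgEquiv.refl⟩, fun ⟨e⟩ => ⟨e.symm⟩, fun ⟨e⟩ ⟨f⟩ => ⟨e.trans f⟩⟩

/-- The `F`-isomorphism classes of hyperelliptic curves of genus `g` over `F`. -/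
def IsoClass : Type (u + 1) := Quotient (isoSetoid F g)

/-- The `F̄`-isomorphism classes of hyperelliptic curves of genus `g` over `F`. -/
def GeomClass : Type (u + 1) := Quotient (geomSetoid F g)

variable {F g}

/-- A representative of an `F`-isomorphism class. -/
noncomputable def IsoClass.rep (c : IsoClass F g) : Curve F := (Quotient.out c).1

/-- The sum `s_n(C)`, over the twists `C'` of `C` up to `F`-isomorphism, of
`(q + 1 - #C'(F))^n / #Aut_F(C')`, where `C` is hyperelliptic of genus `g` (all its twists then are
hyperelliptic of genus `g` as well). -/
noncomputable def twistSum (n : ℕ) (C : HypCurve F g) : ℝ :=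
  ∑ᶠ (c : IsoClass F g) (_ : C.1.GeomIso c.rep),
    ((Nat.card F : ℝ) + 1 - c.rep.numPoints) ^ n / Nat.card c.rep.Aut

variable (F g)

/-- `S_n(q, H_g)`: the sum of `s_n(C)` over the `F̄`-isomorphism classes of hyperelliptic curves `C`
of genus `g` over the field `F` with `q` elements. -/
noncomputable def traceSum (n : ℕ) : ℝ :=
  ∑ᶠ c : GeomClass F g, twistSum n (Quotient.out c : HypCurve F g)

/-- `a_q = (S_n(q, H_g) / q ^ (2g - 1 + n/2)) ^ (1/n)`, for `g ≥ 1` and even `n`. -/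
noncomputable def aq (n : ℕ) : ℝ :=
  (traceSum F g n / (Nat.card F : ℝ) ^ (2 * g - 1 + n / 2)) ^ (1 / (n : ℝ))

end CurveCount

/-! Let `M` be the largest absolute value of a trace `q + 1 - #C(F)` over hyperelliptic curves of
genus `g`. Summing over geometric classes and then over twists is summing over all `F`-isomorphism
classes (`traceSum_eq`), so for even `n` the sum `S_n` is at most `M ^ n` times the mass `∑ 1 /
#Aut`. If the mass is at most `q ^ (2g - 1)`, then `a_q √q ≤ M` (`exists_aq_mul_sqrt_le`). A curve
attaining `M` and its quadratic twist have opposite traces (`IsModel.exists_twist`), and one of the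
two serves each inequality.

The mass bound `sum_inv_card_aut_le` counts equations `y² + h y = f` with `deg h ≤ N` and `deg f ≤
2N`, in every characteristic at once. For a given curve take `N` minimal. Minimality makes the
equation normal in both charts of the line; over a finite field normal means smooth, and the regular
differentials `a(x) dx / (2y + h)` then give `N = g + 1` (`level_of_genus`). The coordinate changes,
`q (q² - 1) (q - 1) q ^ (g + 2)` in number, map injectively to pairs of an automorphism and an
equation of the curve (`card_coordChange_le`), which bounds `1 / #Aut` by the number of equations of
the curve over the number of changes. Different classes have disjoint sets of equations.

It remains to bound the number of all minimal equations (`card_globallyMinimalPairs_le`). Every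
equation of nonzero discriminant arises from exactly one normal equation by a monic denominator `a`
and a residue `t` mod `a`; this gives a recurrence in `N` for the number of normal ones. Removing
those that are not minimal at infinity leaves at most `q ^ (3g + 2) (q - 1) (q² - 1)`, and division
gives `q ^ (2g - 1)`. -/

namespace CurveCount

open Polynomial

/-! ### Counting Weierstrass equations. -/

section Pairs

variable {F : Type*} [Field F]

/-- The discriminant of `y² + h y - f` as a polynomial in `y`. -/
noncomputable def discr (p : F[X] × F[X]) : F[X] := p.1 ^ 2 + 4 * p.2

/-- The coefficients of `y² + h y - f` after the substitution of `y + t` for `y`. -/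
noncomputable def shift (t : F[X]) (p : F[X] × F[X]) : F[X] × F[X] :=
  (p.1 + 2 * t, p.2 - p.1 * t - t ^ 2)

lemma shift_shift (s t : F[X]) (p : F[X] × F[X]) : shift s (shift t p) = shift (s + t) p := by
  ext1 <;> simp only [shift] <;> ring

lemma shift_zero (p : F[X] × F[X]) : shift 0 p = p := by simp [shift]

lemma shift_neg_shift (t : F[X]) (p : F[X] × F[X]) : shift (-t) (shift t p) = p := by
  rw [shift_shift, neg_add_cancel, shift_zero]

lemma shift_shift_neg (t : F[X]) (p : F[X] × F[X]) : shift t (shift (-t) p) = p := by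
  rw [shift_shift, add_neg_cancel, shift_zero]

lemma discr_shift (t : F[X]) (p : F[X] × F[X]) : discr (shift t p) = discr p := by
  simp only [shift, discr]; ring

/-- The coefficients of `y² + h y - f` after the substitution of `a y` for `y` and multiplication
by `a²`. -/
noncomputable def dilate (a : F[X]) (p : F[X] × F[X]) : F[X] × F[X] := (a * p.1, a ^ 2 * p.2)

lemma discr_dilate (a : F[X]) (p : F[X] × F[X]) : discr (dilate a p) = a ^ 2 * discr p := by
  simp only [dilate, discr]; ring

/-- The affine curve `y² + h y = f` has no partial normalization of the form
`F[x, (y - t) / a]`. -/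
def AffineMinimal (p : F[X] × F[X]) : Prop :=
  ∀ a t : F[X], a ∣ (shift t p).1 → a ^ 2 ∣ (shift t p).2 → IsUnit a

lemma AffineMinimal.shift {p : F[X] × F[X]} (hp : AffineMinimal p) (t : F[X]) :
    AffineMinimal (shift t p) := fun a s h1 h2 => by
  rw [shift_shift] at h1 h2
  exact hp a _ h1 h2

/-- The pairs `(h, f)` with `deg h ≤ N`, `deg f ≤ 2 N` and nonzero discriminant. -/
def levelPairs (F : Type*) [Field F] (N : ℕ) : Set (F[X] × F[X]) :=
  {p | p.1.natDegree ≤ N ∧ p.2.natDegree ≤ 2 * N ∧ discr p ≠ 0}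

/-- The affinely minimal pairs of level `N`. -/
def minimalPairs (F : Type*) [Field F] (N : ℕ) : Set (F[X] × F[X]) :=
  {p | p ∈ levelPairs F N ∧ AffineMinimal p}

/-- The affinely minimal pairs of level `N` which are minimal at infinity as well. -/
def globallyMinimalPairs (F : Type*) [Field F] (N : ℕ) : Set (F[X] × F[X]) :=
  {p | p ∈ minimalPairs F N ∧ ∀ c : F, shift (C c * X ^ N) p ∉ levelPairs F (N - 1)}

lemma natDegree_two_mul_le (t : F[X]) : (2 * t).natDegree ≤ t.natDegree := by
  have := natDegree_C_mul_le (2 : F) t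
  rwa [show (C 2 : F[X]) = 2 from rfl] at this

lemma shift_mem_levelPairs {N : ℕ} {p : F[X] × F[X]} (hp : p ∈ levelPairs F N) {t : F[X]}
    (ht : t.natDegree ≤ N) : shift t p ∈ levelPairs F N := by
  obtain ⟨h1, h2, h3⟩ := hp
  refine ⟨?_, ?_, by rwa [discr_shift]⟩
  · exact (natDegree_add_le _ _).trans (max_le h1 ((natDegree_two_mul_le t).trans ht))
  · refine (natDegree_sub_le _ _).trans (max_le ((natDegree_sub_le _ _).trans (max_le h2 ?_)) ?_)
    · exact natDegree_mul_le.trans (by omega)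
    · exact natDegree_pow_le.trans (by omega)

lemma dvd_discr_of_dvd_shift {p : F[X] × F[X]} {a t : F[X]} (ha1 : a ∣ (shift t p).1)
    (ha2 : a ^ 2 ∣ (shift t p).2) : a ^ 2 ∣ discr p := by
  rw [← discr_shift t p, discr]
  exact dvd_add (pow_dvd_pow_of_dvd ha1 2) (ha2.mul_left 4)

/-- The order `F[x, (y - t) / a]` depends on `t` only modulo `a`. -/
lemma dvd_shift_add_mul {p : F[X] × F[X]} {a t : F[X]} (s : F[X]) (ha1 : a ∣ (shift t p).1)
    (ha2 : a ^ 2 ∣ (shift t p).2) :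
    a ∣ (shift (t + a * s) p).1 ∧ a ^ 2 ∣ (shift (t + a * s) p).2 := by
  obtain ⟨v, hv⟩ := ha1
  obtain ⟨w, hw⟩ := ha2
  simp only [shift] at hv hw ⊢
  exact ⟨⟨v + 2 * s, by linear_combination hv⟩,
    ⟨w - v * s - s ^ 2, by linear_combination hw - a * s * hv⟩⟩

/-- A pair is obtained from an affinely minimal one by a dilation and a shift. -/
lemma exists_affineMinimal {p : F[X] × F[X]} (hp : discr p ≠ 0) :
    ∃ a t : F[X], a.Monic ∧ t.degree < a.natDegree ∧
      ∃ r, AffineMinimal r ∧ shift t p = dilate a r := by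
  have ne_zero : ∀ a t : F[X], a ∣ (shift t p).1 → a ^ 2 ∣ (shift t p).2 → a ≠ 0 := by
    rintro a t ha1 ha2 rfl
    exact hp (by simpa using dvd_discr_of_dvd_shift ha1 ha2)
  -- A denominator of largest degree is wanted. Degrees are bounded because the square of a
  -- denominator divides the discriminant.
  let S : Set ℕ := {k | ∃ a t : F[X], a ∣ (shift t p).1 ∧ a ^ 2 ∣ (shift t p).2 ∧ a.natDegree = k}
  have hS : S.Nonempty := ⟨0, 1, 0, one_dvd _, by simp, by simp⟩
  have hSb : BddAbove S := ⟨(discr p).natDegree, by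
    rintro k ⟨a, t, ha1, ha2, rfl⟩
    have := natDegree_le_of_dvd (dvd_discr_of_dvd_shift ha1 ha2) hp
    rw [natDegree_pow] at this
    omega⟩
  obtain ⟨a', t', ha1', ha2', hk⟩ := Nat.sSup_mem hS hSb
  have ha'0 := ne_zero a' t' ha1' ha2'
  set u : F[X] := C a'.leadingCoeff⁻¹ with hu
  have huu : IsUnit u := isUnit_C.2 (by simpa using ha'0)
  set a := a' * u with ha
  have hmon : a.Monic := monic_mul_leadingCoeff_inv ha'0
  have hadvd : a ∣ a' := (huu.mul_right_dvd).2 dvd_rfl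
  have hdeg : a.natDegree = sSup S := by
    rw [← hk, ha, natDegree_mul_C]
    simpa using ha'0
  have h12 := dvd_shift_add_mul (-(t' /ₘ a)) (hadvd.trans ha1')
    ((pow_dvd_pow_of_dvd hadvd 2).trans ha2')
  have htt : t' + a * -(t' /ₘ a) = t' %ₘ a := by
    linear_combination -(modByMonic_add_div t' a)
  rw [htt] at h12
  obtain ⟨⟨r1, hr1⟩, ⟨r2, hr2⟩⟩ := h12
  have hpr : shift (t' %ₘ a) p = dilate a (r1, r2) := Prod.ext hr1 hr2
  refine ⟨a, t' %ₘ a, hmon, ?_, (r1, r2), ?_, hpr⟩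
  · rw [← degree_eq_natDegree hmon.ne_zero]
    exact degree_modByMonic_lt t' hmon
  · intro b s hb1 hb2
    -- A denominator `b` for `r` would give the denominator `a * b` for `p`, so maximality of the
    -- degree forces `b` to be constant.
    have hb : a * b ∣ (shift (t' %ₘ a + a * s) p).1 ∧
        (a * b) ^ 2 ∣ (shift (t' %ₘ a + a * s) p).2 := by
      rw [add_comm, ← shift_shift, hpr]
      obtain ⟨v, hv⟩ := hb1
      obtain ⟨w, hw⟩ := hb2
      simp only [shift] at hv hw
      constructor
      · refine ⟨v, ?_⟩
        simp only [shift, dilate]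
        linear_combination a * hv
      · refine ⟨w, ?_⟩
        simp only [shift, dilate]
        linear_combination a ^ 2 * hw
    have hb0 : a * b ≠ 0 := ne_zero _ _ hb.1 hb.2
    have := le_csSup hSb (show (a * b).natDegree ∈ S from ⟨_, _, hb.1, hb.2, rfl⟩)
    rw [natDegree_mul (left_ne_zero_of_mul hb0) (right_ne_zero_of_mul hb0)] at this
    have h0 : b.natDegree = 0 := by omega
    rw [Polynomial.isUnit_iff_degree_eq_zero, degree_eq_natDegree (right_ne_zero_of_mul hb0), h0]
    rfl

lemma natDegree_add_le_of_dilate {M : ℕ} {a : F[X]} (ha : a ≠ 0) {r : F[X] × F[X]}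
    (h1 : (dilate a r).1.natDegree ≤ M) (h2 : (dilate a r).2.natDegree ≤ 2 * M) :
    (a.natDegree + r.1.natDegree ≤ M ∨ r.1 = 0) ∧
      (a.natDegree + a.natDegree + r.2.natDegree ≤ 2 * M ∨ r.2 = 0) := by
  simp only [dilate, sq] at h1 h2
  constructor
  · by_cases h0 : r.1 = 0
    · exact Or.inr h0
    · rw [natDegree_mul ha h0] at h1
      exact Or.inl h1
  · by_cases h0 : r.2 = 0
    · exact Or.inr h0
    · rw [natDegree_mul (mul_ne_zero ha ha) h0, natDegree_mul ha ha] at h2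
      exact Or.inl h2

lemma exists_mem_minimalPairs {N : ℕ} {p : F[X] × F[X]} (hp : p ∈ levelPairs F N) :
    ∃ a t : F[X], a.Monic ∧ a.natDegree ≤ N ∧ t.degree < a.natDegree ∧
      ∃ r ∈ minimalPairs F (N - a.natDegree), p = shift (-t) (dilate a r) := by
  obtain ⟨a, t, hmon, ht, r, hr, hpr⟩ := exists_affineMinimal hp.2.2
  have hpr' : p = shift (-t) (dilate a r) := by rw [← hpr, shift_neg_shift]
  have hDr : discr r ≠ 0 := by
    intro h0
    apply hp.2.2
    rw [hpr', discr_shift, discr_dilate, h0, mul_zero]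
  have htk : t.natDegree ≤ a.natDegree - 1 := by
    by_cases h0 : t = 0
    · simp [h0]
    · have := (natDegree_lt_iff_degree_lt h0).2 ht
      omega
  have key : ∀ M, N ≤ M → t.natDegree ≤ M → (a.natDegree + r.1.natDegree ≤ M ∨ r.1 = 0) ∧
      (a.natDegree + a.natDegree + r.2.natDegree ≤ 2 * M ∨ r.2 = 0) := by
    intro M hM1 hM2
    have hs := shift_mem_levelPairs (N := M) ⟨hp.1.trans hM1, hp.2.1.trans (by omega), hp.2.2⟩ hM2
    rw [hpr] at hs
    exact natDegree_add_le_of_dilate hmon.ne_zero hs.1 hs.2.1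
  -- Otherwise `p`, and also its shift by `t`, fits into level `deg a - 1`; this leaves no room for
  -- a nonzero multiple of `a` or `a²`, and `r` would vanish.
  have hkN : a.natDegree ≤ N := by
    by_contra! hlt
    have := key (a.natDegree - 1) (by omega) htk
    apply hDr
    rw [discr, this.1.resolve_left (by omega), this.2.resolve_left (by omega)]
    simp
  refine ⟨a, t, hmon, hkN, ht, r, ⟨⟨?_, ?_, hDr⟩, hr⟩, hpr'⟩
  · rcases (key N le_rfl (by omega)).1 with h | h
    · omega
    · simp [h]
  · rcases (key N le_rfl (by omega)).2 with h | h
    · omega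
    · simp [h]

/-- The fraction `d / c` is a root of a monic quadratic over `F[x]`, which is integrally closed. -/
lemma dvd_of_sq_eq {c d u v : F[X]} (hc : c ≠ 0) (h : d ^ 2 = c * u * d + c ^ 2 * v) : c ∣ d := by
  classical
  obtain ⟨c0, hc0⟩ := EuclideanDomain.gcd_dvd_left c d
  obtain ⟨d0, hd0⟩ := EuclideanDomain.gcd_dvd_right c d
  have hgcd := EuclideanDomain.gcd_eq_gcd_ab c d
  set e := EuclideanDomain.gcd c d
  have he0 : e ≠ 0 := by
    intro h0
    exact hc (by rw [hc0, h0, zero_mul])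
  have hcop : IsCoprime c0 d0 := by
    refine ⟨EuclideanDomain.gcdA c d, EuclideanDomain.gcdB c d, mul_left_cancel₀ he0 ?_⟩
    linear_combination -hgcd - EuclideanDomain.gcdA c d * hc0 - EuclideanDomain.gcdB c d * hd0
  have h1 : d0 ^ 2 = c0 * (u * d0 + c0 * v) := by
    refine mul_left_cancel₀ (pow_ne_zero 2 he0) ?_
    rw [hc0, hd0] at h
    linear_combination h
  have h2 : IsUnit c0 :=
    (hcop.pow_right (n := 2)).isUnit_of_dvd' dvd_rfl (Dvd.intro _ h1.symm)
  rw [hc0]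
  exact (h2.mul_right_dvd).2 (EuclideanDomain.gcd_dvd_right c d)

/-- Since `r'` is minimal, the order `F[x, (y - s) / b]` is maximal and contains `F[x, (y - t) /
a]`. Used in both directions, this yields uniqueness of the decomposition into denominator, residue
and minimal pair. -/
lemma dvd_of_shift_dilate_eq {a b t s : F[X]} {r r' : F[X] × F[X]}
    (hb : b ≠ 0) (hr' : AffineMinimal r')
    (h : shift (-t) (dilate a r) = shift (-s) (dilate b r')) : a ∣ b ∧ a ∣ t - s := by
  classical
  have e1 : a * r.1 - 2 * t = b * r'.1 - 2 * s := by
    have := congrArg Prod.fst h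
    simp only [shift, dilate] at this
    linear_combination this
  have e2 : a ^ 2 * r.2 + a * r.1 * t - t ^ 2 = b ^ 2 * r'.2 + b * r'.1 * s - s ^ 2 := by
    have := congrArg Prod.snd h
    simp only [shift, dilate] at this
    linear_combination this
  obtain ⟨a0, ha0⟩ := EuclideanDomain.gcd_dvd_left a b
  obtain ⟨b0, hb0⟩ := EuclideanDomain.gcd_dvd_right a b
  have hgcd := EuclideanDomain.gcd_eq_gcd_ab a b
  set c := EuclideanDomain.gcd a b
  have hc0 : c ≠ 0 := by
    intro h0
    exact hb (by rw [hb0, h0, zero_mul])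
  have hcop : IsCoprime a0 b0 := by
    refine ⟨EuclideanDomain.gcdA a b, EuclideanDomain.gcdB a b, mul_left_cancel₀ hc0 ?_⟩
    linear_combination -hgcd - EuclideanDomain.gcdA a b * ha0 - EuclideanDomain.gcdB a b * hb0
  have hq : (t - s) ^ 2 = a * r.1 * (t - s) + a ^ 2 * r.2 - b ^ 2 * r'.2 := by
    linear_combination -e2 + s * e1
  obtain ⟨d, hd⟩ : c ∣ t - s := by
    refine dvd_of_sq_eq (u := a0 * r.1) (v := a0 ^ 2 * r.2 - b0 ^ 2 * r'.2) hc0 ?_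
    rw [hq, ha0, hb0]
    ring
  have hq' : d ^ 2 = a0 * r.1 * d + a0 ^ 2 * r.2 - b0 ^ 2 * r'.2 := by
    refine mul_left_cancel₀ (pow_ne_zero 2 hc0) ?_
    rw [hd, ha0, hb0] at hq
    linear_combination hq
  have hl : a0 * r.1 = b0 * r'.1 + 2 * d := by
    refine mul_left_cancel₀ hc0 ?_
    linear_combination e1 - r.1 * ha0 + r'.1 * hb0 + 2 * hd
  -- With `w = (y - s) / b`, the combination `v (y - t) / a + u a0 w` is integral and equals `(w - d
  -- v) / a0`. Hence `a0` is a denominator for `r'`; the witnesses below are its trace and norm up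
  -- to sign.
  obtain ⟨u, v, huv⟩ := hcop.pow_left (m := 2)
  have hunit : IsUnit a0 := by
    refine hr' a0 (d * v) (Dvd.intro (v * r.1 + u * a0 * r'.1) ?_)
      (Dvd.intro (r'.2 * u * (1 + v * b0) - r'.1 * d * v * u + v ^ 2 * r.2) ?_)
    · simp only [shift]
      linear_combination v * hl + r'.1 * huv
    · simp only [shift]
      linear_combination (r'.2 + r'.2 * (v * b0) - r'.1 * d * v) * huv - v ^ 2 * hq' - v ^ 2 * d * hl
  have hac : a ∣ c := by
    rw [ha0]
    exact (hunit.mul_right_dvd).2 dvd_rfl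
  exact ⟨hac.trans (EuclideanDomain.gcd_dvd_right a b), hac.trans (Dvd.intro _ hd.symm)⟩

lemma card_natDegree_le [Finite F] (N : ℕ) :
    Nat.card {p : F[X] // p.natDegree ≤ N} = Nat.card F ^ (N + 1) := by
  have e : {p : F[X] // p.natDegree ≤ N} ≃ degreeLT F (N + 1) :=
    Equiv.subtypeEquivRight fun p => by
      rw [mem_degreeLT, natDegree_le_iff_degree_le]
      exact Order.lt_succ_iff.symm
  rw [Nat.card_congr e, Nat.card_congr (degreeLTEquiv F (N + 1)).toEquiv, Nat.card_fun, Nat.card_fin]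

instance finite_natDegree_le [Finite F] (N : ℕ) : Finite {p : F[X] // p.natDegree ≤ N} :=
  Nat.finite_of_card_ne_zero (by rw [card_natDegree_le]; exact pow_ne_zero _ Nat.card_pos.ne')

instance finite_degreeLT [Finite F] (n : ℕ) : Finite (degreeLT F n) :=
  Finite.of_equiv _ (degreeLTEquiv F n).toEquiv.symm

lemma card_degreeLT [Finite F] (n : ℕ) : Nat.card (degreeLT F n) = Nat.card F ^ n := by
  rw [Nat.card_congr (degreeLTEquiv F n).toEquiv, Nat.card_fun, Nat.card_fin]

instance finite_monic [Finite F] (n : ℕ) : Finite {p : F[X] // p.Monic ∧ p.natDegree = n} :=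
  Finite.of_equiv _ (monicEquivDegreeLT n).symm

lemma finite_levelPairs [Finite F] (N : ℕ) : (levelPairs F N).Finite := by
  have h1 : {p : F[X] | p.natDegree ≤ N}.Finite := finite_natDegree_le N
  have h2 : {p : F[X] | p.natDegree ≤ 2 * N}.Finite := finite_natDegree_le _
  exact (h1.prod h2).subset fun p hp => ⟨hp.1, hp.2.1⟩

lemma finite_minimalPairs [Finite F] (N : ℕ) : (minimalPairs F N).Finite :=
  (finite_levelPairs N).subset fun _ hp => hp.1

instance [Finite F] (N : ℕ) : Finite (minimalPairs F N) := finite_minimalPairs N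

lemma finite_globallyMinimalPairs [Finite F] (N : ℕ) : (globallyMinimalPairs F N).Finite :=
  (finite_minimalPairs N).subset fun _ hp => hp.1

instance [Finite F] (N : ℕ) : Finite (globallyMinimalPairs F N) := finite_globallyMinimalPairs N

lemma dilate_mem_levelPairs {N : ℕ} {a : F[X]} (ha : a ≠ 0) (hN : a.natDegree ≤ N)
    {r : F[X] × F[X]} (hr : r ∈ levelPairs F (N - a.natDegree)) : dilate a r ∈ levelPairs F N := by
  obtain ⟨h1, h2, h3⟩ := hr
  refine ⟨natDegree_mul_le.trans (by omega), natDegree_mul_le.trans ?_, ?_⟩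
  · rw [natDegree_pow]
    omega
  · rw [discr_dilate]
    exact mul_ne_zero (pow_ne_zero _ ha) h3

/-- The weight `q ^ (2k)` counts the monic denominators of degree `k`, times the residues modulo one
of them. -/
lemma card_levelPairs_eq_sum [Finite F] (N : ℕ) : Nat.card (levelPairs F N) =
    ∑ k ∈ Finset.range (N + 1), Nat.card F ^ (2 * k) * Nat.card (minimalPairs F (N - k)) := by
  let T := Σ k : Fin (N + 1), ({a : F[X] // a.Monic ∧ a.natDegree = k} × degreeLT F k ×
    minimalPairs F (N - k))
  have hdeg : ∀ k : Fin (N + 1), ∀ t : degreeLT F k, t.1.natDegree ≤ N := fun k t => by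
    have := mem_degreeLT.1 t.2
    by_cases h0 : t.1 = 0
    · simp [h0]
    · have := (natDegree_lt_iff_degree_lt h0).2 this
      omega
  let Φ : T → levelPairs F N := fun ⟨k, a, t, r⟩ => ⟨shift (-t.1) (dilate a.1 r.1), by
    obtain ⟨a, ha, hak⟩ := a
    refine shift_mem_levelPairs (dilate_mem_levelPairs ha.ne_zero (by rw [hak]; omega) ?_)
      (by rw [natDegree_neg]; exact hdeg k t)
    rw [hak]
    exact r.2.1⟩
  have hΦ : Function.Bijective Φ := by
    constructor
    · rintro ⟨k, ⟨a, ha, hak⟩, ⟨t, ht⟩, ⟨r, hr⟩⟩ ⟨k', ⟨b, hb, hbk⟩, ⟨s, hs⟩, ⟨r', hr'⟩⟩ h0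
      have h : shift (-t) (dilate a r) = shift (-s) (dilate b r') := congrArg Subtype.val h0
      clear h0
      obtain ⟨h1, h2⟩ := dvd_of_shift_dilate_eq hb.ne_zero hr'.2 h
      obtain ⟨h3, -⟩ := dvd_of_shift_dilate_eq ha.ne_zero hr.2 h.symm
      obtain rfl : a = b := eq_of_monic_of_associated ha hb (associated_of_dvd_dvd h1 h3)
      obtain rfl : k = k' := Fin.ext (hak.symm.trans hbk)
      have hts : t = s := by
        rw [← sub_eq_zero]
        refine eq_zero_of_dvd_of_degree_lt h2 ?_
        rw [degree_eq_natDegree ha.ne_zero, hak]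
        exact (degree_sub_le _ _).trans_lt (max_lt (mem_degreeLT.1 ht) (mem_degreeLT.1 hs))
      subst hts
      have hr : r = r' := by
        have h' := congrArg (shift t) h
        rw [shift_shift_neg, shift_shift_neg] at h'
        exact Prod.ext (mul_left_cancel₀ ha.ne_zero (congrArg Prod.fst h'))
          (mul_left_cancel₀ (pow_ne_zero 2 ha.ne_zero) (congrArg Prod.snd h'))
      subst hr
      rfl
    · rintro ⟨p, hp⟩
      obtain ⟨a, t, ha, haN, ht, r, hr, rfl⟩ := exists_mem_minimalPairs hp
      exact ⟨⟨⟨a.natDegree, by omega⟩, ⟨a, ha, rfl⟩, ⟨t, mem_degreeLT.2 ht⟩, ⟨r, hr⟩⟩, rfl⟩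
  rw [← Nat.card_congr (Equiv.ofBijective Φ hΦ), Nat.card_sigma, Finset.sum_range]
  refine Finset.sum_congr rfl fun k _ => ?_
  rw [Nat.card_prod, Nat.card_prod, Nat.card_congr (monicEquivDegreeLT (k : ℕ)), card_degreeLT]
  ring

lemma card_levelPairs_succ [Finite F] (N : ℕ) : Nat.card (levelPairs F (N + 1)) =
    Nat.card (minimalPairs F (N + 1)) + Nat.card F ^ 2 * Nat.card (levelPairs F N) := by
  rw [card_levelPairs_eq_sum, card_levelPairs_eq_sum, Finset.sum_range_succ', Finset.mul_sum]
  rw [add_comm]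
  congr 1
  · simp
  · refine Finset.sum_congr rfl fun k _ => ?_
    rw [show N + 1 - (k + 1) = N - k by omega]
    ring

/-- The translates of the minimal pairs of level `N` by the `q` monomials `c x ^ (N + 1)` are
disjoint, and none of them is minimal at infinity. -/
lemma card_globallyMinimalPairs_add_le [Finite F] (N : ℕ) :
    Nat.card (globallyMinimalPairs F (N + 1)) + Nat.card F * Nat.card (minimalPairs F N) ≤
      Nat.card (minimalPairs F (N + 1)) := by
  have hlev : ∀ p ∈ levelPairs F N, p ∈ levelPairs F (N + 1) := fun p hp =>
    ⟨hp.1.trans (by omega), hp.2.1.trans (by omega), hp.2.2⟩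
  have hmem : ∀ (c : F) (p : F[X] × F[X]), p ∈ minimalPairs F N →
      shift (-(C c * X ^ (N + 1))) p ∈ minimalPairs F (N + 1) := fun c p hp =>
    ⟨shift_mem_levelPairs (hlev p hp.1)
      (by rw [natDegree_neg]; exact natDegree_C_mul_X_pow_le _ _), hp.2.shift _⟩
  let Φ : globallyMinimalPairs F (N + 1) ⊕ F × minimalPairs F N → minimalPairs F (N + 1) :=
    Sum.elim (fun p => ⟨p.1, p.2.1⟩)
      (fun c => ⟨shift (-(C c.1 * X ^ (N + 1))) c.2.1, hmem _ _ c.2.2⟩)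
  have hΦ : Function.Injective Φ := by
    refine Function.Injective.sumElim ?_ ?_ ?_
    · intro p p' h
      exact Subtype.ext (congrArg (fun u : minimalPairs F (N + 1) => u.1) h)
    · rintro ⟨c, ⟨p, hp⟩⟩ ⟨c', ⟨p', hp'⟩⟩ h0
      have h : shift (-(C c * X ^ (N + 1))) p = shift (-(C c' * X ^ (N + 1))) p' :=
        congrArg (fun u : minimalPairs F (N + 1) => u.1) h0
      clear h0
      -- The two top coefficients give `2c = 2c'` and `c² = c'²`. Together they yield `(c - c')² =
      -- 0`, also in characteristic 2.
      have hcc : c = c' := by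
        have e1 := congrArg (fun r => r.1.coeff (N + 1)) h
        have e2 := congrArg (fun r => r.2.coeff (2 * N + 2)) h
        have z1 : ∀ {u : F[X]}, u.natDegree ≤ N → u.coeff (N + 1) = 0 := fun hu =>
          coeff_eq_zero_of_natDegree_lt (by omega)
        have z2 : ∀ {u : F[X]}, u.natDegree ≤ 2 * N → u.coeff (2 * N + 2) = 0 := fun hu =>
          coeff_eq_zero_of_natDegree_lt (by omega)
        have z3 : ∀ {u : F[X]} (c : F), u.natDegree ≤ N →
            (u * (C c * X ^ (N + 1))).coeff (2 * N + 2) = 0 := fun c hu =>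
          coeff_eq_zero_of_natDegree_lt ((natDegree_mul_le.trans
            (Nat.add_le_add hu (natDegree_C_mul_X_pow_le _ _))).trans_lt (by omega))
        have z4 : ∀ c : F, ((C c * X ^ (N + 1)) ^ 2).coeff (2 * N + 2) = c ^ 2 := fun c => by
          rw [mul_pow, ← C_pow, ← pow_mul, coeff_C_mul, coeff_X_pow, if_pos (by ring), mul_one]
        have z5 : ∀ c : F, (2 * (C c * X ^ (N + 1))).coeff (N + 1) = 2 * c := fun c => by
          rw [← C_ofNat, ← mul_assoc, ← C_mul, coeff_C_mul, coeff_X_pow, if_pos rfl, mul_one]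
        simp only [shift, mul_neg, coeff_add, coeff_sub, coeff_neg, z5, z1 hp.1.1, z1 hp'.1.1,
          zero_add, neg_sq, z4, z3 _ hp.1.1, z3 _ hp'.1.1, z2 hp.1.2.1, z2 hp'.1.2.1] at e1 e2
        have : (c - c') ^ 2 = 0 := by linear_combination e2 - c * e1
        exact sub_eq_zero.1 (pow_eq_zero_iff two_ne_zero |>.1 this)
      subst hcc
      have := congrArg (shift (C c * X ^ (N + 1))) h
      rw [shift_shift_neg, shift_shift_neg] at this
      subst this
      rfl
    · rintro ⟨p, hp⟩ ⟨c, ⟨p', hp'⟩⟩ h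
      have h : p = shift (-(C c * X ^ (N + 1))) p' :=
        congrArg (fun u : minimalPairs F (N + 1) => u.1) h
      apply hp.2 c
      rw [h, shift_shift_neg]
      exact hp'.1
  have := Nat.card_le_card_of_injective Φ hΦ
  rwa [Nat.card_sum, Nat.card_prod] at this

/-- In characteristic 2 the discriminant is `h²`, so `h = 0` and `f` is free; otherwise `f = -h² /
4` and `h` is free. -/
lemma card_discr_eq_zero [Finite F] : (∀ N, Nat.card {p : F[X] × F[X] //
      (p.1.natDegree ≤ N ∧ p.2.natDegree ≤ 2 * N) ∧ discr p = 0} = Nat.card F ^ (N + 1)) ∨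
    (∀ N, Nat.card {p : F[X] × F[X] //
      (p.1.natDegree ≤ N ∧ p.2.natDegree ≤ 2 * N) ∧ discr p = 0} = Nat.card F ^ (2 * N + 1)) := by
  by_cases h2 : (2 : F) = 0
  · right
    intro N
    have h2' : (2 : F[X]) = 0 := by rw [← C_ofNat, h2, C_0]
    have h4' : (4 : F[X]) = 0 := by linear_combination (2 : F[X]) * h2'
    rw [← card_natDegree_le]
    refine Nat.card_congr ⟨fun p => ⟨p.1.2, p.2.1.2⟩, fun f => ⟨(0, f.1), ⟨by simp, f.2⟩, ?_⟩,
      ?_, fun _ => rfl⟩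
    · simp [discr, h4']
    · rintro ⟨⟨h, f⟩, ⟨h1, h2⟩, h3⟩
      have : h = 0 := by simpa [discr, h4'] using h3
      subst this
      rfl
  · left
    intro N
    have h4 : (4 : F) ≠ 0 := by
      intro h
      apply h2
      have : (2 : F) * 2 = 0 := by linear_combination h
      simpa using this
    have h4' : (4 : F[X]) * C (4⁻¹) = 1 := by
      rw [← C_ofNat, ← C_mul, mul_inv_cancel₀ h4, C_1]
    rw [← card_natDegree_le]
    refine Nat.card_congr ⟨fun p => ⟨p.1.1, p.2.1.1⟩, fun h => ⟨(h.1, -(C (4⁻¹) * h.1 ^ 2)),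
      ⟨h.2, ?_⟩, ?_⟩, ?_, fun _ => rfl⟩
    · rw [natDegree_neg]
      exact (natDegree_C_mul_le _ _).trans (natDegree_pow_le_of_le 2 h.2)
    · simp only [discr]
      linear_combination -h.1 ^ 2 * h4'
    · rintro ⟨⟨h, f⟩, ⟨h1, h2⟩, h3⟩
      refine Subtype.ext (Prod.ext rfl ?_)
      simp only [discr] at h3 ⊢
      linear_combination f * h4' - C 4⁻¹ * h3

lemma card_levelPairs_add [Finite F] (N : ℕ) : Nat.card (levelPairs F N) +
    Nat.card {p : F[X] × F[X] // (p.1.natDegree ≤ N ∧ p.2.natDegree ≤ 2 * N) ∧ discr p = 0} =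
      Nat.card F ^ (3 * N + 2) := by
  classical
  have e : {p : F[X] × F[X] // p.1.natDegree ≤ N ∧ p.2.natDegree ≤ 2 * N} ≃
      {p : F[X] // p.natDegree ≤ N} × {p : F[X] // p.natDegree ≤ 2 * N} :=
    Equiv.subtypeProdEquivProd (p := fun p : F[X] => p.natDegree ≤ N)
      (q := fun p : F[X] => p.natDegree ≤ 2 * N)
  have : Finite {p : F[X] × F[X] // p.1.natDegree ≤ N ∧ p.2.natDegree ≤ 2 * N} :=
    Finite.of_equiv _ e.symm
  have hc := Nat.card_congr e
  rw [Nat.card_prod, card_natDegree_le, card_natDegree_le] at hc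
  rw [show 3 * N + 2 = N + 1 + (2 * N + 1) by ring, pow_add, ← hc,
    ← Nat.card_congr (Equiv.sumCompl fun p : {p : F[X] × F[X] //
      p.1.natDegree ≤ N ∧ p.2.natDegree ≤ 2 * N} => discr p.1 = 0), Nat.card_sum, add_comm]
  congr 1
  · exact (Nat.card_congr (Equiv.subtypeSubtypeEquivSubtypeInter _ fun p => discr p = 0)).symm
  · refine (Nat.card_congr ((Equiv.subtypeSubtypeEquivSubtypeInter _
      fun p => ¬ discr p = 0).trans (Equiv.subtypeEquivRight fun p => ?_))).symm
    exact and_assoc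

/-- The bound for the number of Weierstrass equations of level `N ≥ 2`; in fact equality holds. -/
theorem card_globallyMinimalPairs_le [Finite F] (N : ℕ) :
    (Nat.card (globallyMinimalPairs F (N + 2)) : ℝ) ≤
      (Nat.card F : ℝ) ^ (3 * N + 5) * ((Nat.card F : ℝ) - 1) * ((Nat.card F : ℝ) ^ 2 - 1) := by
  have a1 := card_globallyMinimalPairs_add_le (F := F) (N + 1)
  have a2 := card_levelPairs_succ (F := F) N
  have a3 := card_levelPairs_succ (F := F) (N + 1)
  -- The correction `d` is a geometric sequence of ratio `q` or `q²`. The recurrence has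
  -- characteristic polynomial `(T - q²)(T - q)`: the factors come from denominators on the affine
  -- line and from translates at infinity. It kills `d` in both cases, so the final bound does not
  -- depend on the characteristic.
  obtain ⟨d, hd, hd'⟩ : ∃ d : ℕ → ℝ, (∀ M, (Nat.card (levelPairs F M) : ℝ) =
      (Nat.card F : ℝ) ^ (3 * M + 2) - d M) ∧
      d (N + 2) - ((Nat.card F : ℝ) ^ 2 + Nat.card F) * d (N + 1) + (Nat.card F : ℝ) ^ 3 * d N
        = 0 := by
    refine ⟨fun M => (Nat.card {p : F[X] × F[X] //
      (p.1.natDegree ≤ M ∧ p.2.natDegree ≤ 2 * M) ∧ discr p = 0} : ℕ), fun M => ?_, ?_⟩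
    · beta_reduce
      rw [eq_sub_iff_add_eq]
      exact_mod_cast card_levelPairs_add (F := F) M
    · rcases card_discr_eq_zero (F := F) with hd | hd
      · simp only [hd]
        push_cast
        ring
      · simp only [hd]
        push_cast
        ring
  rify at a1 a2 a3
  rw [hd] at a2 a3
  rw [hd] at a2 a3
  simp only [add_assoc, one_add_one_eq_two] at a1 a3
  set q : ℝ := (Nat.card F : ℝ)
  have e0 : q ^ (3 * (N + 1) + 2) = q ^ (3 * N + 2) * q ^ 3 := by ring
  have e1 : q ^ (3 * (N + 2) + 2) = q ^ (3 * N + 2) * q ^ 6 := by ring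
  have e2 : q ^ (3 * N + 5) = q ^ (3 * N + 2) * q ^ 3 := by ring
  rw [e0] at a2 a3
  rw [e1] at a3
  rw [e2]
  linear_combination a1 - a3 + q * a2 - hd'

end Pairs

/-! ### The Jacobian criterion, twists, and the chart at infinity. -/

section Smooth

variable {F : Type*} [Field F]

/-- The norm to `F[x]` of the partial derivative `h' y - f'` with respect to `x` of
`y² + h y - f`. -/
noncomputable def jac (p : F[X] × F[X]) : F[X] :=
  derivative p.2 ^ 2 + derivative p.2 * derivative p.1 * p.1 - derivative p.1 ^ 2 * p.2

/-- The Jacobian criterion for the affine curve `y² + h y = f`, in terms of norms. -/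
def AffineSmooth (p : F[X] × F[X]) : Prop := IsCoprime (discr p) (jac p)

lemma jac_shift (t : F[X]) (p : F[X] × F[X]) : jac (shift t p) =
    jac p - (derivative t * derivative p.1 + derivative t ^ 2) * discr p := by
  have h2 : derivative (2 * t) = 2 * derivative t := by
    rw [← C_ofNat, derivative_C_mul]
  simp only [jac, shift, discr, derivative_sub, derivative_add, derivative_mul, h2,
    derivative_pow]
  push_cast
  simp only [C_ofNat]
  ring

lemma AffineSmooth.affineMinimal {p : F[X] × F[X]} (hp : AffineSmooth p) : AffineMinimal p := by
  intro a t ha1 ha2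
  have hJ : a ∣ jac (shift t p) := by
    obtain ⟨u, hu⟩ := ha1
    obtain ⟨v, hv⟩ := ha2
    refine ⟨(2 * derivative a * v + a * derivative v) * (derivative (a ^ 2 * v) +
      derivative (a * u) * (a * u)) - derivative (a * u) ^ 2 * (a * v), ?_⟩
    have : derivative (a ^ 2 * v) = a * (2 * derivative a * v + a * derivative v) := by
      simp only [derivative_mul, derivative_pow]
      push_cast
      simp only [C_ofNat]
      ring
    rw [jac, hu, hv]
    linear_combination (derivative (a ^ 2 * v) + derivative (a * u) * (a * u)) * this
  have hD : a ∣ discr p := (dvd_pow_self a two_ne_zero).trans (dvd_discr_of_dvd_shift ha1 ha2)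
  refine hp.isUnit_of_dvd' hD ?_
  rw [jac_shift] at hJ
  exact (dvd_sub_left (hD.mul_left _)).1 hJ

/-- Away from characteristic 2 the double root is `-h / 2`. In characteristic 2, `P` divides `h`,
and `f` has a square root in the residue field `F[x] / P` because that field is finite. -/
lemma exists_double_root [Finite F] {p : F[X] × F[X]} {P : F[X]} (hP : Irreducible P)
    (hD : P ∣ discr p) : ∃ t, P ∣ (shift t p).1 ∧ P ∣ (shift t p).2 := by
  by_cases h2 : (2 : F) = 0
  · have h2' : (2 : F[X]) = 0 := by rw [← C_ofNat, h2, C_0]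
    have h1 : P ∣ p.1 := by
      refine hP.prime.dvd_of_dvd_pow (n := 2) ?_
      have : discr p = p.1 ^ 2 := by
        rw [discr]
        linear_combination 2 * p.2 * h2'
      rwa [← this]
    have : Fact (Irreducible P) := ⟨hP⟩
    have : Finite (AdjoinRoot P) := by
      have := (AdjoinRoot.powerBasis hP.ne_zero).finite
      exact Module.finite_of_finite F
    have hchar : ringChar (AdjoinRoot P) = 2 := by
      have : CharP (AdjoinRoot P) 2 := by
        refine CharTwo.of_one_ne_zero_of_two_eq_zero one_ne_zero ?_
        have := congrArg (AdjoinRoot.mk P) h2'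
        rwa [map_ofNat, map_zero] at this
      exact ringChar.eq _ 2
    obtain ⟨s, hs⟩ := FiniteField.isSquare_of_char_two hchar (AdjoinRoot.mk P p.2)
    obtain ⟨t, rfl⟩ := AdjoinRoot.mk_surjective s
    refine ⟨t, ?_, ?_⟩
    · simpa [shift, h2'] using h1
    · have : P ∣ p.2 - t * t := by
        rw [← AdjoinRoot.mk_eq_zero, map_sub, hs, map_mul, sub_self]
      have h3 : (shift t p).2 = p.2 - t * t - p.1 * t := by
        simp only [shift]; ring
      rw [h3]
      exact dvd_sub this (h1.mul_right _)
  · have h4' : (2 : F[X]) * C (2⁻¹) = 1 := by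
      rw [← C_ofNat, ← C_mul, mul_inv_cancel₀ h2, C_1]
    refine ⟨-(C (2⁻¹) * p.1), ?_, ?_⟩
    · have : (shift (-(C (2⁻¹) * p.1)) p).1 = 0 := by
        simp only [shift]
        linear_combination - p.1 * h4'
      rw [this]
      exact dvd_zero _
    · have : (shift (-(C (2⁻¹) * p.1)) p).2 = C 2⁻¹ ^ 2 * discr p := by
        simp only [shift, discr]
        linear_combination (-p.2 * (1 + 2 * C 2⁻¹) - C 2⁻¹ * p.1 ^ 2) * h4'
      rw [this]
      exact hD.mul_left _

/-- Move a singular point over `P` to `y = 0`, so that `P` divides `h`, `f` and `f'`. Since `P` is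
separable, `P²` divides `f`, and `P` is a denominator. -/
lemma affineSmooth_of_affineMinimal [Finite F] {p : F[X] × F[X]} (hp : AffineMinimal p)
    (hD : discr p ≠ 0) : AffineSmooth p := by
  refine isCoprime_of_prime_dvd (fun h => hD h.1) fun P hP h1 h2 => ?_
  obtain ⟨t, ht1, ht2⟩ := exists_double_root hP.irreducible h1
  have hJ : P ∣ jac (shift t p) := by
    rw [jac_shift]
    exact dvd_sub h2 (h1.mul_left _)
  have hder : P ∣ derivative (shift t p).2 := by
    refine hP.dvd_of_dvd_pow (n := 2) ?_
    have : derivative (shift t p).2 ^ 2 = jac (shift t p) -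
        derivative (shift t p).2 * derivative (shift t p).1 * (shift t p).1 +
        derivative (shift t p).1 ^ 2 * (shift t p).2 := by
      rw [jac]; ring
    rw [this]
    exact dvd_add (dvd_sub hJ (ht1.mul_left _)) (ht2.mul_left _)
  refine hP.not_isUnit (hp P t ht1 ?_)
  obtain ⟨v, hv⟩ := ht2
  rw [hv, sq]
  refine mul_dvd_mul_left P ?_
  rw [hv, derivative_mul, dvd_add_left (Dvd.intro _ rfl)] at hder
  have hsep : P.Separable := PerfectField.separable_of_irreducible hP.irreducible
  exact (hP.dvd_mul.1 hder).resolve_left fun h =>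
    hP.not_isUnit (hsep.isUnit_of_dvd' dvd_rfl h)

/-- The coefficients of the quadratic twist of `y² + h y = f` by the extension
`z² + z = γ`. -/
noncomputable def twistPair (γ : F) (p : F[X] × F[X]) : F[X] × F[X] :=
  (p.1, C (1 + 4 * γ) * p.2 + C γ * p.1 ^ 2)

lemma discr_twistPair (γ : F) (p : F[X] × F[X]) :
    discr (twistPair γ p) = C (1 + 4 * γ) * discr p := by
  simp only [discr, twistPair, C_add, C_mul, C_1, C_ofNat]
  ring

lemma jac_twistPair (γ : F) (p : F[X] × F[X]) : jac (twistPair γ p) =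
    C (1 + 4 * γ) ^ 2 * jac p + C γ * C (1 + 4 * γ) * derivative p.1 ^ 2 * discr p := by
  simp only [discr, jac, twistPair, derivative_add, derivative_C_mul, derivative_pow]
  simp only [C_add, C_mul, C_1, C_ofNat]
  push_cast
  simp only [C_ofNat]
  ring

lemma AffineSmooth.twistPair {p : F[X] × F[X]} (hp : AffineSmooth p) {γ : F}
    (hγ : 1 + 4 * γ ≠ 0) : AffineSmooth (twistPair γ p) := by
  have hu : IsUnit (C (1 + 4 * γ)) := isUnit_C.2 hγ.isUnit
  rw [AffineSmooth, discr_twistPair, jac_twistPair, isCoprime_mul_unit_left_left hu]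
  refine IsCoprime.add_mul_right_right ?_ _
  exact (isCoprime_mul_unit_left_right (hu.pow 2) _ _).2 hp

/-- The pair of the chart at infinity, with coordinates `1 / x` and `y / x ^ N`. -/
noncomputable def reversePair (N : ℕ) (p : F[X] × F[X]) : F[X] × F[X] :=
  (reflect N p.1, reflect (2 * N) p.2)

lemma natDegree_reflect_le_of_le {N : ℕ} {p : F[X]} (hp : p.natDegree ≤ N) :
    (reflect N p).natDegree ≤ N := natDegree_reflect_le.trans (max_le le_rfl hp)

lemma reflect_sq {N : ℕ} {p : F[X]} (hp : p.natDegree ≤ N) :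
    reflect (2 * N) (p ^ 2) = reflect N p ^ 2 := by
  rw [two_mul, sq, sq, reflect_mul _ _ hp hp]

lemma discr_reversePair {N : ℕ} {p : F[X] × F[X]} (hp : p.1.natDegree ≤ N) :
    discr (reversePair N p) = reflect (2 * N) (discr p) := by
  have h4 : (4 : F[X]) = C 4 := rfl
  rw [discr, discr, reversePair, reflect_add, reflect_sq hp, h4, reflect_C_mul]

lemma reversePair_mem_levelPairs {N : ℕ} {p : F[X] × F[X]} (hp : p ∈ levelPairs F N) :
    reversePair N p ∈ levelPairs F N := by
  refine ⟨natDegree_reflect_le_of_le hp.1, natDegree_reflect_le_of_le hp.2.1, ?_⟩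
  rw [discr_reversePair hp.1, Ne, reflect_eq_zero_iff]
  exact hp.2.2

lemma twistPair_mem_levelPairs {N : ℕ} {p : F[X] × F[X]} (hp : p ∈ levelPairs F N) {γ : F}
    (hγ : 1 + 4 * γ ≠ 0) : twistPair γ p ∈ levelPairs F N := by
  refine ⟨hp.1, (natDegree_add_le _ _).trans (max_le ?_ ?_), ?_⟩
  · exact (natDegree_C_mul_le _ _).trans hp.2.1
  · exact (natDegree_C_mul_le _ _).trans (natDegree_pow_le_of_le 2 hp.1)
  · rw [discr_twistPair]
    exact mul_ne_zero (C_ne_zero.2 hγ) hp.2.2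

lemma reversePair_twistPair {N : ℕ} {p : F[X] × F[X]} (hp : p.1.natDegree ≤ N) (γ : F) :
    reversePair N (twistPair γ p) = twistPair γ (reversePair N p) := by
  simp only [reversePair, twistPair, reflect_add, reflect_C_mul, reflect_sq hp]

/-- The pair `(h, f)` of level `N` defines a smooth curve in both charts. -/
structure IsSmoothPair (N : ℕ) (p : F[X] × F[X]) : Prop where
  mem : p ∈ levelPairs F N
  smooth : AffineSmooth p
  smooth_reverse : AffineSmooth (reversePair N p)

lemma IsSmoothPair.twist {N : ℕ} {p : F[X] × F[X]} (hp : IsSmoothPair N p) {γ : F}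
    (hγ : 1 + 4 * γ ≠ 0) : IsSmoothPair N (twistPair γ p) :=
  ⟨twistPair_mem_levelPairs hp.mem hγ, hp.smooth.twistPair hγ, by
    rw [reversePair_twistPair hp.mem.1]; exact hp.smooth_reverse.twistPair hγ⟩

/-- The curve is `y² + y = x ^ (2N - 1)`, or `y² + y = x ^ (2N)` when the characteristic divides `2N
- 1`. In the second case `2N = 1` in `F`, so that `N` and `4` are invertible. -/
lemma exists_isSmoothPair (F : Type*) [Field F] {N : ℕ} (hN : 2 ≤ N) :
    ∃ p : F[X] × F[X], IsSmoothPair N p := by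
  have hD : ∀ k : ℕ, discr ((1, X ^ (k + 1)) : F[X] × F[X]) ≠ 0 := fun k h => by
    have := congrArg (eval 0) h
    simp [discr] at this
  have hX : ∀ k : ℕ, IsCoprime (discr ((1, X ^ (k + 1)) : F[X] × F[X])) X := fun k => by
    refine ⟨1, -4 * X ^ k, ?_⟩
    simp only [discr]
    ring
  have hder : ∀ k : ℕ, derivative (X ^ (k + 1) : F[X]) = C ((k : F) + 1) * X ^ k := fun k => by
    rw [derivative_X_pow]
    simp
  obtain ⟨n, rfl⟩ : ∃ n, N = n + 2 := ⟨N - 2, by omega⟩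
  have hs : ∀ k : ℕ, (k : F) + 1 ≠ 0 → AffineSmooth ((1, X ^ (k + 1)) : F[X] × F[X]) := by
    intro k hk
    have hj : jac ((1, X ^ (k + 1)) : F[X] × F[X]) = C (((k : F) + 1) ^ 2) * X ^ (2 * k) := by
      rw [jac, hder, derivative_one, C_pow]
      ring
    rw [AffineSmooth, hj, isCoprime_mul_unit_left_right (isUnit_C.2 (pow_ne_zero 2 hk).isUnit)]
    exact (hX k).pow_right
  by_cases h : ((2 * n + 2 : ℕ) : F) + 1 = 0
  · have hr : reversePair (n + 2) ((1, X ^ (2 * n + 3 + 1)) : F[X] × F[X]) =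
        (X ^ (n + 1 + 1), 1) := by
      rw [reversePair, reflect_one, show 2 * n + 3 + 1 = 2 * (n + 2) by ring, reflect_monomial,
        revAt_le le_rfl]
      simp
    have h1 : ((2 * n + 3 : ℕ) : F) + 1 = 1 := by
      push_cast at h ⊢
      linear_combination h
    have h2 : ((n + 1 : ℕ) : F) + 1 ≠ 0 := by
      intro h0
      apply one_ne_zero (α := F)
      rw [← h1]
      push_cast at h0 ⊢
      linear_combination 2 * h0
    have h4 : (4 : F) ≠ 0 := by
      intro h0
      have : (1 : F) = 4 * ((n : F) + 2) ^ 2 := by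
        push_cast at h1
        linear_combination (-1 - 2 * ((n : F) + 2)) * h1
      rw [h0, zero_mul] at this
      exact one_ne_zero this
    have h4' : (4 : F[X]) * C (4⁻¹) = 1 := by
      rw [← C_ofNat, ← C_mul, mul_inv_cancel₀ h4, C_1]
    refine ⟨(1, X ^ (2 * n + 3 + 1)), ⟨by simp, by simp; omega, hD _⟩, hs _ (by rw [h1]; exact one_ne_zero), ?_⟩
    rw [hr]
    have hj : jac ((X ^ (n + 1 + 1), 1) : F[X] × F[X]) =
        C (-(((n + 1 : ℕ) : F) + 1) ^ 2) * X ^ (2 * n + 2) := by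
      rw [jac, hder, derivative_one, C_neg, C_pow]
      ring
    rw [AffineSmooth, hj, isCoprime_mul_unit_left_right
      (isUnit_C.2 (neg_ne_zero.2 (pow_ne_zero 2 h2)).isUnit)]
    refine IsCoprime.pow_right ⟨C 4⁻¹, -C 4⁻¹ * X ^ (2 * n + 3), ?_⟩
    simp only [discr]
    linear_combination h4'
  · have hr : reversePair (n + 2) ((1, X ^ (2 * n + 2 + 1)) : F[X] × F[X]) =
        (X ^ (n + 1 + 1), X) := by
      rw [reversePair, reflect_one, reflect_monomial, revAt_le (by omega),
        show 2 * (n + 2) - (2 * n + 2 + 1) = 1 by omega, pow_one]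
    refine ⟨(1, X ^ (2 * n + 2 + 1)), ⟨by simp, by simp; omega, hD _⟩, hs _ h, ?_⟩
    rw [hr]
    set m : F := ((n + 1 : ℕ) : F) + 1 - (((n + 1 : ℕ) : F) + 1) ^ 2 with hm
    have hj : jac ((X ^ (n + 1 + 1), X) : F[X] × F[X]) = 1 + C m * X ^ (2 * n + 3) := by
      rw [jac, hder, derivative_X, hm, C_sub, C_pow]
      ring
    have hd : discr ((X ^ (n + 1 + 1), X) : F[X] × F[X]) = X * (X ^ (2 * n + 3) + 4) := by
      simp only [discr]
      ring
    have hu : (C (((2 * n + 2 : ℕ) : F) + 1) * C (((2 * n + 2 : ℕ) : F) + 1)⁻¹ : F[X]) = 1 := by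
      rw [← C_mul, mul_inv_cancel₀ h, C_1]
    -- Modulo the factor `x ^ (2N - 1) + 4` of the discriminant at infinity, the Jacobian norm
    -- reduces to `1 - 4m`; with `m = N - N²` this is the unit `(2N - 1)²`.
    have hmu : (1 - 4 * C m : F[X]) = C (((2 * n + 2 : ℕ) : F) + 1) ^ 2 := by
      rw [← C_pow, ← C_1, ← C_ofNat, ← C_mul, ← C_sub, hm]
      congr 1
      push_cast
      ring
    rw [AffineSmooth, hj, hd]
    refine IsCoprime.mul_left ⟨-C m * X ^ (2 * n + 2), 1, by ring⟩ ?_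
    set u : F[X] := C (((2 * n + 2 : ℕ) : F) + 1)
    set v : F[X] := C (((2 * n + 2 : ℕ) : F) + 1)⁻¹
    refine ⟨-C m * v ^ 2, v ^ 2, ?_⟩
    linear_combination v ^ 2 * hmu + (1 + u * v) * hu

end Smooth

/-! ### Coordinates `x`, `y` on a function field. -/

section Model

variable {F K K' : Type*} [Field F] [Field K] [Algebra F K] [Field K'] [Algebra F K']

/-- The field `K` is the function field of the curve `y² + h y = f` over `F`, a separable double
cover of the `x`-line. -/
structure IsModel (p : F[X] × F[X]) (x y : K) : Prop where
  discr_ne : discr p ≠ 0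
  eqn : y ^ 2 + aeval x p.1 * y = aeval x p.2
  indep : ∀ a b : F[X], aeval x a + aeval x b * y = 0 → a = 0 ∧ b = 0
  gen : ∀ z : K, ∃ a b r : F[X], r ≠ 0 ∧ aeval x r * z = aeval x a + aeval x b * y

namespace IsModel

variable {p : F[X] × F[X]} {x y : K}

lemma aeval_ne_zero (hm : IsModel p x y) {a : F[X]} (ha : a ≠ 0) : aeval x a ≠ 0 := fun h =>
  ha (hm.indep a 0 (by simpa using h)).1

lemma aeval_injective (hm : IsModel p x y) : Function.Injective (aeval x : F[X] →ₐ[F] K) :=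
  (injective_iff_map_eq_zero _).2 fun _ h => by_contra fun ha => hm.aeval_ne_zero ha h

lemma transcendental (hm : IsModel p x y) : Transcendental F x :=
  transcendental_iff.2 fun _ h => by_contra fun ha => hm.aeval_ne_zero ha h

lemma indep' (hm : IsModel p x y) {a b a' b' : F[X]}
    (h : aeval x a + aeval x b * y = aeval x a' + aeval x b' * y) : a = a' ∧ b = b' := by
  have := hm.indep (a - a') (b - b') (by rw [map_sub, map_sub]; linear_combination h)
  exact ⟨sub_eq_zero.1 this.1, sub_eq_zero.1 this.2⟩

lemma x_ne_zero (hm : IsModel p x y) : x ≠ 0 := by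
  simpa using hm.aeval_ne_zero X_ne_zero

lemma two_mul_add_sq (hm : IsModel p x y) : (2 * y + aeval x p.1) ^ 2 = aeval x (discr p) := by
  rw [discr, map_add, map_pow, map_mul, map_ofNat]
  linear_combination 4 * hm.eqn

lemma two_mul_add_ne_zero (hm : IsModel p x y) : 2 * y + aeval x p.1 ≠ 0 := fun h => by
  have := hm.two_mul_add_sq
  rw [h, zero_pow two_ne_zero] at this
  exact hm.aeval_ne_zero hm.discr_ne this.symm

/-- The model for the other root of the equation. -/
lemma conj (hm : IsModel p x y) : IsModel p x (-aeval x p.1 - y) where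
  discr_ne := hm.discr_ne
  eqn := by linear_combination hm.eqn
  indep a b h := by
    have := hm.indep (a - b * p.1) (-b) (by
      rw [map_sub, map_neg, map_mul]; linear_combination h)
    have hb : b = 0 := neg_eq_zero.1 this.2
    exact ⟨by simpa [hb] using this.1, hb⟩
  gen z := by
    obtain ⟨a, b, r, hr, h⟩ := hm.gen z
    refine ⟨a - b * p.1, -b, r, hr, ?_⟩
    rw [map_sub, map_neg, map_mul]; linear_combination h

lemma shift (hm : IsModel p x y) (t : F[X]) : IsModel (shift t p) x (y - aeval x t) where
  discr_ne := by rw [discr_shift]; exact hm.discr_ne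
  eqn := by
    simp only [CurveCount.shift, map_add, map_sub, map_mul, map_pow, map_ofNat]
    linear_combination hm.eqn
  indep a b h := by
    have := hm.indep (a - b * t) b (by rw [map_sub, map_mul]; linear_combination h)
    exact ⟨by simpa [this.2] using this.1, this.2⟩
  gen z := by
    obtain ⟨a, b, r, hr, h⟩ := hm.gen z
    refine ⟨a + b * t, b, r, hr, ?_⟩
    rw [map_add, map_mul]; linear_combination h

lemma of_dilate {a : F[X]} (ha : a ≠ 0) (hm : IsModel (dilate a p) x y) :
    IsModel p x (y / aeval x a) := by
  have ha' := hm.aeval_ne_zero ha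
  have hy : y = aeval x a * (y / aeval x a) := by field_simp
  set w := y / aeval x a
  refine ⟨fun h0 => hm.discr_ne (by rw [discr_dilate, h0, mul_zero]), ?_, ?_, ?_⟩
  · have := hm.eqn
    simp only [dilate, map_mul, map_pow] at this
    refine mul_left_cancel₀ (pow_ne_zero 2 ha') ?_
    rw [hy] at this
    linear_combination this
  · intro b c h
    have := hm.indep (a * b) c (by rw [map_mul, hy]; linear_combination aeval x a * h)
    exact ⟨(mul_eq_zero.1 this.1).resolve_left ha, this.2⟩
  · intro z
    obtain ⟨b, c, r, hr, h⟩ := hm.gen z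
    refine ⟨b, c * a, r, hr, ?_⟩
    rw [h, map_mul, hy]
    ring

lemma scale (hm : IsModel p x y) {e : F} (he : e ≠ 0) :
    IsModel (dilate (C e) p) x (algebraMap F K e * y) := by
  have he' : algebraMap F K e ≠ 0 := by simpa using he
  have hC : aeval x (C e) = algebraMap F K e := aeval_C x e
  refine ⟨?_, ?_, ?_, ?_⟩
  · rw [discr_dilate]
    exact mul_ne_zero (pow_ne_zero _ (C_ne_zero.2 he)) hm.discr_ne
  · simp only [dilate, map_mul, map_pow, hC]
    linear_combination algebraMap F K e ^ 2 * hm.eqn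
  · intro a b h
    have := hm.indep a (b * C e) (by rw [map_mul, hC]; linear_combination h)
    exact ⟨this.1, (mul_eq_zero.1 this.2).resolve_right (C_ne_zero.2 he)⟩
  · intro z
    obtain ⟨a, b, r, hr, h⟩ := hm.gen z
    refine ⟨C e * a, b, C e * r, mul_ne_zero (C_ne_zero.2 he) hr, ?_⟩
    rw [map_mul, map_mul, hC]
    linear_combination algebraMap F K e * h

lemma affine (hm : IsModel p x y) {u : F} (hu : u ≠ 0) (v : F) :
    IsModel (p.1.comp (C u⁻¹ * (X - C v)), p.2.comp (C u⁻¹ * (X - C v)))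
      (algebraMap F K u * x + algebraMap F K v) y := by
  set ℓ : F[X] := C u⁻¹ * (X - C v) with hℓ
  set ℓ' : F[X] := C u * X + C v with hℓ'
  have hcomp : ℓ'.comp ℓ = X := by
    simp only [hℓ, hℓ', add_comp, mul_comp, C_comp, X_comp]
    rw [← mul_assoc, ← C_mul, mul_inv_cancel₀ hu, C_1]
    ring
  have hcomp' : ℓ.comp ℓ' = X := by
    simp only [hℓ, hℓ', mul_comp, sub_comp, C_comp, X_comp]
    rw [add_sub_cancel_right, ← mul_assoc, ← C_mul, inv_mul_cancel₀ hu, C_1, one_mul]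
  have hx' : algebraMap F K u * x + algebraMap F K v = aeval x ℓ' := by simp [hℓ']
  rw [hx']
  have ev : ∀ a : F[X], aeval (aeval x ℓ') a = aeval x (a.comp ℓ') := fun a =>
    (aeval_comp (p := a) (q := ℓ') x).symm
  have ev' : ∀ a : F[X], aeval (aeval x ℓ') (a.comp ℓ) = aeval x a := fun a => by
    rw [ev, comp_assoc, hcomp', comp_X]
  have inj : ∀ a : F[X], a.comp ℓ = 0 → a = 0 := fun a h => by
    rw [← comp_X (p := a), ← hcomp', ← comp_assoc, h, zero_comp]
  have inj' : ∀ a : F[X], a.comp ℓ' = 0 → a = 0 := fun a h => by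
    rw [← comp_X (p := a), ← hcomp, ← comp_assoc, h, zero_comp]
  refine ⟨?_, ?_, ?_, ?_⟩
  · have : discr (p.1.comp ℓ, p.2.comp ℓ) = (discr p).comp ℓ := by
      simp [discr]
    rw [this]
    exact fun h => hm.discr_ne (inj _ h)
  · simp only [ev']
    exact hm.eqn
  · intro a b h
    rw [ev, ev] at h
    have := hm.indep _ _ h
    exact ⟨inj' _ this.1, inj' _ this.2⟩
  · intro z
    obtain ⟨a, b, r, hr, h⟩ := hm.gen z
    exact ⟨a.comp ℓ, b.comp ℓ, r.comp ℓ, fun h => hr (inj _ h), by simpa only [ev'] using h⟩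

end IsModel

lemma aeval_inv_reflect {x : K} (hx : x ≠ 0) {N : ℕ} {a : F[X]} (ha : a.natDegree ≤ N) :
    aeval x⁻¹ (reflect N a) * x ^ N = aeval x a := by
  let _ := invertibleOfNonzero hx
  have := eval₂_reflect_mul_pow (algebraMap F K) x N a ha
  rwa [invOf_eq_inv] at this

lemma IsModel.reverse {p : F[X] × F[X]} {x y : K} (hm : IsModel p x y) {N : ℕ}
    (hp : p ∈ levelPairs F N) : IsModel (reversePair N p) x⁻¹ (y / x ^ N) := by
  have hx := hm.x_ne_zero
  have hxN : x ^ N ≠ 0 := pow_ne_zero _ hx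
  have hy : y = x ^ N * (y / x ^ N) := by field_simp
  set w := y / x ^ N
  have e1 := aeval_inv_reflect hx hp.1
  have e2 := aeval_inv_reflect hx hp.2.1
  refine ⟨(reversePair_mem_levelPairs hp).2.2, ?_, ?_, ?_⟩
  · refine mul_left_cancel₀ (pow_ne_zero 2 hxN) ?_
    have := hm.eqn
    rw [← e1, ← e2, hy] at this
    rw [reversePair]
    ring_nf at this ⊢
    linear_combination this
  · intro a b h
    set M := max a.natDegree b.natDegree
    have ea := aeval_inv_reflect (inv_ne_zero hx) (le_max_left a.natDegree b.natDegree)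
    have eb := aeval_inv_reflect (inv_ne_zero hx) (le_max_right a.natDegree b.natDegree)
    rw [inv_inv] at ea eb
    rw [← ea, ← eb] at h
    have := hm.indep (reflect M a * X ^ N) (reflect M b) (by
      rw [map_mul, map_pow, aeval_X]
      have hM : x⁻¹ ^ M ≠ 0 := pow_ne_zero _ (inv_ne_zero hx)
      refine mul_left_cancel₀ hM ?_
      rw [hy]
      linear_combination x ^ N * h)
    refine ⟨?_, ?_⟩
    · simpa using this.1
    · simpa using this.2
  · intro z
    obtain ⟨a, b, r, hr, h⟩ := hm.gen z
    set M := max (max a.natDegree b.natDegree) r.natDegree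
    have ea := aeval_inv_reflect hx (show a.natDegree ≤ M by simp [M])
    have eb := aeval_inv_reflect hx (show b.natDegree ≤ M by simp [M])
    have er := aeval_inv_reflect hx (show r.natDegree ≤ M by simp [M])
    refine ⟨reflect M a * X ^ N, reflect M b, reflect M r * X ^ N, ?_, ?_⟩
    · exact mul_ne_zero (by simpa using hr) (pow_ne_zero _ X_ne_zero)
    · rw [map_mul, map_mul, map_pow, aeval_X]
      have hM : x ^ M ≠ 0 := pow_ne_zero _ hx
      have hxx : x⁻¹ ^ N * x ^ N = 1 := by rw [← mul_pow, inv_mul_cancel₀ hx, one_pow]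
      rw [← ea, ← eb, ← er, hy] at h
      refine mul_left_cancel₀ hM ?_
      linear_combination x⁻¹ ^ N * h + aeval x⁻¹ (reflect M b) * w * x ^ M * hxx

section Universal

variable (p : F[X] × F[X])

/-- The defining polynomial of `y` over `F(x)`. -/
noncomputable def defPoly : (RatFunc F)[X] :=
  X ^ 2 + C (algebraMap F[X] (RatFunc F) p.1) * X - C (algebraMap F[X] (RatFunc F) p.2)

/-- The function ring `F(x)[y]`. -/
abbrev FunctionRing : Type _ := AdjoinRoot (defPoly p)

/-- The element `x` of `F(x)[y]`. -/
noncomputable def ratX : FunctionRing p := algebraMap (RatFunc F) _ RatFunc.X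

/-- The element `y` of `F(x)[y]`. -/
noncomputable def rootY : FunctionRing p := AdjoinRoot.root _

lemma natDegree_defPoly : (defPoly p).natDegree = 2 := by
  rw [defPoly]
  compute_degree!

lemma defPoly_monic : (defPoly p).Monic := by
  have := natDegree_defPoly p
  rw [Monic, leadingCoeff, this, defPoly]
  simp

lemma aeval_ratX (a : F[X]) : aeval (ratX p) a =
    algebraMap (RatFunc F) (FunctionRing p) (algebraMap F[X] (RatFunc F) a) := by
  rw [ratX, aeval_algebraMap_apply, ← RatFunc.algebraMap_X, aeval_algebraMap_apply]
  simp

lemma eval₂_defPoly {S : Type*} [CommRing S] (i : RatFunc F →+* S) (w : S) :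
    eval₂ i w (defPoly p) = w ^ 2 + i (algebraMap F[X] (RatFunc F) p.1) * w -
      i (algebraMap F[X] (RatFunc F) p.2) := by
  simp [defPoly]

lemma rootY_eqn : rootY p ^ 2 + aeval (ratX p) p.1 * rootY p = aeval (ratX p) p.2 := by
  have := AdjoinRoot.eval₂_root (defPoly p)
  rw [eval₂_defPoly, sub_eq_zero] at this
  rw [aeval_ratX, aeval_ratX]
  exact this

lemma functionRing_gen (z : FunctionRing p) : ∃ a b r : F[X], r ≠ 0 ∧
    aeval (ratX p) r * z = aeval (ratX p) a + aeval (ratX p) b * rootY p := by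
  obtain ⟨s, rfl⟩ := AdjoinRoot.mk_surjective z
  obtain ⟨u, v, huv⟩ : ∃ u v : RatFunc F, AdjoinRoot.mk (defPoly p) s =
      algebraMap (RatFunc F) (FunctionRing p) u +
        algebraMap (RatFunc F) (FunctionRing p) v * rootY p := by
    have hdeg : (s %ₘ defPoly p).degree < 2 := by
      have := degree_modByMonic_lt s (defPoly_monic p)
      rwa [degree_eq_natDegree (defPoly_monic p).ne_zero, natDegree_defPoly] at this
    refine ⟨(s %ₘ defPoly p).coeff 0, (s %ₘ defPoly p).coeff 1, ?_⟩
    have h1 : s %ₘ defPoly p = C ((s %ₘ defPoly p).coeff 1) * X + C ((s %ₘ defPoly p).coeff 0) :=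
      eq_X_add_C_of_degree_le_one (Order.le_of_lt_succ hdeg)
    have h2 : AdjoinRoot.mk (defPoly p) s = AdjoinRoot.mk (defPoly p) (s %ₘ defPoly p) := by
      conv_lhs => rw [← modByMonic_add_div s (defPoly p)]
      simp
    rw [h2, h1, map_add, map_mul, AdjoinRoot.mk_C, AdjoinRoot.mk_C, AdjoinRoot.mk_X, add_comm]
    simp [rootY, AdjoinRoot.algebraMap_eq]
  refine ⟨u.num * v.denom, v.num * u.denom, u.denom * v.denom,
    mul_ne_zero u.denom_ne_zero v.denom_ne_zero, ?_⟩
  have hnum : ∀ u : RatFunc F, algebraMap F[X] (RatFunc F) u.denom * u =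
      algebraMap F[X] (RatFunc F) u.num := fun u => by
    have h0 : algebraMap F[X] (RatFunc F) u.denom ≠ 0 :=
      RatFunc.algebraMap_ne_zero u.denom_ne_zero
    rw [mul_comm]
    exact ((div_eq_iff h0).1 (RatFunc.num_div_denom u)).symm
  have hu : algebraMap F[X] (RatFunc F) u.denom * u = algebraMap F[X] (RatFunc F) u.num := hnum u
  have hv : algebraMap F[X] (RatFunc F) v.denom * v = algebraMap F[X] (RatFunc F) v.num := hnum v
  rw [huv]
  simp only [aeval_ratX, map_mul]
  rw [← hu, ← hv]
  simp only [map_mul]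
  ring

lemma isModel_functionRing [Fact (Irreducible (defPoly p))] (hD : discr p ≠ 0) :
    IsModel p (ratX p) (rootY p) where
  discr_ne := hD
  eqn := rootY_eqn p
  indep a b h := by
    set a' := algebraMap F[X] (RatFunc F) a
    set b' := algebraMap F[X] (RatFunc F) b
    have h1 : AdjoinRoot.mk (defPoly p) (C a' + C b' * X) = 0 := by
      rw [aeval_ratX, aeval_ratX] at h
      rw [map_add, map_mul, AdjoinRoot.mk_C, AdjoinRoot.mk_C, AdjoinRoot.mk_X]
      exact h
    have h2 : C a' + C b' * X = 0 := by
      refine eq_zero_of_dvd_of_natDegree_lt (AdjoinRoot.mk_eq_zero.1 h1) ?_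
      rw [natDegree_defPoly, add_comm]
      exact natDegree_linear_le.trans_lt one_lt_two
    have ha : a' = 0 := by simpa using congrArg (coeff · 0) h2
    have hb : b' = 0 := by simpa [coeff_C] using congrArg (coeff · 1) h2
    exact ⟨(map_eq_zero_iff _ (RatFunc.algebraMap_injective F)).1 ha,
      (map_eq_zero_iff _ (RatFunc.algebraMap_injective F)).1 hb⟩
  gen := functionRing_gen p

end Universal

namespace IsModel

variable {p : F[X] × F[X]} {x y : K}

lemma nonZeroDivisors_le (hm : IsModel p x y) :
    nonZeroDivisors F[X] ≤ Submonoid.comap (aeval x : F[X] →ₐ[F] K) (nonZeroDivisors K) :=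
  fun _ ha => mem_nonZeroDivisors_of_ne_zero (hm.aeval_ne_zero (nonZeroDivisors.ne_zero ha))

/-- The embedding of `F(x)` into the function field of a model. -/
noncomputable def ratHom (hm : IsModel p x y) : RatFunc F →ₐ[F] K :=
  RatFunc.liftAlgHom (aeval x) hm.nonZeroDivisors_le

lemma ratHom_algebraMap (hm : IsModel p x y) (a : F[X]) :
    hm.ratHom (algebraMap F[X] (RatFunc F) a) = aeval x a := by
  have := RatFunc.liftAlgHom_apply_div (aeval x : F[X] →ₐ[F] K) hm.nonZeroDivisors_le a 1
  rwa [map_one, map_one, div_one, div_one] at this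

/-- The map from `F(x)[y]` to the function field of a model. -/
noncomputable def lift (hm : IsModel p x y) : FunctionRing p →ₐ[F] K :=
  AdjoinRoot.liftAlgHom (defPoly p) hm.ratHom y (by
    rw [eval₂_defPoly]
    simp only [RingHom.coe_coe, ratHom_algebraMap]
    rw [hm.eqn, sub_self])

lemma lift_rootY (hm : IsModel p x y) : hm.lift (rootY p) = y := by
  rw [lift, rootY]
  simp

lemma lift_ratX (hm : IsModel p x y) : hm.lift (ratX p) = x := by
  have : hm.lift (ratX p) = hm.ratHom RatFunc.X := by
    rw [lift, ratX, AdjoinRoot.algebraMap_eq]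
    simp
  rw [this, ← RatFunc.algebraMap_X, ratHom_algebraMap, aeval_X]

/-- Nonzero polynomials in `x` are invertible in `F(x)[y]`, so injectivity reduces to the
independence of `1` and `y`. Irreducibility of the defining polynomial is not needed. -/
lemma lift_bijective (hm : IsModel p x y) : Function.Bijective hm.lift := by
  have hev : ∀ a : F[X], hm.lift (aeval (ratX p) a) = aeval x a := fun a => by
    rw [← aeval_algHom_apply, lift_ratX]
  have hunit : ∀ a : F[X], a ≠ 0 → IsUnit (aeval (ratX p) a) := fun a ha => by
    rw [aeval_ratX]
    exact (RatFunc.algebraMap_ne_zero ha).isUnit.map _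
  constructor
  · refine (injective_iff_map_eq_zero _).2 fun z hz => ?_
    obtain ⟨a, b, r, hr, h⟩ := functionRing_gen p z
    have h' := congrArg hm.lift h
    rw [map_mul, hz, mul_zero, map_add, map_mul, hev, hev, lift_rootY] at h'
    obtain ⟨rfl, rfl⟩ := hm.indep a b h'.symm
    rw [map_zero, zero_mul, add_zero] at h
    exact (hunit r hr).mul_right_eq_zero.1 h
  · intro z
    obtain ⟨a, b, r, hr, h⟩ := hm.gen z
    obtain ⟨u, hu⟩ := hunit r hr
    refine ⟨u⁻¹ * (aeval (ratX p) a + aeval (ratX p) b * rootY p), ?_⟩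
    refine mul_left_cancel₀ (hm.aeval_ne_zero hr) ?_
    rw [h, ← hev r, ← map_mul, ← hu, Units.mul_inv_cancel_left, map_add, map_mul, hev, hev,
      lift_rootY]

/-- Function fields with the same model are isomorphic. -/
lemma exists_algEquiv {x' y' : K'} (hm : IsModel p x y) (hm' : IsModel p x' y') :
    ∃ e : K ≃ₐ[F] K', e x = x' ∧ e y = y' := by
  refine ⟨(AlgEquiv.ofBijective _ hm.lift_bijective).symm.trans
    (AlgEquiv.ofBijective _ hm'.lift_bijective), ?_, ?_⟩
  · have : (AlgEquiv.ofBijective _ hm.lift_bijective).symm x = ratX p := by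
      rw [AlgEquiv.symm_apply_eq]
      exact hm.lift_ratX.symm
    rw [AlgEquiv.trans_apply, this]
    exact hm'.lift_ratX
  · have : (AlgEquiv.ofBijective _ hm.lift_bijective).symm y = rootY p := by
      rw [AlgEquiv.symm_apply_eq]
      exact hm.lift_rootY.symm
    rw [AlgEquiv.trans_apply, this]
    exact hm'.lift_rootY

lemma map (hm : IsModel p x y) (e : K ≃ₐ[F] K') : IsModel p (e x) (e y) where
  discr_ne := hm.discr_ne
  eqn := by
    have := congrArg e hm.eqn
    simpa [aeval_algHom_apply] using this
  indep a b h := by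
    refine hm.indep a b (e.injective ?_)
    simpa [aeval_algHom_apply] using h
  gen z := by
    obtain ⟨a, b, r, hr, h⟩ := hm.gen (e.symm z)
    refine ⟨a, b, r, hr, ?_⟩
    have := congrArg e h
    simpa [aeval_algHom_apply] using this

lemma algHom_ext (hm : IsModel p x y) {e e' : K →ₐ[F] K'} (hx : e x = e' x) (hy : e y = e' y) :
    e = e' := by
  ext z
  obtain ⟨a, b, r, hr, h⟩ := hm.gen z
  have hr' : e (aeval x r) ≠ 0 := by
    simpa using hm.aeval_ne_zero hr
  have h1 := congrArg e h
  have h2 := congrArg e' h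
  simp only [map_mul, map_add, ← aeval_algHom_apply, hx, hy] at h1 h2 hr'
  exact mul_left_cancel₀ hr' (h1.trans h2.symm)

end IsModel

end Model

/-! ### Normality of the affine chart; quadratic extensions of `F(x)`. -/

section Integral

variable {F K : Type*} [Field F] [Field K] [Algebra F K] {p : F[X] × F[X]} {x y : K}

open scoped IntermediateField.algebraAdjoinAdjoin
open IntermediateField

lemma mem_adjoin_iff_aeval {x z : K} :
    z ∈ Algebra.adjoin F {x} ↔ ∃ a : F[X], aeval x a = z := by
  rw [Algebra.adjoin_singleton_eq_range_aeval]
  rfl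

lemma isPrincipalIdealRing_adjoin (x : K) : IsPrincipalIdealRing (Algebra.adjoin F {x}) := by
  let φ : F[X] →ₐ[F] Algebra.adjoin F {x} :=
    (aeval x).codRestrict _ fun a => mem_adjoin_iff_aeval.2 ⟨a, rfl⟩
  refine IsPrincipalIdealRing.of_surjective φ.toRingHom ?_
  rintro ⟨z, hz⟩
  obtain ⟨a, ha⟩ := mem_adjoin_iff_aeval.1 hz
  exact ⟨a, Subtype.ext ha⟩

/-- Rational functions in `x` which are integral over `F[x]` are polynomials. -/
lemma exists_aeval_eq_of_isIntegral {x z : K} {a r : F[X]} (hr : aeval x r ≠ 0)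
    (h : aeval x r * z = aeval x a) (hz : IsIntegral (Algebra.adjoin F {x}) z) :
    ∃ b : F[X], aeval x b = z := by
  have := isPrincipalIdealRing_adjoin (F := F) x
  have hzL : z ∈ F⟮x⟯ := by
    rw [show z = aeval x a / aeval x r by rw [← h]; field_simp]
    exact (mem_adjoin_simple_iff F _).2 ⟨a, r, rfl⟩
  have hz' : IsIntegral (Algebra.adjoin F {x}) (⟨z, hzL⟩ : F⟮x⟯) :=
    (isIntegral_algHom_iff (IsScalarTower.toAlgHom (Algebra.adjoin F {x}) F⟮x⟯ K)
      (algebraMap F⟮x⟯ K).injective).1 hz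
  obtain ⟨w, hw⟩ := IsIntegrallyClosed.isIntegral_iff.1 hz'
  obtain ⟨b, hb⟩ := mem_adjoin_iff_aeval.1 w.2
  exact ⟨b, hb.trans (congrArg Subtype.val hw)⟩

namespace IsModel

lemma algebraMap_adjoin (a : F[X]) :
    ∃ s : Algebra.adjoin F {x}, algebraMap (Algebra.adjoin F {x}) K s = aeval x a :=
  ⟨⟨_, mem_adjoin_iff_aeval.2 ⟨a, rfl⟩⟩, rfl⟩

lemma isIntegral_aeval (a : F[X]) : IsIntegral (Algebra.adjoin F {x}) (aeval x a) := by
  obtain ⟨s, hs⟩ := algebraMap_adjoin (x := x) a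
  rw [← hs]
  exact isIntegral_algebraMap

lemma isIntegral_of_sq {z : K} {a b : F[X]} (h : z ^ 2 + aeval x a * z = aeval x b) :
    IsIntegral (Algebra.adjoin F {x}) z := by
  obtain ⟨s, hs⟩ := algebraMap_adjoin (x := x) a
  obtain ⟨t, ht⟩ := algebraMap_adjoin (x := x) b
  refine ⟨X ^ 2 + C s * X - C t, by monicity!, ?_⟩
  simp only [eval₂_sub, eval₂_add, eval₂_mul, eval₂_C, eval₂_X, eval₂_pow, hs, ht]
  linear_combination h

lemma isIntegral_y (hm : IsModel p x y) : IsIntegral (Algebra.adjoin F {x}) y :=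
  isIntegral_of_sq hm.eqn

/-- The affine coordinate ring of an affinely minimal model is integrally closed. -/
lemma exists_of_isIntegral (hm : IsModel p x y) (hp : AffineMinimal p) {z : K}
    (hz : IsIntegral (Algebra.adjoin F {x}) z) :
    ∃ a b : F[X], z = aeval x a + aeval x b * y := by
  classical
  obtain ⟨a, b, r, hr, h⟩ := hm.gen z
  have hr' := hm.aeval_ne_zero hr
  obtain ⟨r0, hr0⟩ := EuclideanDomain.gcd_dvd_left r b
  obtain ⟨b0, hb0⟩ := EuclideanDomain.gcd_dvd_right r b
  have hgcd := EuclideanDomain.gcd_eq_gcd_ab r b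
  set d := EuclideanDomain.gcd r b
  set v := EuclideanDomain.gcdA r b
  set u := EuclideanDomain.gcdB r b
  have hd0 : d ≠ 0 := by
    intro h0
    exact hr (by rw [hr0, h0, zero_mul])
  have hr00 : r0 ≠ 0 := by
    rintro rfl
    exact hr (by rw [hr0, mul_zero])
  have hd' := hm.aeval_ne_zero hd0
  have hr0' := hm.aeval_ne_zero hr00
  -- the element `w` has the form `(y - t) / r0` with `t` in `F(x)`
  set w := aeval x u * z + aeval x v * y with hw
  have hwint : IsIntegral (Algebra.adjoin F {x}) w :=
    ((isIntegral_aeval u).mul hz).add ((isIntegral_aeval v).mul hm.isIntegral_y)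
  set t := y - aeval x r0 * w with ht
  have htd : aeval x d * t = aeval x (-(u * a)) := by
    have e1 : aeval x r = aeval x d * aeval x r0 := by rw [hr0, map_mul]
    have e3 : aeval x d = aeval x r * aeval x v + aeval x b * aeval x u := by
      rw [← map_mul, ← map_mul, ← map_add, ← hgcd]
    rw [ht, hw, map_neg, map_mul]
    linear_combination (aeval x u * z + aeval x v * y) * e1 + y * e3 - aeval x u * h
  -- Conjugation fixes `F(x)`, hence `t`. The trace and norm of `w` are thus integral elements of
  -- `F(x)`, that is, polynomials `T` and `N`.
  obtain ⟨σ, hσx, hσy⟩ := hm.exists_algEquiv hm.conj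
  have hσa : ∀ c : F[X], σ (aeval x c) = aeval x c := fun c => by
    rw [← aeval_algHom_apply, hσx]
  have hσint : ∀ {w : K}, IsIntegral (Algebra.adjoin F {x}) w →
      IsIntegral (Algebra.adjoin F {x}) (σ w) := by
    rintro w ⟨g, hg, hgw⟩
    refine ⟨g, hg, ?_⟩
    have := congrArg σ hgw
    rw [map_zero] at this
    rw [← this]
    have h3 := hom_eval₂ g (algebraMap (Algebra.adjoin F {x}) K) (σ : K →+* K) w
    simp only [RingHom.coe_coe] at h3
    rw [h3]
    congr 1
    ext ⟨s, hs⟩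
    obtain ⟨c, rfl⟩ := mem_adjoin_iff_aeval.1 hs
    exact (hσa c).symm
  have hσt : σ t = t := by
    refine mul_left_cancel₀ hd' ?_
    rw [htd, ← hσa d, ← map_mul, htd, hσa]
  have hw' : aeval x r0 * w = y - t := by rw [ht]; ring
  have hσw : aeval x r0 * σ w = σ y - t := by
    have := congrArg σ hw'
    rwa [map_sub, map_mul, hσt, hσa] at this
  have htint : IsIntegral (Algebra.adjoin F {x}) t :=
    hm.isIntegral_y.sub ((isIntegral_aeval r0).mul hwint)
  obtain ⟨τ, hτ⟩ := exists_aeval_eq_of_isIntegral hd' htd htint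
  obtain ⟨T, hT⟩ : ∃ T : F[X], aeval x T = w + σ w := by
    refine exists_aeval_eq_of_isIntegral (r := r0) (a := -p.1 - 2 * τ) hr0' ?_
      (hwint.add (hσint hwint))
    rw [map_sub, map_neg, map_mul, map_ofNat, hτ]
    linear_combination hw' + hσw + hσy
  obtain ⟨N, hN⟩ : ∃ N : F[X], aeval x N = w * σ w := by
    refine exists_aeval_eq_of_isIntegral (r := r0 ^ 2) (a := -p.2 + τ * p.1 + τ ^ 2)
      (by rw [map_pow]; exact pow_ne_zero 2 hr0') ?_ (hwint.mul (hσint hwint))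
    simp only [map_add, map_neg, map_mul, map_pow, hτ]
    linear_combination aeval x r0 * σ w * hw' + (y - t) * hσw + (y - t) * hσy - hm.eqn
  -- The coefficients of the quadratic equation of `w = (y - τ) / r0` are polynomials, so `r0` is a
  -- denominator for `p`.
  have hunit : IsUnit r0 := by
    refine hp r0 τ (Dvd.intro (-T) (hm.aeval_injective ?_)) (Dvd.intro (-N) (hm.aeval_injective ?_))
    · simp only [CurveCount.shift, map_add, map_neg, map_mul, map_ofNat, hT, hτ]
      linear_combination -hw' - hσw - hσy
    · simp only [CurveCount.shift, map_sub, map_neg, map_mul, map_pow, hN, hτ]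
      linear_combination -aeval x r0 * σ w * hw' - (y - t) * hσw - (y - t) * hσy + hm.eqn
  obtain ⟨s, hs⟩ := hunit.exists_right_inv
  have hs' : aeval x r0 * aeval x s = 1 := by rw [← map_mul, hs, map_one]
  obtain ⟨c, hc⟩ : ∃ c : F[X], aeval x c = z - aeval x (s * b0) * y := by
    refine exists_aeval_eq_of_isIntegral (r := d) (a := s * a) hd' ?_
      (hz.sub ((isIntegral_aeval _).mul hm.isIntegral_y))
    rw [hr0, hb0, map_mul, map_mul] at h
    rw [map_mul, map_mul]
    linear_combination aeval x s * h - aeval x d * z * hs'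
  exact ⟨c, s * b0, by rw [hc]; ring⟩

lemma exists_aeval_eq_mul_of_mem (z : K) (hz : z ∈ F⟮x⟯) :
    ∃ a r : F[X], aeval x r ≠ 0 ∧ aeval x r * z = aeval x a := by
  obtain ⟨a, r, rfl⟩ := (mem_adjoin_simple_iff F _).1 hz
  by_cases h : aeval x r = 0
  · exact ⟨0, 1, by simp, by simp [h]⟩
  · exact ⟨a, r, h, by field_simp⟩

lemma aeval_mem_adjoin (x : K) (a : F[X]) : aeval x a ∈ F⟮x⟯ :=
  algebra_adjoin_le_adjoin F {x} (mem_adjoin_iff_aeval.2 ⟨a, rfl⟩)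

lemma adjoin_y_eq_top (hm : IsModel p x y) : F⟮x⟯⟮y⟯ = ⊤ := by
  rw [eq_top_iff]
  rintro z -
  obtain ⟨a, b, r, hr, h⟩ := hm.gen z
  have hmem : ∀ c : F[X], aeval x c ∈ F⟮x⟯⟮y⟯ := fun c =>
    (F⟮x⟯⟮y⟯).algebraMap_mem (⟨_, aeval_mem_adjoin x c⟩ : F⟮x⟯)
  have hr' := hm.aeval_ne_zero hr
  rw [show z = (aeval x a + aeval x b * y) / aeval x r by rw [← h]; field_simp]
  exact div_mem (add_mem (hmem a) (mul_mem (hmem b) (mem_adjoin_simple_self _ y))) (hmem r)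

lemma minpoly_dvd (hm : IsModel p x y) : ∃ g : F⟮x⟯[X], g.natDegree = 2 ∧ g.Monic ∧
    g.Separable ∧ minpoly F⟮x⟯ y ∣ g := by
  set h : F⟮x⟯ := ⟨_, aeval_mem_adjoin x p.1⟩ with hh
  set f : F⟮x⟯ := ⟨_, aeval_mem_adjoin x p.2⟩ with hf
  refine ⟨X ^ 2 + C h * X - C f, by compute_degree!, by monicity!, ?_, minpoly.dvd _ _ ?_⟩
  · have hD : h ^ 2 + 4 * f ≠ 0 := by
      intro h0
      apply hm.aeval_ne_zero hm.discr_ne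
      have := congrArg (algebraMap F⟮x⟯ K) h0
      rw [map_add, map_pow, map_mul, map_ofNat, map_zero] at this
      rw [discr, map_add, map_mul, map_pow, map_ofNat]
      exact this
    have hD' : C ((h ^ 2 + 4 * f)⁻¹) * (C h ^ 2 + 4 * C f) = 1 := by
      rw [← C_ofNat, ← C_pow, ← C_mul, ← C_add, ← C_mul, inv_mul_cancel₀ hD, C_1]
    -- This is the identity `(2Y + h)² - 4 (Y² + hY - f) = h² + 4f`, divided by the discriminant.
    refine ⟨-4 * C (h ^ 2 + 4 * f)⁻¹, C (h ^ 2 + 4 * f)⁻¹ * (2 * X + C h), ?_⟩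
    simp only [derivative_sub, derivative_add, derivative_mul, derivative_X, derivative_C,
      derivative_pow]
    push_cast
    simp only [C_ofNat]
    linear_combination hD'
  · simp only [map_sub, map_add, map_mul, map_pow, aeval_X, aeval_C]
    change y ^ 2 + aeval x p.1 * y - aeval x p.2 = 0
    rw [hm.eqn, sub_self]

lemma isIntegral_field (hm : IsModel p x y) : IsIntegral F⟮x⟯ y := by
  obtain ⟨g, -, hg, -, hd⟩ := hm.minpoly_dvd
  refine minpoly.ne_zero_iff.1 fun h0 => hg.ne_zero ?_
  rw [h0] at hd
  exact zero_dvd_iff.1 hd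

lemma finrank_eq_two (hm : IsModel p x y) : Module.finrank F⟮x⟯ K = 2 := by
  obtain ⟨g, hg2, hg, -, hd⟩ := hm.minpoly_dvd
  have h1 : (minpoly F⟮x⟯ y).natDegree ≤ 2 := hg2 ▸ natDegree_le_of_dvd hd hg.ne_zero
  have h2 : 2 ≤ (minpoly F⟮x⟯ y).natDegree := by
    rw [minpoly.two_le_natDegree_iff hm.isIntegral_field]
    rintro ⟨⟨w, hw⟩, rfl⟩
    obtain ⟨a, r, hr, h⟩ := exists_aeval_eq_mul_of_mem w hw
    have := hm.indep a (-r) (by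
      rw [map_neg, ← h]
      change _ + - aeval x r * w = 0
      ring)
    apply hr
    rw [neg_eq_zero.1 this.2, map_zero]
  rw [← finrank_top', ← hm.adjoin_y_eq_top, adjoin.finrank hm.isIntegral_field]
  omega

lemma isSeparable (hm : IsModel p x y) : Algebra.IsSeparable F⟮x⟯ K := by
  obtain ⟨g, -, -, hg, hd⟩ := hm.minpoly_dvd
  have h : Algebra.IsSeparable F⟮x⟯ F⟮x⟯⟮y⟯ :=
    (isSeparable_adjoin_simple_iff_isSeparable _ _).2 (hg.of_dvd hd)
  rw [hm.adjoin_y_eq_top] at h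
  exact AlgEquiv.Algebra.isSeparable topEquiv

lemma finiteDimensional (hm : IsModel p x y) : FiniteDimensional F⟮x⟯ K :=
  Module.finite_of_finrank_pos (by rw [hm.finrank_eq_two]; norm_num)

end IsModel

lemma exists_isModel {x : K} (hx : Transcendental F x) (h2 : Module.finrank F⟮x⟯ K = 2)
    (hs : Algebra.IsSeparable F⟮x⟯ K) : ∃ p y, IsModel (F := F) p x y := by
  have hev : ∀ a : F[X], aeval x a = 0 → a = 0 := fun a => transcendental_iff.1 hx a
  have hfin : FiniteDimensional F⟮x⟯ K := Module.finite_of_finrank_pos (by omega)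
  obtain ⟨y0, hy0⟩ : ∃ y0 : K, y0 ∉ (algebraMap F⟮x⟯ K).range := by
    by_contra! h
    have : (⊥ : IntermediateField F⟮x⟯ K) = ⊤ := eq_top_iff.2 fun z _ => mem_bot.2 (h z)
    have h1 := IntermediateField.finrank_bot (F := F⟮x⟯) (E := K)
    rw [this, finrank_top', h2] at h1
    omega
  have hint : IsIntegral F⟮x⟯ y0 := IsIntegral.of_finite _ _
  have hd2 : (minpoly F⟮x⟯ y0).natDegree = 2 := by
    refine le_antisymm ?_ ((minpoly.two_le_natDegree_iff hint).2 hy0)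
    rw [← h2]
    exact minpoly.natDegree_le y0
  have htop : F⟮x⟯⟮y0⟯ = ⊤ := by
    refine eq_of_le_of_finrank_eq le_top ?_
    rw [finrank_top', h2, adjoin.finrank hint, hd2]
  set c1 := (minpoly F⟮x⟯ y0).coeff 1
  set c0 := (minpoly F⟮x⟯ y0).coeff 0
  have hmin : minpoly F⟮x⟯ y0 = X ^ 2 + C c1 * X + C c0 := by
    have hmon := minpoly.monic hint
    rw [Monic, leadingCoeff, hd2] at hmon
    rw [(minpoly F⟮x⟯ y0).as_sum_range_C_mul_X_pow, hd2]
    simp only [Finset.sum_range_succ, Finset.sum_range_zero, hmon]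
    simp only [C_1, c1, c0]
    ring
  have heq : y0 ^ 2 + algebraMap F⟮x⟯ K c1 * y0 + algebraMap F⟮x⟯ K c0 = 0 := by
    have := minpoly.aeval F⟮x⟯ y0
    rw [hmin] at this
    simpa using this
  have hder : 2 * y0 + algebraMap F⟮x⟯ K c1 ≠ 0 := by
    have := (Algebra.IsSeparable.isSeparable F⟮x⟯ y0).aeval_derivative_ne_zero
      (minpoly.aeval F⟮x⟯ y0)
    have hd : derivative (X ^ 2 + C c1 * X + C c0) = 2 * X + C c1 := by
      simp only [derivative_add, derivative_mul, derivative_X, derivative_C, derivative_pow]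
      push_cast
      simp only [C_ofNat]
      ring
    rwa [hmin, hd, map_add, map_mul, map_ofNat, aeval_X, aeval_C] at this
  obtain ⟨a1, r1, hr1, h1⟩ := IsModel.exists_aeval_eq_mul_of_mem (algebraMap F⟮x⟯ K c1) c1.2
  obtain ⟨a0, r0, hr0, h0⟩ := IsModel.exists_aeval_eq_mul_of_mem (algebraMap F⟮x⟯ K c0) c0.2
  have hrr : aeval x (r0 * r1) ≠ 0 := by
    rw [map_mul]
    exact mul_ne_zero hr0 hr1
  -- The factor `r0 r1` clears the denominators `r1` and `r0` of the linear and constant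
  -- coefficients of the minimal polynomial.
  set y := aeval x (r0 * r1) * y0 with hy
  have heqn : y ^ 2 + aeval x (a1 * r0) * y = aeval x (-(a0 * r0 * r1 ^ 2)) := by
    simp only [hy, map_neg, map_mul, map_pow]
    rw [← h1, ← h0]
    linear_combination aeval x r0 ^ 2 * aeval x r1 ^ 2 * heq
  have hynot : ∀ a b : F[X], aeval x a + aeval x b * y = 0 → a = 0 ∧ b = 0 := by
    intro a b h
    have hb : b = 0 := by
      by_contra hb
      apply hy0
      have hb' : aeval x b ≠ 0 := fun h => hb (hev b h)
      refine ⟨⟨-aeval x a / (aeval x b * aeval x (r0 * r1)), div_mem (neg_mem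
        (IsModel.aeval_mem_adjoin x a)) (mul_mem (IsModel.aeval_mem_adjoin x b)
        (IsModel.aeval_mem_adjoin x _))⟩, ?_⟩
      change -aeval x a / (aeval x b * aeval x (r0 * r1)) = y0
      rw [div_eq_iff (mul_ne_zero hb' hrr)]
      linear_combination -h + aeval x b * hy
    subst hb
    exact ⟨hev a (by simpa using h), rfl⟩
  refine ⟨(a1 * r0, -(a0 * r0 * r1 ^ 2)), y, ?_, heqn, hynot, ?_⟩
  · intro hD
    have h3 : (2 * y + aeval x (a1 * r0)) ^ 2 = 0 := by
      have := congrArg (aeval x) hD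
      simp only [discr, map_add, map_mul, map_pow, map_ofNat, map_neg, map_zero] at this heqn ⊢
      linear_combination 4 * heqn + this
    have h4 : 2 * y + aeval x (a1 * r0) = 0 := pow_eq_zero_iff two_ne_zero |>.1 h3
    refine hder (mul_left_cancel₀ hrr ?_)
    rw [mul_zero, ← h4, hy, map_mul, map_mul]
    linear_combination aeval x r0 * h1
  · intro z
    have hz : z ∈ F⟮x⟯⟮y0⟯ := htop ▸ mem_top
    obtain ⟨g, hg⟩ : ∃ g : F⟮x⟯[X], aeval y0 g = z := by
      have : z ∈ (F⟮x⟯⟮y0⟯).toSubalgebra := hz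
      rw [adjoin_simple_toSubalgebra_of_isAlgebraic hint.isAlgebraic,
        Algebra.adjoin_singleton_eq_range_aeval] at this
      exact this
    have hz' : z = algebraMap F⟮x⟯ K ((g %ₘ minpoly F⟮x⟯ y0).coeff 0) +
        algebraMap F⟮x⟯ K ((g %ₘ minpoly F⟮x⟯ y0).coeff 1) * y0 := by
      have hdeg : (g %ₘ minpoly F⟮x⟯ y0).degree < 2 := by
        have := degree_modByMonic_lt g (minpoly.monic hint)
        rwa [degree_eq_natDegree (minpoly.monic hint).ne_zero, hd2] at this
      have h1 := eq_X_add_C_of_degree_le_one (Order.le_of_lt_succ hdeg)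
      have h2 := congrArg (aeval y0) (modByMonic_add_div g (minpoly F⟮x⟯ y0))
      rw [map_add, map_mul, minpoly.aeval, zero_mul, add_zero, hg, h1] at h2
      rw [← h2]
      simp [add_comm]
    set u := (g %ₘ minpoly F⟮x⟯ y0).coeff 0
    set v := (g %ₘ minpoly F⟮x⟯ y0).coeff 1
    obtain ⟨b, s, hs, hu⟩ := IsModel.exists_aeval_eq_mul_of_mem (algebraMap F⟮x⟯ K u) u.2
    obtain ⟨c, t, ht, hv⟩ := IsModel.exists_aeval_eq_mul_of_mem (algebraMap F⟮x⟯ K v) v.2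
    refine ⟨b * t * (r0 * r1), c * s, s * t * (r0 * r1), ?_, ?_⟩
    · intro h
      have := congrArg (aeval x) h
      rw [map_mul, map_mul, map_zero] at this
      exact mul_ne_zero (mul_ne_zero hs ht) hrr this
    · simp only [hz', hy, map_mul]
      linear_combination aeval x t * (aeval x r0 * aeval x r1) * hu +
        aeval x s * (aeval x r0 * aeval x r1) * y0 * hv

section Local

/-- In the discrete valuation ring at `P` one of `a`, `b` divides the other; the denominator of the
quotient is cleared. -/
lemma exists_mul_eq_mul_of_isDedekindDomain {A : Type*} [CommRing A] [IsDedekindDomain A]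
    {P : Ideal A} [P.IsPrime] (hP : P ≠ ⊥) (a b : A) :
    ∃ s t : A, t ∉ P ∧ (a * s = b * t ∨ b * s = a * t) := by
  have := IsLocalization.AtPrime.isDiscreteValuationRing_of_dedekind_domain A hP
    (Localization.AtPrime P)
  have hinj := IsLocalization.injective (Localization.AtPrime P) P.primeCompl_le_nonZeroDivisors
  obtain ⟨c, hc⟩ := ValuationRing.cond (algebraMap A (Localization.AtPrime P) a)
    (algebraMap A (Localization.AtPrime P) b)
  obtain ⟨⟨s, t⟩, hst⟩ := IsLocalization.surj P.primeCompl c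
  refine ⟨s, t, t.2, hc.imp (fun h => hinj ?_) (fun h => hinj ?_)⟩
  · rw [map_mul, map_mul, ← h, ← hst]
    ring
  · rw [map_mul, map_mul, ← h, ← hst]
    ring

variable {O : ValuationSubring K}

lemma mem_of_isIntegral_adjoin (hF : ∀ a : F, algebraMap F K a ∈ O) (hx : x ∈ O) {z : K}
    (hz : IsIntegral (Algebra.adjoin F {x}) z) : z ∈ O := by
  have hle : ∀ s ∈ Algebra.adjoin F {x}, s ∈ O := fun s hs => by
    obtain ⟨a, rfl⟩ := mem_adjoin_iff_aeval.1 hs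
    induction a using Polynomial.induction_on' with
    | add a b ha hb =>
      rw [map_add]
      exact add_mem (ha (mem_adjoin_iff_aeval.2 ⟨a, rfl⟩)) (hb (mem_adjoin_iff_aeval.2 ⟨b, rfl⟩))
    | monomial n c =>
      rw [aeval_monomial]
      exact mul_mem (hF c) (pow_mem hx n)
  have : IsIntegral O z := by
    obtain ⟨g, hg, hgz⟩ := hz
    let i : Algebra.adjoin F {x} →+* O :=
      ((algebraMap (Algebra.adjoin F {x}) K).codRestrict O.toSubring fun s => hle s s.2)
    refine ⟨g.map i, hg.map i, ?_⟩
    rw [eval₂_map]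
    exact hgz
  obtain ⟨w, rfl⟩ := IsIntegrallyClosed.isIntegral_iff.1 this
  exact w.2

namespace IsModel

lemma aeval_mem (hF : ∀ a : F, algebraMap F K a ∈ O) (hx : x ∈ O) (a : F[X]) : aeval x a ∈ O :=
  mem_of_isIntegral_adjoin hF hx (isIntegral_aeval a)

lemma y_mem (hm : IsModel p x y) (hF : ∀ a : F, algebraMap F K a ∈ O) (hx : x ∈ O) : y ∈ O :=
  mem_of_isIntegral_adjoin hF hx hm.isIntegral_y

/-- The local ring of a point on a normal affine curve is a localization of the coordinate
ring. -/
lemma exists_mul_eq_of_mem (hm : IsModel p x y) (hp : AffineMinimal p)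
    (hF : ∀ a : F, algebraMap F K a ∈ O) (hx : x ∈ O) {z : K} (hz : z ∈ O) :
    ∃ a b c d : F[X], O.valuation (aeval x c + aeval x d * y) = 1 ∧
      (aeval x c + aeval x d * y) * z = aeval x a + aeval x b * y := by
  have := isPrincipalIdealRing_adjoin (F := F) x
  have := hm.isSeparable
  have := hm.finiteDimensional
  have : IsDedekindDomain (integralClosure (Algebra.adjoin F {x}) K) :=
    integralClosure.isDedekindDomain (Algebra.adjoin F {x}) F⟮x⟯ K
  set B := integralClosure (Algebra.adjoin F {x}) K
  have hBO : ∀ b : B, (b : K) ∈ O := fun b => mem_of_isIntegral_adjoin hF hx b.2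
  let i : B →+* O := (algebraMap B K).codRestrict O.toSubring hBO
  -- `P` is the centre of `O` on the normal affine curve: elements of `B` outside `P` are units of
  -- `O`.
  let P : Ideal B := (IsLocalRing.maximalIdeal O).comap i
  have hP : ∀ b : B, b ∉ P → O.valuation (b : K) = 1 := fun b hb => by
    have h1 : ¬ O.valuation (b : K) < 1 := fun h => hb ((O.valuation_lt_one_iff (i b)).2 h)
    exact le_antisymm ((O.valuation_le_one_iff _).2 (hBO b)) (not_lt.1 h1)
  obtain ⟨a, b, r, hr, h⟩ := hm.gen z
  have hr' := hm.aeval_ne_zero hr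
  let u : B := ⟨aeval x a + aeval x b * y,
    (isIntegral_aeval a).add ((isIntegral_aeval b).mul hm.isIntegral_y)⟩
  let v : B := ⟨aeval x r, isIntegral_aeval r⟩
  have hu : (u : K) = v * z := h.symm
  suffices ∃ s t : B, t ∉ P ∧ (t : K) * z = s by
    obtain ⟨s, t, ht, hst⟩ := this
    obtain ⟨a', b', hs⟩ := hm.exists_of_isIntegral hp s.2
    obtain ⟨c', d', ht'⟩ := hm.exists_of_isIntegral hp t.2
    refine ⟨a', b', c', d', ?_, ?_⟩
    · rw [← ht']
      exact hP t ht
    · rw [← hs, ← ht', hst]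
  by_cases hP0 : P = ⊥
  · refine ⟨u, v, ?_, hu.symm⟩
    rw [hP0, Ideal.mem_bot]
    exact fun h0 => hr' (congrArg Subtype.val h0)
  · obtain ⟨s, t, ht, hst⟩ := exists_mul_eq_mul_of_isDedekindDomain hP0 u v
    have hv0 : (v : K) ≠ 0 := hr'
    rcases hst with hst | hst
    · -- here `z * s = t`, so that `s` is a unit at `O`
      have h1 : z * s = t := by
        have := congrArg (fun b : B => (b : K)) hst
        simp only [MulMemClass.coe_mul, hu] at this
        refine mul_left_cancel₀ hv0 ?_
        linear_combination this
      have hs : s ∉ P := by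
        intro hs
        apply ht
        have h2 : i t = ⟨z, hz⟩ * i s := Subtype.ext h1.symm
        change i t ∈ IsLocalRing.maximalIdeal O
        rw [h2]
        exact Ideal.mul_mem_left _ _ hs
      exact ⟨t, s, hs, by rw [← h1]; ring⟩
    · refine ⟨s, t, ht, ?_⟩
      have := congrArg (fun b : B => (b : K)) hst
      simp only [MulMemClass.coe_mul, hu] at this
      refine mul_left_cancel₀ hv0 ?_
      linear_combination -this

end IsModel

end Local

end Integral

/-! ### Differentials regular on an affine chart. -/

section Differentials

variable {F K : Type*} [Field F] [Field K] [Algebra F K] {p : F[X] × F[X]} {x y : K}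

open scoped IntermediateField.algebraAdjoinAdjoin
open IntermediateField

/-- The differential `dx / (2 y + h)`. -/
noncomputable def basicDifferential (p : F[X] × F[X]) (x y : K) : Ω[K⁄F] :=
  (2 * y + aeval x p.1)⁻¹ • KaehlerDifferential.D F K x

local notation "dd" => KaehlerDifferential.D F K

namespace IsModel

lemma D_x (hm : IsModel p x y) :
    dd x = (2 * y + aeval x p.1) • basicDifferential p x y := by
  rw [basicDifferential, smul_smul, mul_inv_cancel₀ hm.two_mul_add_ne_zero, one_smul]

lemma D_aeval (hm : IsModel p x y) (a : F[X]) : dd (aeval x a) =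
    (aeval x (derivative a) * (2 * y + aeval x p.1)) • basicDifferential p x y := by
  rw [Derivation.map_aeval, hm.D_x, smul_smul]

lemma D_y (hm : IsModel p x y) : dd y =
    (aeval x (derivative p.2) - aeval x (derivative p.1) * y) • basicDifferential p x y := by
  have h := congrArg dd hm.eqn
  rw [map_add, Derivation.leibniz, sq, Derivation.leibniz, hm.D_aeval, hm.D_aeval, smul_smul] at h
  have h0 := hm.two_mul_add_ne_zero
  have h1 : (2 * y + aeval x p.1) • dd y = (2 * y + aeval x p.1) •
      (aeval x (derivative p.2) - aeval x (derivative p.1) * y) • basicDifferential p x y := by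
    have e : (2 * y + aeval x p.1) • dd y = (y • dd y + y • dd y + (aeval x p.1 • dd y +
      (y * (aeval x (derivative p.1) * (2 * y + aeval x p.1))) • basicDifferential p x y)) -
      (y * (aeval x (derivative p.1) * (2 * y + aeval x p.1))) • basicDifferential p x y := by
      module
    rw [e, h]
    module
  have := congrArg (fun ω => (2 * y + aeval x p.1)⁻¹ • ω) h1
  simpa only [inv_smul_smul₀ h0] using this

/-- The derivative of a function in the coordinate ring. -/
lemma D_coord (hm : IsModel p x y) (a b : F[X]) : dd (aeval x a + aeval x b * y) =
    ((aeval x (derivative a) + aeval x (derivative b) * y) * (2 * y + aeval x p.1) +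
      aeval x b * (aeval x (derivative p.2) - aeval x (derivative p.1) * y)) •
        basicDifferential p x y := by
  rw [map_add, Derivation.leibniz, hm.D_aeval, hm.D_aeval, hm.D_y]
  module

lemma D_of_mul_eq (hm : IsModel p x y) {a b c d : F[X]} {z : K}
    (hr : aeval x c + aeval x d * y ≠ 0)
    (h : (aeval x c + aeval x d * y) * z = aeval x a + aeval x b * y) :
    dd z = ((aeval x c + aeval x d * y)⁻¹ *
      (((aeval x (derivative a) + aeval x (derivative b) * y) * (2 * y + aeval x p.1) +
      aeval x b * (aeval x (derivative p.2) - aeval x (derivative p.1) * y)) -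
      z * ((aeval x (derivative c) + aeval x (derivative d) * y) * (2 * y + aeval x p.1) +
      aeval x d * (aeval x (derivative p.2) - aeval x (derivative p.1) * y)))) •
        basicDifferential p x y := by
  have h1 := congrArg dd h
  rw [Derivation.leibniz, hm.D_coord, hm.D_coord] at h1
  rw [mul_smul, sub_smul, ← h1, mul_smul z, add_sub_cancel_right, inv_smul_smul₀ hr]

lemma exists_smul_basicDifferential (hm : IsModel p x y) (ω : Ω[K⁄F]) :
    ∃ u : K, ω = u • basicDifferential p x y := by
  have hω : ω ∈ Submodule.span K (Set.range dd) := by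
    rw [KaehlerDifferential.span_range_derivation]
    trivial
  induction hω using Submodule.span_induction with
  | mem ω h =>
    obtain ⟨z, rfl⟩ := h
    obtain ⟨a, b, r, hr, h⟩ := hm.gen z
    have hr' : aeval x r + aeval x (0 : F[X]) * y ≠ 0 := by
      simpa using hm.aeval_ne_zero hr
    exact ⟨_, hm.D_of_mul_eq hr' (by simpa using h)⟩
  | zero => exact ⟨0, (zero_smul _ _).symm⟩
  | add ω₁ ω₂ _ _ h₁ h₂ =>
    obtain ⟨u, rfl⟩ := h₁
    obtain ⟨v, rfl⟩ := h₂
    exact ⟨u + v, (add_smul _ _ _).symm⟩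
  | smul c ω _ h =>
    obtain ⟨u, rfl⟩ := h
    exact ⟨c * u, smul_smul _ _ _⟩

/-- If it vanished, there would be no nonzero differentials, and the finitely generated extension `K
/ F` would be unramified, hence algebraic, although `x` is transcendental. -/
lemma basicDifferential_ne_zero (hm : IsModel p x y) : basicDifferential p x y ≠ 0 := by
  intro h0
  have hsub : Subsingleton (Ω[K⁄F]) := ⟨fun a b => by
    obtain ⟨u, rfl⟩ := hm.exists_smul_basicDifferential a
    obtain ⟨v, rfl⟩ := hm.exists_smul_basicDifferential b
    rw [h0, smul_zero, smul_zero]⟩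
  have : Algebra.FormallyUnramified F K := ⟨hsub⟩
  have := hm.finiteDimensional
  have : Algebra.EssFiniteType F F⟮x⟯ :=
    essFiniteType_iff.2 ⟨{x}, by simp⟩
  have : Algebra.EssFiniteType F K := .comp F F⟮x⟯ K
  have := Algebra.FormallyUnramified.isSeparable F K
  exact hm.transcendental (Algebra.IsAlgebraic.isAlgebraic x)

variable {O : ValuationSubring K}

/-- The `O`-module generated by the differentials of elements of `O`, for a point of a smooth
affine chart. -/
lemma mem_span_iff (hm : IsModel p x y) (hp : AffineSmooth p)
    (hF : ∀ a : F, algebraMap F K a ∈ O) (hx : x ∈ O) (ω : Ω[K⁄F]) :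
    ω ∈ Submodule.span F {ω | ∃ s ∈ O, ∃ t ∈ O, ω = s • dd t} ↔
      ∃ u ∈ O, ω = u • basicDifferential p x y := by
  have hA : ∀ a : F[X], aeval x a ∈ O := aeval_mem hF hx
  have hy := hm.y_mem hF hx
  have h2 : (2 : K) ∈ O := by
    have := add_mem O.one_mem O.one_mem
    rwa [one_add_one_eq_two] at this
  have hFy : 2 * y + aeval x p.1 ∈ O := add_mem (mul_mem h2 hy) (hA _)
  constructor
  · intro h
    induction h using Submodule.span_induction with
    | mem ω h =>
      obtain ⟨s, hs, t, ht, rfl⟩ := h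
      obtain ⟨a, b, c, d, hr, h⟩ := hm.exists_mul_eq_of_mem hp.affineMinimal hF hx ht
      have hr0 : aeval x c + aeval x d * y ≠ 0 := by
        intro h0
        rw [h0, map_zero] at hr
        exact zero_ne_one hr
      have hrinv : (aeval x c + aeval x d * y)⁻¹ ∈ O := by
        rw [← O.valuation_le_one_iff, map_inv₀, hr, inv_one]
      rw [hm.D_of_mul_eq hr0 h, smul_smul]
      have hc : ∀ a b : F[X], (aeval x (derivative a) + aeval x (derivative b) * y) *
          (2 * y + aeval x p.1) +
          aeval x b * (aeval x (derivative p.2) - aeval x (derivative p.1) * y) ∈ O := fun a b =>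
        add_mem (mul_mem (add_mem (hA _) (mul_mem (hA _) hy)) hFy)
          (mul_mem (hA _) (sub_mem (hA _) (mul_mem (hA _) hy)))
      exact ⟨_, mul_mem hs (mul_mem hrinv (sub_mem (hc a b) (mul_mem ht (hc c d)))), rfl⟩
    | zero => exact ⟨0, O.zero_mem, (zero_smul _ _).symm⟩
    | add ω₁ ω₂ _ _ h₁ h₂ =>
      obtain ⟨u, hu, rfl⟩ := h₁
      obtain ⟨v, hv, rfl⟩ := h₂
      exact ⟨u + v, add_mem hu hv, (add_smul _ _ _).symm⟩
    | smul c ω _ h =>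
      obtain ⟨u, hu, rfl⟩ := h
      refine ⟨algebraMap F K c * u, mul_mem (hF c) hu, ?_⟩
      rw [mul_smul, algebraMap_smul]
  · rintro ⟨u, hu, rfl⟩
    obtain ⟨U, V, hUV⟩ := hp
    -- The Bézout relation between discriminant and Jacobian norm expresses `1` through `2y + h` and
    -- `f' - h' y`. These are the coefficients of `dx` and `dy` with respect to the basic
    -- differential, which is therefore an `O`-combination of `dx` and `dy`.
    have h1 : aeval x U * (2 * y + aeval x p.1) ^ 2 + aeval x V *
        ((aeval x (derivative p.2) - aeval x (derivative p.1) * y) *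
        (aeval x (derivative p.2) + aeval x (derivative p.1) * (aeval x p.1 + y))) = 1 := by
      have := congrArg (aeval x) hUV
      rw [map_add, map_mul, map_mul, map_one, ← hm.two_mul_add_sq, jac] at this
      simp only [map_add, map_sub, map_mul, map_pow] at this
      linear_combination this - aeval x V * aeval x (derivative p.1) ^ 2 * hm.eqn
    have h3 : u • basicDifferential p x y =
        (u * (aeval x U * (2 * y + aeval x p.1))) • dd x +
        (u * (aeval x V * (aeval x (derivative p.2) + aeval x (derivative p.1) *
          (aeval x p.1 + y)))) • dd y := by
      rw [hm.D_y, hm.D_x, smul_smul, smul_smul, ← add_smul]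
      congr 1
      linear_combination -u * h1
    rw [h3]
    refine add_mem (Submodule.subset_span ⟨_, ?_, x, hx, rfl⟩)
      (Submodule.subset_span ⟨_, ?_, y, hy, rfl⟩)
    · exact mul_mem hu (mul_mem (hA _) hFy)
    · exact mul_mem hu (mul_mem (hA _) (add_mem (hA _) (mul_mem (hA _) (add_mem (hA _) hy))))

/-- Functions that are regular on an affine chart. -/
lemma exists_of_forall_mem (hm : IsModel p x y) (hp : AffineMinimal p) {z : K}
    (hz : ∀ O : ValuationSubring K, (∀ a : F, algebraMap F K a ∈ O) → x ∈ O → O ≠ ⊤ → z ∈ O) :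
    ∃ a b : F[X], z = aeval x a + aeval x b * y := by
  refine hm.exists_of_isIntegral hp ?_
  by_contra hint
  set B := integralClosure (Algebra.adjoin F {x}) K
  have : IsIntegrallyClosedIn B.toSubring K :=
    inferInstanceAs (IsIntegrallyClosedIn B K)
  obtain ⟨V, hV, hzV⟩ := Subring.exists_le_valuationSubring_of_isIntegrallyClosedIn
    (R := B.toSubring) (x := z) hint
  have hA : ∀ a : F[X], aeval x a ∈ V := fun a => hV (isIntegral_aeval a)
  refine hzV (hz V (fun a => ?_) ?_ ?_)
  · simpa using hA (C a)
  · simpa using hA X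
  · rintro rfl
    exact hzV trivial

/-- Here `d(1/x) = -x⁻² dx`, while `2y + h` is divided by `x ^ N`. The factor `-x ^ (N - 2)` is what
bounds the degree of `a` in `a(x) dx / (2y + h)`. -/
lemma basicDifferential_reverse (hm : IsModel p x y) {N : ℕ} (hp : p ∈ levelPairs F N) :
    basicDifferential (reversePair N p) x⁻¹ (y / x ^ N) =
      (-(x ^ N * x⁻¹ ^ 2)) • basicDifferential p x y := by
  have hx := hm.x_ne_zero
  have h0 := hm.two_mul_add_ne_zero
  have hxN : x ^ N ≠ 0 := pow_ne_zero _ hx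
  have e1 : 2 * (y / x ^ N) + aeval x⁻¹ (reversePair N p).1 =
      (2 * y + aeval x p.1) / x ^ N := by
    rw [reversePair, ← aeval_inv_reflect hx hp.1]
    field_simp
  have e2 : dd x⁻¹ = (-x⁻¹ ^ 2) • dd x := by
    rw [Derivation.leibniz_inv]
  rw [basicDifferential, e1, e2, hm.D_x, smul_smul, smul_smul]
  congr 1
  field_simp

end IsModel

end Differentials

/-! ### The space of regular differentials and the genus. -/

section Genus

variable {F : Type u} [Field F] {C : Curve F} {p : F[X] × F[X]} {x y : C.K} {N : ℕ}

namespace IsModel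

/-- The coefficient `u` of the differential must lie in `F[x, y]`, and `u x ^ (2 - N)` in `F[1/x, y
/ x ^ N]`. Comparing degrees in `x` kills the `y`-part and leaves polynomials of degree at most `N -
2`. -/
lemma mem_regularDifferentials_iff (hm : IsModel p x y) (hp : IsSmoothPair N p)
    (ω : Ω[C.K⁄F]) : ω ∈ C.regularDifferentials ↔
      ∃ a : F[X], a.degree < (N - 1 : ℕ) ∧ ω = aeval x a • basicDifferential p x y := by
  have hx := hm.x_ne_zero
  have hm' := hm.reverse hp.mem
  have hrev := hm.basicDifferential_reverse hp.mem
  have hω0 := hm.basicDifferential_ne_zero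
  have hxN : x ^ N ≠ 0 := pow_ne_zero _ hx
  simp only [Curve.regularDifferentials, Submodule.mem_iInf]
  constructor
  · intro h
    obtain ⟨u, rfl⟩ := hm.exists_smul_basicDifferential ω
    obtain ⟨a, b, hab⟩ := hm.exists_of_forall_mem hp.smooth.affineMinimal (z := u)
      fun O hF hxO hO => by
        obtain ⟨v, hv, h⟩ := (hm.mem_span_iff hp.smooth hF hxO _).1 (h O ⟨hF, hO⟩)
        rwa [smul_left_injective _ hω0 h]
    obtain ⟨a', b', hab'⟩ := hm'.exists_of_forall_mem hp.smooth_reverse.affineMinimal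
      (z := -(u * (x ^ 2 * x⁻¹ ^ N))) fun O hF hxO hO => by
        obtain ⟨v, hv, h⟩ := (hm'.mem_span_iff hp.smooth_reverse hF hxO _).1 (h O ⟨hF, hO⟩)
        rw [hrev, smul_smul] at h
        have h' := smul_left_injective _ hω0 h
        have : -(u * (x ^ 2 * x⁻¹ ^ N)) = v := by
          have e1 : x * x⁻¹ = 1 := mul_inv_cancel₀ hx
          have e2 : x ^ N * x⁻¹ ^ N = 1 := by rw [← mul_pow, e1, one_pow]
          rw [h']
          linear_combination v * ((x * x⁻¹ + 1) * (x ^ N * x⁻¹ ^ N) * e1 + e2)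
        rwa [this]
    set M := max a'.natDegree b'.natDegree
    have ea := aeval_inv_reflect (N := M) (inv_ne_zero hx) (le_max_left a'.natDegree b'.natDegree)
    have eb := aeval_inv_reflect (N := M) (inv_ne_zero hx) (le_max_right a'.natDegree b'.natDegree)
    rw [inv_inv] at ea eb
    rw [← ea, ← eb, hab] at hab'
    have key := hm.indep' (a := a * X ^ (M + 2)) (b := b * X ^ (M + 2))
      (a' := -(reflect M a' * X ^ N)) (b' := -reflect M b') (by
        simp only [map_mul, map_neg, map_pow, aeval_X]
        have hMM : x ^ M * x⁻¹ ^ M = 1 := by rw [← mul_pow, mul_inv_cancel₀ hx, one_pow]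
        have hNN : x ^ N * x⁻¹ ^ N = 1 := by rw [← mul_pow, mul_inv_cancel₀ hx, one_pow]
        have hdiv : y / x ^ N = y * x⁻¹ ^ N := by rw [inv_pow, div_eq_mul_inv]
        rw [hdiv] at hab'
        linear_combination -x ^ M * x ^ N * hab' -
          (aeval x a + aeval x b * y) * x ^ (M + 2) * hNN -
          aeval x (reflect M a') * x ^ N * hMM -
          aeval x (reflect M b') * y * (hMM + x ^ M * x⁻¹ ^ M * hNN))
    have hM : ∀ c : F[X], c.natDegree ≤ M → (reflect M c).natDegree ≤ M := fun c hc =>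
      natDegree_reflect_le_of_le hc
    have hb : b = 0 := by
      by_contra hb
      have h1 := congrArg natDegree key.2
      rw [natDegree_mul hb (pow_ne_zero _ X_ne_zero), natDegree_X_pow, natDegree_neg] at h1
      have := hM b' (le_max_right _ _)
      omega
    refine ⟨a, ?_, by rw [hab, hb, map_zero, zero_mul, add_zero]⟩
    by_cases ha : a = 0
    · rw [ha, degree_zero]
      exact WithBot.bot_lt_coe _
    rw [← natDegree_lt_iff_degree_lt ha]
    have h1 := congrArg natDegree key.1
    rw [natDegree_mul ha (pow_ne_zero _ X_ne_zero), natDegree_X_pow, natDegree_neg] at h1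
    have h2 := hM a' (le_max_left _ _)
    have h3 : (reflect M a' * X ^ N).natDegree ≤ M + N :=
      natDegree_mul_le.trans (by rw [natDegree_X_pow]; omega)
    omega
  · rintro ⟨a, ha, rfl⟩ O ⟨hF, hO⟩
    by_cases hxO : x ∈ O
    · exact (hm.mem_span_iff hp.smooth hF hxO _).2 ⟨_, aeval_mem hF hxO a, rfl⟩
    · have hxO' : x⁻¹ ∈ O := (O.mem_or_inv_mem x).resolve_left hxO
      refine (hm'.mem_span_iff hp.smooth_reverse hF hxO' _).2
        ⟨aeval x⁻¹ (-reflect (N - 2) a), aeval_mem hF hxO' _, ?_⟩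
      rw [hrev, smul_smul]
      by_cases ha0 : a = 0
      · simp [ha0]
      have hdeg := (natDegree_lt_iff_degree_lt ha0).2 ha
      obtain ⟨k, rfl⟩ : ∃ k, N = k + 2 := ⟨N - 2, by omega⟩
      rw [← aeval_inv_reflect hx (show a.natDegree ≤ k by omega)]
      congr 1
      rw [map_neg, add_tsub_cancel_right]
      have hxx : x * x⁻¹ = 1 := mul_inv_cancel₀ hx
      linear_combination -aeval x⁻¹ (reflect k a) * x ^ k * (x * x⁻¹ + 1) * hxx

lemma genus_eq (hm : IsModel p x y) (hp : IsSmoothPair N p) : C.genus = N - 1 := by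
  let φ : degreeLT F (N - 1) →ₗ[F] Ω[C.K⁄F] :=
    ((LinearMap.toSpanSingleton C.K (Ω[C.K⁄F]) (basicDifferential p x y)).restrictScalars F).comp
      ((aeval x : F[X] →ₐ[F] C.K).toLinearMap.comp (degreeLT F (N - 1)).subtype)
  have hφ : ∀ a, φ a = aeval x a.1 • basicDifferential p x y := fun a => rfl
  have hinj : Function.Injective φ := fun a b h => by
    rw [hφ, hφ] at h
    exact Subtype.ext (hm.aeval_injective
      (smul_left_injective _ hm.basicDifferential_ne_zero h))
  have hrange : LinearMap.range φ = C.regularDifferentials := by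
    ext ω
    rw [hm.mem_regularDifferentials_iff hp]
    constructor
    · rintro ⟨a, rfl⟩
      exact ⟨a.1, mem_degreeLT.1 a.2, hφ a⟩
    · rintro ⟨a, ha, rfl⟩
      exact ⟨⟨a, mem_degreeLT.2 ha⟩, hφ _⟩
  rw [Curve.genus, ← hrange, LinearMap.finrank_range_of_inj hinj,
    (degreeLTEquiv F (N - 1)).finrank_eq]
  simp

end IsModel

end Genus

/-! ### The field of constants; existence of the curve of a smooth pair. -/

section Constants

variable {F K : Type*} [Field F] [Field K] [Algebra F K] {p : F[X] × F[X]} {x y : K} {N : ℕ}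

/-- An algebraic element is integral over `F[x]` and over `F[1/x]`, hence regular on both charts;
the comparison of degrees leaves only constants. -/
lemma IsModel.exists_algebraMap_eq (hm : IsModel p x y) (hp : IsSmoothPair N p) (hN : 1 ≤ N) {z : K}
    (hz : IsAlgebraic F z) : ∃ a : F, algebraMap F K a = z := by
  have hx := hm.x_ne_zero
  have hint : ∀ w : K, IsIntegral (Algebra.adjoin F {w}) z := fun w => hz.isIntegral.tower_top
  obtain ⟨a, b, hab⟩ := hm.exists_of_isIntegral hp.smooth.affineMinimal (hint x)
  obtain ⟨a', b', hab'⟩ := (hm.reverse hp.mem).exists_of_isIntegral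
    hp.smooth_reverse.affineMinimal (hint x⁻¹)
  set M := max a'.natDegree b'.natDegree
  have ea := aeval_inv_reflect (N := M) (inv_ne_zero hx) (le_max_left a'.natDegree b'.natDegree)
  have eb := aeval_inv_reflect (N := M) (inv_ne_zero hx) (le_max_right a'.natDegree b'.natDegree)
  rw [inv_inv] at ea eb
  rw [← ea, ← eb, hab] at hab'
  have key := hm.indep' (a := a * X ^ (M + N)) (b := b * X ^ (M + N))
    (a' := reflect M a' * X ^ N) (b' := reflect M b') (by
      simp only [map_mul, map_pow, aeval_X]
      have hMM : x ^ M * x⁻¹ ^ M = 1 := by rw [← mul_pow, mul_inv_cancel₀ hx, one_pow]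
      have hNN : x ^ N * x⁻¹ ^ N = 1 := by rw [← mul_pow, mul_inv_cancel₀ hx, one_pow]
      have hdiv : y / x ^ N = y * x⁻¹ ^ N := by rw [inv_pow, div_eq_mul_inv]
      rw [hdiv] at hab'
      linear_combination x ^ M * x ^ N * hab' + aeval x (reflect M a') * x ^ N * hMM +
        aeval x (reflect M b') * y * (hMM + x ^ M * x⁻¹ ^ M * hNN))
  have hM : ∀ c : F[X], c.natDegree ≤ M → (reflect M c).natDegree ≤ M := fun c hc =>
    natDegree_reflect_le_of_le hc
  have hb : b = 0 := by
    by_contra hb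
    have h1 := congrArg natDegree key.2
    rw [natDegree_mul hb (pow_ne_zero _ X_ne_zero), natDegree_X_pow] at h1
    have := hM b' (le_max_right _ _)
    omega
  have ha : a.natDegree = 0 := by
    by_cases ha : a = 0
    · rw [ha, natDegree_zero]
    have h1 := congrArg natDegree key.1
    rw [natDegree_mul ha (pow_ne_zero _ X_ne_zero), natDegree_X_pow] at h1
    have h2 := hM a' (le_max_left _ _)
    have h3 : (reflect M a' * X ^ N).natDegree ≤ M + N :=
      natDegree_mul_le.trans (by rw [natDegree_X_pow]; omega)
    omega
  obtain ⟨c, rfl⟩ := natDegree_eq_zero.1 ha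
  exact ⟨c, by rw [hab, hb, map_zero, zero_mul, add_zero, aeval_C]⟩

/-- A root would be a polynomial `t` with `deg t ≤ N`, splitting the curve into two components that
meet where `h + 2t` vanishes. Smoothness makes `h + 2t` a nonzero constant, but then its reversal is
a multiple of `x ^ N`, and the components meet at infinity. -/
lemma IsSmoothPair.irreducible_defPoly (hp : IsSmoothPair N p) (hN : 1 ≤ N) :
    Irreducible (defPoly p) := by
  rw [(defPoly_monic p).irreducible_iff_roots_eq_zero_of_degree_le_three
    (by rw [natDegree_defPoly]) (by rw [natDegree_defPoly]; norm_num)]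
  by_contra h
  obtain ⟨w, hw⟩ := Multiset.exists_mem_of_ne_zero h
  have hw0 := (mem_roots (defPoly_monic p).ne_zero).1 hw
  rw [IsRoot, ← eval₂_id, eval₂_defPoly] at hw0
  simp only [RingHom.id_apply] at hw0
  obtain ⟨t, rfl⟩ : ∃ t : F[X], algebraMap F[X] (RatFunc F) t = w := by
    refine IsIntegrallyClosed.isIntegral_iff.1 ⟨X ^ 2 + C p.1 * X - C p.2, by monicity!, ?_⟩
    simpa using hw0
  have ht : t ^ 2 + p.1 * t = p.2 := by
    apply RatFunc.algebraMap_injective F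
    rw [map_add, map_mul, map_pow]
    exact sub_eq_zero.1 hw0
  have htN : t.natDegree ≤ N := by
    by_contra! hlt
    have h1 : (t + p.1).natDegree = t.natDegree :=
      natDegree_add_eq_left_of_natDegree_lt (hp.mem.1.trans_lt hlt)
    have h0 : t + p.1 ≠ 0 := fun h0 => by
      rw [h0, natDegree_zero] at h1
      omega
    have h0' : t ≠ 0 := fun h0 => by
      rw [h0, natDegree_zero] at hlt
      omega
    have h2 := hp.mem.2.1
    rw [← ht, show t ^ 2 + p.1 * t = t * (t + p.1) by ring, natDegree_mul h0' h0, h1] at h2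
    omega
  have hunit : ∀ {r : F[X] × F[X]} {s : F[X]}, AffineSmooth r → s ^ 2 + r.1 * s = r.2 →
      IsUnit (r.1 + 2 * s) := fun {r s} hr hs => by
    refine hr.affineMinimal _ s dvd_rfl ?_
    have : (shift s r).2 = 0 := by
      simp only [shift]
      linear_combination -hs
    rw [this]
    exact dvd_zero _
  have h1 := hunit hp.smooth ht
  have h2 := hunit (s := reflect N t) hp.smooth_reverse (by
    simp only [reversePair]
    rw [← reflect_sq htN, ← reflect_mul _ _ hp.mem.1 htN, ← two_mul, ← reflect_add, ht])
  have h3 : (reversePair N p).1 + 2 * reflect N t = reflect N (p.1 + 2 * t) := by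
    rw [reversePair, reflect_add, ← C_ofNat, reflect_C_mul]
  obtain ⟨c, hc, hc'⟩ := Polynomial.isUnit_iff.1 h1
  rw [h3, ← hc', reflect_C] at h2
  exact not_isUnit_X ((isUnit_pow_iff (by omega)).1 (isUnit_of_mul_isUnit_right h2))

/-- Every smooth pair of positive level is a model of a curve. -/
lemma IsSmoothPair.exists_curve {F : Type u} [Field F] {p : F[X] × F[X]} (hp : IsSmoothPair N p)
    (hN : 1 ≤ N) : ∃ (C : Curve F) (x y : C.K), IsModel p x y := by
  have : Fact (Irreducible (defPoly p)) := ⟨hp.irreducible_defPoly hN⟩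
  have hm := isModel_functionRing p hp.mem.2.2
  exact ⟨{ K := FunctionRing p
           finite_over_rational := ⟨ratX p, hm.transcendental, hm.finiteDimensional⟩
           constants := fun z hz => hm.exists_algebraMap_eq hp hN hz }, _, _, hm⟩

end Constants

/-! ### The minimal level of a curve is its genus plus one. -/

section Levels

variable {F : Type u} [Field F] {C : Curve F} {N : ℕ}

lemma IsModel.isHyperelliptic {p : F[X] × F[X]} {x y : C.K} (hm : IsModel p x y) :
    C.IsHyperelliptic := ⟨x, hm.transcendental, hm.finrank_eq_two, hm.isSeparable⟩

/-- The curve `C` has a model of level `N`. -/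
def HasLevel (C : Curve F) (N : ℕ) : Prop :=
  ∃ p ∈ levelPairs F N, ∃ x y : C.K, IsModel p x y

lemma exists_hasLevel (hC : C.IsHyperelliptic) : ∃ N, HasLevel C N := by
  obtain ⟨x, hx, h2, hs⟩ := hC
  obtain ⟨p, y, hm⟩ := exists_isModel hx h2 hs
  exact ⟨max p.1.natDegree p.2.natDegree, p, ⟨le_max_left _ _,
    (le_max_right p.1.natDegree _).trans (by omega), hm.discr_ne⟩, x, y, hm⟩

/-- With `h` and `f` constant, `y` would be algebraic over `F` and hence a constant of the curve. -/
lemma not_hasLevel_zero (C : Curve F) : ¬ HasLevel C 0 := by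
  rintro ⟨p, hp, x, y, hm⟩
  obtain ⟨c, hc⟩ := natDegree_eq_zero.1 (Nat.le_zero.1 hp.1)
  obtain ⟨d, hd⟩ := natDegree_eq_zero.1 (Nat.le_zero.1 hp.2.1)
  have heqn := hm.eqn
  rw [← hc, ← hd, aeval_C, aeval_C] at heqn
  have hy : IsAlgebraic F y := by
    refine IsIntegral.isAlgebraic ⟨X ^ 2 + Polynomial.C c * X - Polynomial.C d, by monicity!, ?_⟩
    simp only [eval₂_sub, eval₂_add, eval₂_mul, eval₂_C, eval₂_X, eval₂_pow]
    rw [heqn, sub_self]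
  obtain ⟨a, ha⟩ := C.constants y hy
  have := (hm.indep (Polynomial.C a) (-1) (by rw [aeval_C, ha, map_neg, map_one]; ring)).2
  simp at this

variable {p : F[X] × F[X]} {x y : C.K}

/-- A denominator of positive degree would give a model of the same curve at a smaller level. -/
lemma IsModel.affineMinimal (hmin : ∀ M < N, ¬ HasLevel C M)
    (hp : p ∈ levelPairs F N) (hm : IsModel p x y) : AffineMinimal p := by
  obtain ⟨a, t, ha, haN, -, r, hr, rfl⟩ := exists_mem_minimalPairs hp
  have hm' := hm.shift t
  rw [shift_shift_neg] at hm'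
  have h0 : a.natDegree = 0 := by
    by_contra h0
    exact hmin (N - a.natDegree) (by omega) ⟨r, hr.1, x, _, hm'.of_dilate ha.ne_zero⟩
  rw [ha.natDegree_eq_zero.1 h0]
  have : dilate 1 r = r := by simp [dilate]
  rw [this]
  exact hr.2.shift _

lemma IsModel.mem_globallyMinimalPairs (hmin : ∀ M < N, ¬ HasLevel C M)
    (hp : p ∈ levelPairs F N) (hm : IsModel p x y) :
    p ∈ globallyMinimalPairs F N := by
  refine ⟨⟨hp, hm.affineMinimal hmin hp⟩, fun c hc => ?_⟩
  have hN : N ≠ 0 := by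
    rintro rfl
    exact not_hasLevel_zero C ⟨p, hp, x, y, hm⟩
  exact hmin (N - 1) (by omega) ⟨_, hc, x, _, hm.shift _⟩

/-- The equation at infinity is again a model of the same curve at the same minimal level, so the
affine argument applies to both charts. -/
lemma IsModel.isSmoothPair [Finite F] (hmin : ∀ M < N, ¬ HasLevel C M)
    (hp : p ∈ levelPairs F N) (hm : IsModel p x y) : IsSmoothPair N p :=
  ⟨hp, affineSmooth_of_affineMinimal (hm.affineMinimal hmin hp) hp.2.2,
    affineSmooth_of_affineMinimal
      ((hm.reverse hp).affineMinimal hmin (reversePair_mem_levelPairs hp))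
      (reversePair_mem_levelPairs hp).2.2⟩

/-- The level of a hyperelliptic curve is at least its genus plus one. -/
lemma level_of_genus [Finite F] {g : ℕ} (hC : C.IsHyperelliptic) (hg : C.genus = g) :
    HasLevel C (g + 1) ∧ ∀ M < g + 1, ¬ HasLevel C M := by
  classical
  have hex := exists_hasLevel hC
  have hmin : ∀ M < Nat.find hex, ¬ HasLevel C M := fun M hM => Nat.find_min hex hM
  have h0 := Nat.find_spec hex
  have hpos : Nat.find hex ≠ 0 := fun h => not_hasLevel_zero C (h ▸ h0)
  have hN : g + 1 = Nat.find hex := by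
    obtain ⟨p, hp, x, y, hm⟩ := h0
    have := hm.genus_eq (hm.isSmoothPair hmin hp)
    omega
  rw [hN]
  exact ⟨h0, hmin⟩

end Levels

/-! ### Finiteness of automorphism groups. -/

section Automorphisms

variable {F : Type u} [Field F] {C : Curve F} {N : ℕ} {p : F[X] × F[X]} {x y : C.K}

lemma finite_roots_quadratic {K : Type*} [Field K] (b c : K) : {v : K | v ^ 2 + b * v = c}.Finite := by
  have hmon : (X ^ 2 + Polynomial.C b * X - Polynomial.C c).Monic := by monicity!
  refine (rootSet_finite (X ^ 2 + Polynomial.C b * X - Polynomial.C c) K).subset fun v hv => ?_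
  rw [mem_rootSet_of_ne hmon.ne_zero]
  simp only [map_sub, map_add, map_mul, map_pow, aeval_X, aeval_C, Algebra.algebraMap_self,
    RingHom.id_apply]
  exact sub_eq_zero.2 hv

lemma IsModel.finite_regularDifferentials [Finite F] (hm : IsModel p x y)
    (hp : IsSmoothPair N p) : (C.regularDifferentials : Set (Ω[C.K⁄F])).Finite := by
  refine (Set.finite_range fun a : degreeLT F (N - 1) =>
    aeval x a.1 • basicDifferential p x y).subset fun ω hω => ?_
  obtain ⟨a, ha, rfl⟩ := (hm.mem_regularDifferentials_iff hp ω).1 hω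
  exact ⟨⟨a, mem_degreeLT.2 ha⟩, rfl⟩

/-- For an automorphism `σ`, `σ x` is the ratio of two regular differentials, of which there are
finitely many; then `σ y` is a root of a fixed quadratic. The condition `3 ≤ N` makes `x dx / (2y +
h)` regular. -/
lemma IsModel.finite_aut [Finite F] (hm : IsModel p x y) (hp : IsSmoothPair N p) (hN : 3 ≤ N) :
    Finite C.Aut := by
  set H := (C.regularDifferentials : Set (Ω[C.K⁄F]))
  have hH : H.Finite := hm.finite_regularDifferentials hp
  let S : Set C.K := ⋃ ω ∈ H \ {0}, {u | u • ω ∈ H}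
  have hS : S.Finite := hH.sdiff.biUnion fun ω hω =>
    hH.preimage (smul_left_injective C.K hω.2).injOn
  let T : Set (C.K × C.K) := ⋃ u ∈ S, Prod.mk u '' {v | v ^ 2 + aeval u p.1 * v = aeval u p.2}
  have hT : T.Finite := hS.biUnion fun u _ => (finite_roots_quadratic _ _).image _
  have hmem : ∀ σ : C.Aut, (σ x, σ y) ∈ T := by
    intro σ
    have hσ := hm.map σ
    have h1 : basicDifferential p (σ x) (σ y) ∈ H :=
      (hσ.mem_regularDifferentials_iff hp _).2 ⟨1, by
        rw [degree_one]; exact_mod_cast (by omega : 0 < N - 1), by simp⟩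
    have h2 : σ x • basicDifferential p (σ x) (σ y) ∈ H :=
      (hσ.mem_regularDifferentials_iff hp _).2 ⟨X, by
        rw [degree_X]; exact_mod_cast (by omega : 1 < N - 1), by simp⟩
    exact Set.mem_biUnion (Set.mem_biUnion ⟨h1, hσ.basicDifferential_ne_zero⟩ h2)
      ⟨σ y, hσ.eqn, rfl⟩
  have : Finite T := hT
  refine Finite.of_injective (fun σ : C.Aut => (⟨_, hmem σ⟩ : T)) fun σ τ h => ?_
  have h' := congrArg Subtype.val h
  have := hm.algHom_ext (e := (σ : C.K →ₐ[F] C.K)) (e' := (τ : C.K →ₐ[F] C.K))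
    (congrArg Prod.fst h') (congrArg Prod.snd h')
  exact AlgEquiv.ext fun z => DFunLike.congr_fun this z

end Automorphisms

/-! ### Places over a point of the affine curve. -/

section Congruence

variable {F K : Type*} [Field F] [Field K] [Algebra F K] {p : F[X] × F[X]} {x y : K}
  {O : ValuationSubring K} {a b : F}

lemma valuation_mul_lt_one {w z : K} (hw : w ∈ O) (hz : O.valuation z < 1) :
    O.valuation (w * z) < 1 := by
  rw [map_mul]
  exact (mul_le_of_le_one_left' ((O.valuation_le_one_iff w).2 hw)).trans_lt hz

lemma valuation_sub_lt_one {w z : K} (hw : O.valuation w < 1) (hz : O.valuation z < 1) :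
    O.valuation (w - z) < 1 := (O.valuation.map_sub w z).trans_lt (max_lt hw hz)

lemma valuation_add_lt_one {w z : K} (hw : O.valuation w < 1) (hz : O.valuation z < 1) :
    O.valuation (w + z) < 1 := O.valuation.map_add_lt hw hz

lemma valuation_algebraMap_eq_one (hF : ∀ a : F, algebraMap F K a ∈ O) {c : F} (hc : c ≠ 0) :
    O.valuation (algebraMap F K c) = 1 := by
  refine le_antisymm ((O.valuation_le_one_iff _).2 (hF c)) ?_
  have h := (O.valuation_le_one_iff _).2 (hF c⁻¹)
  rw [map_inv₀, map_inv₀] at h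
  have h0 : O.valuation (algebraMap F K c) ≠ 0 := by simpa using hc
  exact (inv_le_one₀ (zero_lt_iff.2 h0)).1 h

lemma eq_zero_of_valuation_lt_one (hF : ∀ a : F, algebraMap F K a ∈ O) {c : F}
    (hc : O.valuation (algebraMap F K c) < 1) : c = 0 := by
  by_contra h
  exact hc.ne (valuation_algebraMap_eq_one hF h)

lemma eq_of_valuation_sub_lt_one (hF : ∀ a : F, algebraMap F K a ∈ O) {z : K} {c d : F}
    (hc : O.valuation (z - algebraMap F K c) < 1) (hd : O.valuation (z - algebraMap F K d) < 1) :
    c = d := by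
  refine (sub_eq_zero.1 (eq_zero_of_valuation_lt_one hF ?_)).symm
  have := valuation_sub_lt_one hc hd
  rwa [sub_sub_sub_cancel_left, ← map_sub] at this

/-- The place `O` lies over the point `(a, b)`. -/
structure LiesOver (O : ValuationSubring K) (x y : K) (a b : F) : Prop where
  const_mem : ∀ c : F, algebraMap F K c ∈ O
  fst : O.valuation (x - algebraMap F K a) < 1
  snd : O.valuation (y - algebraMap F K b) < 1

namespace LiesOver

lemma x_mem (h : LiesOver O x y a b) : x ∈ O := by
  have := add_mem ((O.valuation_le_one_iff _).1 h.fst.le) (h.const_mem a)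
  rwa [sub_add_cancel] at this

lemma y_mem (h : LiesOver O x y a b) : y ∈ O := by
  have := add_mem ((O.valuation_le_one_iff _).1 h.snd.le) (h.const_mem b)
  rwa [sub_add_cancel] at this

lemma aeval_sub (h : LiesOver O x y a b) (c : F[X]) :
    O.valuation (aeval x c - algebraMap F K (c.eval a)) < 1 := by
  obtain ⟨s, hs⟩ := X_sub_C_dvd_sub_C_eval (a := a) (p := c)
  have := congrArg (aeval x) hs
  rw [map_sub, map_mul, map_sub, aeval_C, aeval_C, aeval_X] at this
  rw [this, mul_comm]
  exact valuation_mul_lt_one (IsModel.aeval_mem h.const_mem h.x_mem s) h.fst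

lemma coord_sub (h : LiesOver O x y a b) (c d : F[X]) :
    O.valuation (aeval x c + aeval x d * y - algebraMap F K (c.eval a + d.eval a * b)) < 1 := by
  have e : aeval x c + aeval x d * y - algebraMap F K (c.eval a + d.eval a * b) =
      (aeval x c - algebraMap F K (c.eval a)) + (aeval x d * (y - algebraMap F K b) +
        algebraMap F K b * (aeval x d - algebraMap F K (d.eval a))) := by
    rw [map_add, map_mul]; ring
  rw [e]
  exact valuation_add_lt_one (h.aeval_sub c) (valuation_add_lt_one
    (valuation_mul_lt_one (IsModel.aeval_mem h.const_mem h.x_mem d) h.snd)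
    (valuation_mul_lt_one (h.const_mem b) (h.aeval_sub d)))

lemma valuation_coord_eq_one_iff (h : LiesOver O x y a b) (c d : F[X]) :
    O.valuation (aeval x c + aeval x d * y) = 1 ↔ c.eval a + d.eval a * b ≠ 0 := by
  have h1 := h.coord_sub c d
  constructor
  · intro h2 h3
    rw [h3, map_zero, sub_zero, h2] at h1
    exact lt_irrefl _ h1
  · intro h2
    have h3 := valuation_algebraMap_eq_one h.const_mem h2
    have := O.valuation.map_add_eq_of_lt_left (h1.trans_eq h3.symm)
    rwa [add_sub_cancel, h3] at this

lemma eqn (h : LiesOver O x y a b) (hm : IsModel p x y) :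
    b ^ 2 + p.1.eval a * b = p.2.eval a := by
  have h1 : O.valuation (y * (y - algebraMap F K b) + algebraMap F K b * (y - algebraMap F K b))
      < 1 := valuation_add_lt_one (valuation_mul_lt_one h.y_mem h.snd)
        (valuation_mul_lt_one (h.const_mem b) h.snd)
  have h2 := h.coord_sub (-p.2) p.1
  have h3 := valuation_add_lt_one h1 h2
  have e : y * (y - algebraMap F K b) + algebraMap F K b * (y - algebraMap F K b) +
      (aeval x (-p.2) + aeval x p.1 * y - algebraMap F K ((-p.2).eval a + p.1.eval a * b)) =
      algebraMap F K (p.2.eval a - (b ^ 2 + p.1.eval a * b)) := by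
    simp only [eval_neg, map_neg, map_add, map_sub, map_mul, map_pow]
    linear_combination hm.eqn
  rw [e] at h3
  exact (sub_eq_zero.1 (eq_zero_of_valuation_lt_one h.const_mem h3)).symm

/-- An element of `O` is a fraction whose denominator is a unit at `O`. Whether a coordinate
function is a unit can be read off from its value at `(a, b)`, so the same fraction lies in `O'`. -/
lemma le_of_liesOver {O' : ValuationSubring K} (h : LiesOver O x y a b)
    (h' : LiesOver O' x y a b) (hm : IsModel p x y) (hp : AffineMinimal p) : O ≤ O' := by
  intro z hz
  obtain ⟨c, d, e, f, hr, hz'⟩ := hm.exists_mul_eq_of_mem hp h.const_mem h.x_mem hz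
  have hr' := (h'.valuation_coord_eq_one_iff e f).2 ((h.valuation_coord_eq_one_iff e f).1 hr)
  have hw : aeval x c + aeval x d * y ∈ O' := add_mem (IsModel.aeval_mem h'.const_mem h'.x_mem c)
    (mul_mem (IsModel.aeval_mem h'.const_mem h'.x_mem d) h'.y_mem)
  rw [← hz', ← O'.valuation_le_one_iff, map_mul, hr', one_mul] at hw
  exact (O'.valuation_le_one_iff z).1 hw

lemma eq_of_liesOver {O' : ValuationSubring K} (h : LiesOver O x y a b)
    (h' : LiesOver O' x y a b) (hm : IsModel p x y) (hp : AffineMinimal p) : O = O' :=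
  le_antisymm (h.le_of_liesOver h' hm hp) (h'.le_of_liesOver h hm hp)

lemma ne_top (h : LiesOver O x y a b) (hm : IsModel p x y) : O ≠ ⊤ := by
  rintro rfl
  have h0 : x - algebraMap F K a ≠ 0 := by
    simpa using hm.aeval_ne_zero (X_sub_C_ne_zero a)
  have h1 := h.fst
  have h2 := ((⊤ : ValuationSubring K).valuation_le_one_iff (x - algebraMap F K a)⁻¹).2 trivial
  rw [map_inv₀, inv_le_one₀ (zero_lt_iff.2 (by simpa using h0))] at h2
  exact absurd h1 (not_lt.2 h2)

lemma exists_valuation_sub_lt_one (h : LiesOver O x y a b) (hm : IsModel p x y)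
    (hp : AffineMinimal p) {z : K} (hz : z ∈ O) :
    ∃ c : F, O.valuation (z - algebraMap F K c) < 1 := by
  obtain ⟨c, d, e, f, hr, hz'⟩ := hm.exists_mul_eq_of_mem hp h.const_mem h.x_mem hz
  have h0 := (h.valuation_coord_eq_one_iff e f).1 hr
  set r0 := e.eval a + f.eval a * b
  set w0 := c.eval a + d.eval a * b
  have h1 := h.coord_sub c d
  have h2 := h.coord_sub e f
  refine ⟨w0 / r0, ?_⟩
  have e1 : (aeval x e + aeval x f * y) * (z - algebraMap F K (w0 / r0)) =
      (aeval x c + aeval x d * y - algebraMap F K w0) -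
        algebraMap F K (w0 / r0) * (aeval x e + aeval x f * y - algebraMap F K r0) := by
    have : algebraMap F K w0 = algebraMap F K (w0 / r0) * algebraMap F K r0 := by
      rw [← map_mul, div_mul_cancel₀ _ h0]
    linear_combination hz' + this
  have h3 := valuation_sub_lt_one h1 (valuation_mul_lt_one (h.const_mem (w0 / r0)) h2)
  rwa [← e1, map_mul, hr, one_mul] at h3

end LiesOver

lemma IsModel.exists_liesOver (hm : IsModel p x y) (hp : AffineMinimal p)
    (hab : b ^ 2 + p.1.eval a * b = p.2.eval a) :
    ∃ O : ValuationSubring K, LiesOver O x y a b := by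
  set B := (integralClosure (Algebra.adjoin F {x}) K).toSubring
  have hA : ∀ c : F[X], aeval x c ∈ B := fun c => IsModel.isIntegral_aeval c
  have hC : ∀ c : F, algebraMap F K c ∈ B := fun c => by simpa using hA (C c)
  have hx : x ∈ B := by simpa using hA X
  have hy : y ∈ B := hm.isIntegral_y
  let u : B := ⟨x - algebraMap F K a, sub_mem hx (hC a)⟩
  let v : B := ⟨y - algebraMap F K b, sub_mem hy (hC b)⟩
  -- By minimality the integral closure is `F[x, y]`. A relation `1 = s (x - a) + t (y - b)` there
  -- would become `1 = 0` on evaluation at the point `(a, b)`.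
  have hI : Ideal.span {u, v} ≠ ⊤ := by
    intro h
    have h1 : (1 : B) ∈ Ideal.span {u, v} := by rw [h]; trivial
    obtain ⟨s, t, hst⟩ := Ideal.mem_span_pair.1 h1
    obtain ⟨c, d, hs⟩ := hm.exists_of_isIntegral hp s.2
    obtain ⟨e, f, ht⟩ := hm.exists_of_isIntegral hp t.2
    have h2 : (s : K) * (x - algebraMap F K a) + t * (y - algebraMap F K b) = 1 :=
      congrArg (fun w : B => (w : K)) hst
    rw [hs, ht] at h2
    have h3 := hm.indep' (a := c * (X - C a) - C b * e + f * p.2)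
      (b := d * (X - C a) + e - C b * f - p.1 * f) (a' := 1) (b' := 0) (by
        simp only [map_add, map_sub, map_mul, aeval_X, aeval_C, map_one, map_zero]
        linear_combination h2 - aeval x f * hm.eqn)
    have h4 := congrArg (eval a) h3.1
    have h5 := congrArg (eval a) h3.2
    simp only [eval_add, eval_sub, eval_mul, eval_X, eval_C, eval_one, eval_zero] at h4 h5
    apply one_ne_zero (α := F)
    linear_combination -h4 - b * h5 - f.eval a * hab
  obtain ⟨V, hV, hVI⟩ := Ideal.image_subset_nonunits_valuationSubring _ hI
  refine ⟨V, fun c => hV (hC c), ?_, ?_⟩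
  · exact V.mem_nonunits_iff.1 (hVI ⟨u, Ideal.subset_span (by simp), rfl⟩)
  · exact V.mem_nonunits_iff.1 (hVI ⟨v, Ideal.subset_span (by simp), rfl⟩)

end Congruence

/-! ### Rational points and the quadratic twist. -/

section Points

variable {F : Type u} [Field F] {C : Curve F} {p : F[X] × F[X]} {x y : C.K} {N : ℕ}

lemma LiesOver.isRationalPlace {O : ValuationSubring C.K} {a b : F} (h : LiesOver O x y a b)
    (hm : IsModel p x y) (hp : AffineMinimal p) : C.IsRationalPlace O :=
  ⟨⟨h.const_mem, h.ne_top hm⟩, fun _ hz => h.exists_valuation_sub_lt_one hm hp hz⟩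

lemma IsModel.exists_liesOver_of_isRationalPlace (hm : IsModel p x y) {O : ValuationSubring C.K}
    (hO : C.IsRationalPlace O) (hx : x ∈ O) : ∃ a b : F, LiesOver O x y a b := by
  obtain ⟨a, ha⟩ := hO.2 x hx
  obtain ⟨b, hb⟩ := hO.2 y (hm.y_mem hO.1.1 hx)
  exact ⟨a, b, hO.1.1, ha, hb⟩

/-- The number of solutions of `b² + h b = f` in `F`. -/
noncomputable def numSolutions (h f : F) : ℕ := Nat.card {b : F // b ^ 2 + h * b = f}

lemma eval_zero_reflect (M : ℕ) (f : F[X]) : (reflect M f).eval 0 = f.coeff M := by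
  rw [← coeff_zero_eq_eval_zero, coeff_reflect, revAt_zero]

/-- The rational points of a smooth model correspond to the solutions of its equation over the
points of the projective line. -/
lemma IsModel.exists_equiv_rationalPoint (hm : IsModel p x y) (hp : IsSmoothPair N p) :
    Nonempty ((Σ a : F, {b : F // b ^ 2 + p.1.eval a * b = p.2.eval a}) ⊕
      {b : F // b ^ 2 + p.1.coeff N * b = p.2.coeff (2 * N)} ≃ C.RationalPoint) := by
  have hm' := hm.reverse hp.mem
  have hinf : ∀ b : F, b ^ 2 + p.1.coeff N * b = p.2.coeff (2 * N) ↔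
      b ^ 2 + (reversePair N p).1.eval 0 * b = (reversePair N p).2.eval 0 := fun b => by
    rw [reversePair, eval_zero_reflect, eval_zero_reflect]
  have hx0 := hm.x_ne_zero
  choose P hP using fun s : Σ a : F, {b : F // b ^ 2 + p.1.eval a * b = p.2.eval a} =>
    hm.exists_liesOver hp.smooth.affineMinimal s.2.2
  choose Q hQ using fun b : {b : F // b ^ 2 + p.1.coeff N * b = p.2.coeff (2 * N)} =>
    hm'.exists_liesOver hp.smooth_reverse.affineMinimal ((hinf b.1).1 b.2)
  -- At the places over infinity `1/x` has value `0`, so these are disjoint from the affine ones.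
  have hQx : ∀ b, x ∉ Q b := fun b hx => by
    have h1 := (hQ b).fst
    rw [map_zero, sub_zero, map_inv₀] at h1
    have h2 := ((Q b).valuation_le_one_iff x).2 hx
    exact h1.not_ge ((one_le_inv₀ (zero_lt_iff.2 (by simpa using hx0))).2 h2)
  let Φ : (Σ a : F, {b : F // b ^ 2 + p.1.eval a * b = p.2.eval a}) ⊕
      {b : F // b ^ 2 + p.1.coeff N * b = p.2.coeff (2 * N)} → C.RationalPoint :=
    Sum.elim (fun s => ⟨P s, (hP s).isRationalPlace hm hp.smooth.affineMinimal⟩)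
      (fun b => ⟨Q b, (hQ b).isRationalPlace hm' hp.smooth_reverse.affineMinimal⟩)
  refine ⟨Equiv.ofBijective Φ ⟨Function.Injective.sumElim ?_ ?_ ?_, ?_⟩⟩
  · rintro ⟨a, b, hb⟩ ⟨a', b', hb'⟩ h
    have h : P ⟨a, b, hb⟩ = P ⟨a', b', hb'⟩ := congrArg (fun Q : C.RationalPoint => Q.1) h
    have h1 := hP ⟨a, b, hb⟩
    have h2 := hP ⟨a', b', hb'⟩
    rw [← h] at h2
    obtain rfl : a = a' := eq_of_valuation_sub_lt_one h1.const_mem h1.fst h2.fst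
    obtain rfl : b = b' := eq_of_valuation_sub_lt_one h1.const_mem h1.snd h2.snd
    rfl
  · rintro ⟨b, hb⟩ ⟨b', hb'⟩ h
    have h : Q ⟨b, hb⟩ = Q ⟨b', hb'⟩ := congrArg (fun Q : C.RationalPoint => Q.1) h
    have h1 := hQ ⟨b, hb⟩
    have h2 := hQ ⟨b', hb'⟩
    rw [← h] at h2
    obtain rfl : b = b' := eq_of_valuation_sub_lt_one h1.const_mem h1.snd h2.snd
    rfl
  · intro s b h
    have h : P s = Q b := congrArg (fun Q : C.RationalPoint => Q.1) h
    exact hQx b (h ▸ (hP s).x_mem)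
  · rintro ⟨O, hO⟩
    by_cases hx : x ∈ O
    · obtain ⟨a, b, h⟩ := hm.exists_liesOver_of_isRationalPlace hO hx
      refine ⟨Sum.inl ⟨a, b, h.eqn hm⟩, Subtype.ext ?_⟩
      exact (hP _).eq_of_liesOver h hm hp.smooth.affineMinimal
    · have hx' : x⁻¹ ∈ O := (O.mem_or_inv_mem x).resolve_left hx
      obtain ⟨a, b, h⟩ := hm'.exists_liesOver_of_isRationalPlace hO hx'
      have ha : a = 0 := by
        refine eq_of_valuation_sub_lt_one hO.1.1 h.fst ?_
        rw [map_zero, sub_zero, map_inv₀]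
        rw [← O.valuation_le_one_iff, not_le] at hx
        exact inv_lt_one_of_one_lt₀ hx
      subst ha
      refine ⟨Sum.inr ⟨b, (hinf b).2 (h.eqn hm')⟩, Subtype.ext ?_⟩
      exact (hQ _).eq_of_liesOver h hm' hp.smooth_reverse.affineMinimal

lemma IsModel.finite_rationalPoint [Finite F] (hm : IsModel p x y) (hp : IsSmoothPair N p) :
    Finite C.RationalPoint := by
  obtain ⟨e⟩ := hm.exists_equiv_rationalPoint hp
  exact Finite.of_equiv _ e

lemma IsModel.numPoints_eq [Fintype F] (hm : IsModel p x y) (hp : IsSmoothPair N p) :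
    C.numPoints = ∑ a : F, numSolutions (p.1.eval a) (p.2.eval a) +
      numSolutions (p.1.coeff N) (p.2.coeff (2 * N)) := by
  obtain ⟨e⟩ := hm.exists_equiv_rationalPoint hp
  rw [Curve.numPoints, ← Nat.card_congr e, Nat.card_sum, Nat.card_sigma]
  rfl

/-- The map `z ↦ z² + z` identifies `0` and `-1`, so it is not surjective on a finite field. If `1 +
4γ = 0`, the characteristic is not 2 and `z = -1/2` would solve `z² + z = γ`. -/
lemma exists_twist_parameter (F : Type*) [Field F] [Finite F] :
    ∃ γ : F, (∀ z : F, z ^ 2 + z ≠ γ) ∧ 1 + 4 * γ ≠ 0 := by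
  have h : ¬ Function.Surjective fun z : F => z ^ 2 + z := by
    rw [← Finite.injective_iff_surjective]
    intro h
    have := @h 0 (-1) (by ring)
    exact one_ne_zero (α := F) (by linear_combination this)
  obtain ⟨γ, hγ⟩ := not_forall.1 h
  have hγ' : ∀ z : F, z ^ 2 + z ≠ γ := fun z hz => hγ ⟨z, hz⟩
  refine ⟨γ, hγ', fun h0 => ?_⟩
  by_cases h2 : (2 : F) = 0
  · exact one_ne_zero (α := F) (by linear_combination h0 - 2 * γ * h2)
  · refine hγ' (-(2⁻¹)) (mul_left_cancel₀ (pow_ne_zero 2 h2) ?_)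
    have : (2 : F) * 2⁻¹ = 1 := mul_inv_cancel₀ h2
    linear_combination (2 * 2⁻¹ + 1 - 2) * this - h0

lemma numSolutions_le_ncard [Finite F] {h f b : F} (hb : b ^ 2 + h * b = f) :
    numSolutions h f ≤ Set.ncard {b, -h - b} := by
  refine Set.ncard_le_ncard (s := {b | b ^ 2 + h * b = f}) (fun c hc => ?_)
  have hc : c ^ 2 + h * c = f := hc
  have : (c - b) * (c - (-h - b)) = 0 := by linear_combination hc - hb
  rcases mul_eq_zero.1 this with h | h
  · exact Or.inl (sub_eq_zero.1 h)
  · exact Or.inr (sub_eq_zero.1 h)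

lemma numSolutions_eq_zero {h f : F} (hb : ∀ b, b ^ 2 + h * b ≠ f) : numSolutions h f = 0 := by
  have : IsEmpty {b : F // b ^ 2 + h * b = f} := ⟨fun b => hb b.1 b.2⟩
  exact Nat.card_of_isEmpty

lemma numSolutions_le_two [Finite F] (h f : F) : numSolutions h f ≤ 2 := by
  by_cases hb : ∃ b, b ^ 2 + h * b = f
  · obtain ⟨b, hb⟩ := hb
    exact (numSolutions_le_ncard hb).trans ((Set.ncard_insert_le _ _).trans (by simp))
  · rw [numSolutions_eq_zero (not_exists.1 hb)]
    exact Nat.zero_le 2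

lemma numSolutions_le_one [Finite F] {h f b : F} (hb : b ^ 2 + h * b = f) (h0 : 2 * b + h = 0) :
    numSolutions h f ≤ 1 := by
  refine (numSolutions_le_ncard hb).trans_eq ?_
  rw [show -h - b = b by linear_combination -h0]
  simp

/-- If both equations have solutions `w` and `v` and `2w + h ≠ 0`, then `z = (v - w) / (2w + h)`
satisfies `z² + z = γ`, which is excluded. So both have just a double root. -/
lemma numSolutions_add_twist_le [Finite F] {γ : F} (hγ : ∀ z : F, z ^ 2 + z ≠ γ) (h f : F) :
    numSolutions h f + numSolutions h ((1 + 4 * γ) * f + γ * h ^ 2) ≤ 2 := by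
  by_cases hw : ∃ w, w ^ 2 + h * w = f
  swap
  · rw [numSolutions_eq_zero (not_exists.1 hw), zero_add]
    exact numSolutions_le_two _ _
  by_cases hv : ∃ v, v ^ 2 + h * v = (1 + 4 * γ) * f + γ * h ^ 2
  swap
  · rw [numSolutions_eq_zero (not_exists.1 hv), add_zero]
    exact numSolutions_le_two _ _
  obtain ⟨w, hw⟩ := hw
  obtain ⟨v, hv⟩ := hv
  have hw0 : 2 * w + h = 0 := by
    by_contra hw0
    have hz := div_mul_cancel₀ (v - w) hw0
    refine hγ ((v - w) / (2 * w + h)) (mul_right_cancel₀ (pow_ne_zero 2 hw0) ?_)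
    linear_combination ((v - w) / (2 * w + h) * (2 * w + h) + (v - w) + (2 * w + h)) * hz + hv -
      (1 + 4 * γ) * hw
  have hv0 : 2 * v + h = 0 := by
    refine pow_eq_zero_iff two_ne_zero |>.1 ?_
    linear_combination 4 * hv - 4 * (1 + 4 * γ) * hw + (1 + 4 * γ) * (2 * w + h) * hw0
  exact add_le_add (numSolutions_le_one hw hw0) (numSolutions_le_one hv hv0)

lemma sum_numSolutions [Fintype F] (h : F) : ∑ f : F, numSolutions h f = Fintype.card F := by
  rw [← Nat.card_eq_fintype_card,
    ← Nat.card_congr (Equiv.sigmaFiberEquiv fun b : F => b ^ 2 + h * b), Nat.card_sigma]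
  rfl

/-- Summed over all `f`, both sides equal `2q`, because every `b` solves exactly one equation and
the twist permutes the values of `f`. The termwise inequality is therefore an equality. -/
lemma numSolutions_add_twist [Finite F] {γ : F} (hγ : ∀ z : F, z ^ 2 + z ≠ γ) (hγ' : 1 + 4 * γ ≠ 0)
    (h f : F) : numSolutions h f + numSolutions h ((1 + 4 * γ) * f + γ * h ^ 2) = 2 := by
  classical
  have := Fintype.ofFinite F
  have hbij : Function.Bijective fun f : F => (1 + 4 * γ) * f + γ * h ^ 2 :=
    Finite.injective_iff_bijective.1 fun a b hab => mul_left_cancel₀ hγ' (add_right_cancel hab)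
  have hsum : ∑ f : F, (numSolutions h f + numSolutions h ((1 + 4 * γ) * f + γ * h ^ 2)) =
      ∑ f : F, 2 := by
    rw [Finset.sum_add_distrib, hbij.sum_comp (numSolutions h), sum_numSolutions]
    simp [mul_two]
  exact (Finset.sum_eq_sum_iff_of_le fun f _ => numSolutions_add_twist_le hγ h f).1 hsum f
    (Finset.mem_univ f)

/-- A hyperelliptic curve has a quadratic twist with the opposite trace. -/
lemma IsModel.exists_twist [Finite F] (hm : IsModel p x y) (hp : IsSmoothPair N p) (hN : 1 ≤ N) :
    ∃ C' : Curve F, C'.IsHyperelliptic ∧ C'.genus = C.genus ∧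
      C.numPoints + C'.numPoints = 2 * Nat.card F + 2 := by
  have := Fintype.ofFinite F
  obtain ⟨γ, hγ, hγ'⟩ := exists_twist_parameter F
  have hp' := hp.twist hγ'
  obtain ⟨C', x', y', hm'⟩ := hp'.exists_curve hN
  refine ⟨C', hm'.isHyperelliptic, by rw [hm'.genus_eq hp', hm.genus_eq hp], ?_⟩
  have h1 : ∀ a : F, (twistPair γ p).2.eval a = (1 + 4 * γ) * p.2.eval a + γ * p.1.eval a ^ 2 :=
    fun a => by simp [twistPair]
  have h2 : (twistPair γ p).2.coeff (2 * N) =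
      (1 + 4 * γ) * p.2.coeff (2 * N) + γ * p.1.coeff N ^ 2 := by
    rw [twistPair, coeff_add, coeff_C_mul, coeff_C_mul,
      coeff_pow_of_natDegree_le hp.mem.1]
  rw [hm.numPoints_eq hp, hm'.numPoints_eq hp', add_add_add_comm, ← Finset.sum_add_distrib]
  simp_rw [h1, h2]
  rw [show (twistPair γ p).1 = p.1 from rfl]
  simp_rw [numSolutions_add_twist hγ hγ']
  simp [mul_comm]

end Points

/-! ### Changes of coordinates between models. -/

section Coordinates

variable {F : Type u} [Field F] {K : Type*} [Field K] [Algebra F K] {N : ℕ}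

/-- The data of a change of coordinates between models of level `N`. -/
abbrev CoordChange (F : Type u) [Field F] (N : ℕ) : Type u :=
  Option F × Fˣ × F × Fˣ × {t : F[X] // t.natDegree ≤ N}

/-- The coordinate functions in which the pole of `x` is moved to a given point of the line. -/
noncomputable def basePoint (N : ℕ) (x y : K) : Option F → K × K
  | none => (x, y)
  | some d => ((x - algebraMap F K d)⁻¹, y / (x - algebraMap F K d) ^ N)

/-- The coordinate functions after a change of coordinates. -/
noncomputable def newCoord (N : ℕ) (x y : K) (s : CoordChange F N) : K × K :=
  (algebraMap F K s.2.1 * (basePoint N x y s.1).1 + algebraMap F K s.2.2.1,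
    algebraMap F K s.2.2.2.1 * (basePoint N x y s.1).2 -
      aeval (basePoint N x y s.1).1 s.2.2.2.2.1)

/-- The functions `x`, `y` satisfy the equation of a model of level `N`. -/
def IsCoordPair (F : Type u) [Field F] {K : Type*} [Field K] [Algebra F K] (N : ℕ) (x y : K) :
    Prop := ∃ p ∈ levelPairs F N, IsModel p x y

lemma IsModel.isCoordPair_affine {p : F[X] × F[X]} {x y : K} (hm : IsModel p x y)
    (hp : p ∈ levelPairs F N) {u : F} (hu : u ≠ 0) (v : F) :
    IsCoordPair F N (algebraMap F K u * x + algebraMap F K v) y := by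
  have hm' := hm.affine hu v
  have h1 : (C u⁻¹ * (X - C v)).natDegree ≤ 1 :=
    (natDegree_C_mul_le _ _).trans (natDegree_X_sub_C_le v)
  exact ⟨_, ⟨natDegree_comp_le.trans ((Nat.mul_le_mul hp.1 h1).trans_eq (mul_one _)),
    natDegree_comp_le.trans ((Nat.mul_le_mul hp.2.1 h1).trans_eq (mul_one _)),
    hm'.discr_ne⟩, hm'⟩

lemma IsModel.isCoordPair_basePoint {p : F[X] × F[X]} {x y : K} (hm : IsModel p x y)
    (hp : p ∈ levelPairs F N) (d : Option F) :
    IsCoordPair F N (basePoint N x y d).1 (basePoint N x y d).2 := by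
  cases d with
  | none => exact ⟨p, hp, hm⟩
  | some d =>
    obtain ⟨r, hr, hmr⟩ := hm.isCoordPair_affine hp one_ne_zero (-d)
    rw [map_one, one_mul, map_neg, ← sub_eq_add_neg] at hmr
    exact ⟨_, reversePair_mem_levelPairs hr, hmr.reverse hr⟩

lemma IsModel.isCoordPair_newCoord {p : F[X] × F[X]} {x y : K} (hm : IsModel p x y)
    (hp : p ∈ levelPairs F N) (s : CoordChange F N) :
    IsCoordPair F N (newCoord N x y s).1 (newCoord N x y s).2 := by
  obtain ⟨d, a, b, e, t⟩ := s
  obtain ⟨r, hr, hmr⟩ := hm.isCoordPair_basePoint hp d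
  have he : (C (e : F)).natDegree = 0 := natDegree_C _
  refine ((hmr.scale e.ne_zero).shift t.1).isCoordPair_affine
    (shift_mem_levelPairs (dilate_mem_levelPairs (C_ne_zero.2 e.ne_zero) ?_ ?_) t.2) a.ne_zero b
  · rw [he]; exact Nat.zero_le N
  · rwa [he, Nat.sub_zero]

/-- The pole of the new `x`-coordinate on the line determines the base point; the remaining
parameters are then coefficients with respect to the independent functions `1`, `x`, `y`. -/
lemma IsModel.newCoord_injective {p : F[X] × F[X]} {x y : K} (hm : IsModel p x y)
    (hp : p ∈ levelPairs F N) : Function.Injective (newCoord (F := F) N x y) := by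
  have hx : ∀ d : F, x - algebraMap F K d ≠ 0 := fun d => by
    simpa using hm.aeval_ne_zero (X_sub_C_ne_zero d)
  have aux : ∀ {a a' : Fˣ} {b b' d : F}, algebraMap F K a * x + algebraMap F K b ≠
      algebraMap F K a' * (x - algebraMap F K d)⁻¹ + algebraMap F K b' := by
    intro a a' b b' d h
    have h1 := mul_inv_cancel₀ (hx d)
    have h2 : (C (a : F) * X + C b) * (X - C d) = C (a' : F) + C b' * (X - C d) := by
      apply hm.aeval_injective
      simp only [map_mul, map_add, map_sub, aeval_X, aeval_C]
      linear_combination (x - algebraMap F K d) * h + algebraMap F K a' * h1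
    have h3 := congrArg (eval d) h2
    exact a'.ne_zero (by simpa using h3.symm)
  rintro ⟨d, a, b, e, t⟩ ⟨d', a', b', e', t'⟩ h
  obtain ⟨h1, h2⟩ := Prod.ext_iff.1 h
  simp only [newCoord] at h1 h2
  obtain rfl : d = d' := by
    cases d with
    | none =>
      cases d' with
      | none => rfl
      | some d' => exact absurd h1 aux
    | some d =>
      cases d' with
      | none => exact absurd h1.symm aux
      | some d' =>
        simp only [basePoint] at h1
        have h3 := mul_inv_cancel₀ (hx d)
        have h4 := mul_inv_cancel₀ (hx d')
        have h5 : (C (a : F) + C b * (X - C d)) * (X - C d') =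
            (C (a' : F) + C b' * (X - C d')) * (X - C d) := by
          apply hm.aeval_injective
          simp only [map_mul, map_add, map_sub, aeval_X, aeval_C]
          linear_combination (x - algebraMap F K d) * (x - algebraMap F K d') * h1 -
            algebraMap F K a * (x - algebraMap F K d') * h3 +
            algebraMap F K a' * (x - algebraMap F K d) * h4
        have h6 := congrArg (eval d) h5
        simp only [eval_mul, eval_add, eval_sub, eval_X, eval_C, sub_self, mul_zero, add_zero,
          mul_eq_zero, Units.ne_zero, false_or] at h6
        rw [sub_eq_zero.1 h6]
  obtain ⟨r, hr, hmr⟩ := hm.isCoordPair_basePoint hp d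
  set X' := (basePoint N x y d).1
  set Y' := (basePoint N x y d).2
  have h3 : C (a : F) * X + C b = C (a' : F) * X + C b' := by
    apply hmr.aeval_injective
    simpa only [map_mul, map_add, aeval_X, aeval_C] using h1
  have h4 := hmr.indep' (a := -t.1) (b := C (e : F)) (a' := -t'.1) (b' := C (e' : F)) (by
    simp only [map_neg, aeval_C]
    linear_combination h2)
  have ha : (a : F) = a' := by simpa using congrArg (fun f => coeff f 1) h3
  have hb : b = b' := by simpa using congrArg (fun f => coeff f 0) h3
  have he := C_injective h4.2
  have ht := neg_injective h4.1
  rw [Units.ext ha, hb, Units.ext he, Subtype.ext ht]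

lemma card_coordChange [Finite F] (N : ℕ) : (Nat.card (CoordChange F N) : ℝ) =
    (Nat.card F + 1) * ((Nat.card F - 1) * (Nat.card F * ((Nat.card F - 1) *
      (Nat.card F : ℝ) ^ (N + 1)))) := by
  have hu : (Nat.card Fˣ : ℝ) = Nat.card F - 1 := by
    rw [Nat.card_units, Nat.cast_sub Nat.card_pos, Nat.cast_one]
  simp only [Nat.card_prod, Nat.cast_mul, card_natDegree_le, hu, Finite.card_option, Nat.cast_pow,
    Nat.cast_add, Nat.cast_one]

end Coordinates

/-! ### The mass of the hyperelliptic curves. -/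

section Mass

variable {F : Type u} [Field F] {g : ℕ}

/-- The models of level `N` of the curve `C`. -/
def modelsOf (C : Curve F) (N : ℕ) : Set (F[X] × F[X]) :=
  {p | p ∈ globallyMinimalPairs F N ∧ ∃ x y : C.K, IsModel p x y}

instance [Finite F] (C : Curve F) (N : ℕ) : Finite (modelsOf C N) :=
  (finite_globallyMinimalPairs N).subset fun _ hp => hp.1

/-- This is the orbit-stabilizer inequality. After fixing reference coordinates for every equation
of the curve, a change of coordinates is recovered from its new equation and the automorphism taking
the reference coordinates to the new ones. -/
lemma card_coordChange_le [Finite F] {C : Curve F} {N : ℕ} (h0 : HasLevel C N)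
    (hmin : ∀ M < N, ¬ HasLevel C M) [Finite C.Aut] :
    Nat.card (CoordChange F N) ≤ Nat.card C.Aut * Nat.card (modelsOf C N) := by
  obtain ⟨p, hp, x, y, hm⟩ := h0
  choose ρ hρ hmρ using hm.isCoordPair_newCoord hp
  have hmem : ∀ s, ρ s ∈ modelsOf C N := fun s =>
    ⟨(hmρ s).mem_globallyMinimalPairs hmin (hρ s), _, _, hmρ s⟩
  choose X' Y' hXY using fun r : modelsOf C N => r.2.2
  choose σ hσ using fun s => (hXY ⟨ρ s, hmem s⟩).exists_algEquiv (hmρ s)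
  rw [← Nat.card_prod]
  refine Nat.card_le_card_of_injective
    (fun s => ((σ s, ⟨ρ s, hmem s⟩) : C.Aut × modelsOf C N)) fun s s' h => ?_
  obtain ⟨h1, h2⟩ := Prod.ext_iff.1 h
  refine hm.newCoord_injective hp (Prod.ext ?_ ?_)
  · rw [← (hσ s).1, ← (hσ s').1]
    simp only at h1 h2
    rw [h1, h2]
  · rw [← (hσ s).2, ← (hσ s').2]
    simp only at h1 h2
    rw [h1, h2]

lemma IsoClass.isHyperelliptic (c : IsoClass F g) : c.rep.IsHyperelliptic := (Quotient.out c).2.1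

lemma IsoClass.genus_rep (c : IsoClass F g) : c.rep.genus = g := (Quotient.out c).2.2

lemma IsoClass.eq_of_isModel {c c' : IsoClass F g} {p : F[X] × F[X]} {x y : c.rep.K}
    {x' y' : c'.rep.K} (hm : IsModel p x y) (hm' : IsModel p x' y') : c = c' := by
  obtain ⟨e, -⟩ := hm.exists_algEquiv hm'
  exact Quotient.out_equiv_out.1 ⟨e⟩

lemma finite_of_isHyperelliptic [Finite F] {C : Curve F} (hg : 2 ≤ g) (hC : C.IsHyperelliptic)
    (hCg : C.genus = g) : Finite C.RationalPoint ∧ Finite C.Aut := by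
  obtain ⟨⟨p, hp, x, y, hm⟩, hmin⟩ := level_of_genus hC hCg
  have hp' := hm.isSmoothPair hmin hp
  exact ⟨hm.finite_rationalPoint hp', hm.finite_aut hp' (by omega)⟩

lemma exists_mem_modelsOf [Finite F] (c : IsoClass F g) : ∃ p, p ∈ modelsOf c.rep (g + 1) := by
  obtain ⟨⟨p, hp, x, y, hm⟩, hmin⟩ := level_of_genus c.isHyperelliptic c.genus_rep
  exact ⟨p, hm.mem_globallyMinimalPairs hmin hp, x, y, hm⟩

instance finite_isoClass [Finite F] : Finite (IsoClass F g) := by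
  choose p hp using exists_mem_modelsOf (F := F) (g := g)
  refine Finite.of_injective (fun c => (⟨p c, (hp c).1⟩ : globallyMinimalPairs F (g + 1)))
    fun c c' h => ?_
  obtain ⟨-, x, y, hm⟩ := hp c
  obtain ⟨-, x', y', hm'⟩ := hp c'
  rw [show p c = p c' from congrArg Subtype.val h] at hm
  exact IsoClass.eq_of_isModel hm hm'

lemma sum_card_modelsOf_le [Finite F] [Fintype (IsoClass F g)] (N : ℕ) :
    ∑ c : IsoClass F g, Nat.card (modelsOf c.rep N) ≤ Nat.card (globallyMinimalPairs F N) := by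
  rw [← Nat.card_sigma]
  refine Nat.card_le_card_of_injective (fun s : Σ c : IsoClass F g, modelsOf c.rep N =>
    (⟨s.2.1, s.2.2.1⟩ : globallyMinimalPairs F N)) ?_
  rintro ⟨c, p, hp, x, y, hm⟩ ⟨c', p', hp', x', y', hm'⟩ h
  obtain rfl : p = p' := congrArg Subtype.val h
  obtain rfl := IsoClass.eq_of_isModel hm hm'
  rfl

/-- The mass of the hyperelliptic curves of genus `g` is at most `q ^ (2 * g - 1)`. -/
theorem sum_inv_card_aut_le [Finite F] [Fintype (IsoClass F g)] (hg : 2 ≤ g) :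
    ∑ c : IsoClass F g, (Nat.card c.rep.Aut : ℝ)⁻¹ ≤ (Nat.card F : ℝ) ^ (2 * g - 1) := by
  obtain ⟨k, rfl⟩ : ∃ k, g = k + 1 := ⟨g - 1, by omega⟩
  set G : ℝ := (Nat.card (CoordChange F (k + 1 + 1)) : ℝ) with hG
  have hq : (1 : ℝ) < Nat.card F := by exact_mod_cast Finite.one_lt_card
  rw [card_coordChange] at hG
  have hq1 : 0 < (Nat.card F : ℝ) - 1 := sub_pos.2 hq
  have hGpos : 0 < G := by rw [hG]; positivity
  have h1 : ∀ c : IsoClass F (k + 1), (Nat.card c.rep.Aut : ℝ)⁻¹ ≤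
      Nat.card (modelsOf c.rep (k + 1 + 1)) / G := by
    intro c
    have := (finite_of_isHyperelliptic hg c.isHyperelliptic c.genus_rep).2
    obtain ⟨h0, hmin⟩ := level_of_genus c.isHyperelliptic c.genus_rep
    have h2 : (Nat.card c.rep.Aut : ℝ) > 0 := by exact_mod_cast Nat.card_pos
    rw [le_div_iff₀ hGpos, inv_mul_le_iff₀ h2]
    rw [hG, ← card_coordChange]
    exact_mod_cast card_coordChange_le h0 hmin
  calc ∑ c : IsoClass F (k + 1), (Nat.card c.rep.Aut : ℝ)⁻¹
      ≤ ∑ c : IsoClass F (k + 1), Nat.card (modelsOf c.rep (k + 1 + 1)) / G :=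
        Finset.sum_le_sum fun c _ => h1 c
    _ ≤ Nat.card (globallyMinimalPairs F (k + 1 + 1)) / G := by
        rw [← Finset.sum_div]
        gcongr
        exact_mod_cast sum_card_modelsOf_le _
    _ ≤ _ := by
        rw [div_le_iff₀ hGpos]
        refine (card_globallyMinimalPairs_le k).trans_eq ?_
        rw [hG, show 2 * (k + 1) - 1 = 2 * k + 1 by omega]
        ring

end Mass

/-! ### From the mass to a curve with a large trace. -/

section TraceSum

variable {F : Type u} [Field F] {g : ℕ}

lemma Curve.Iso.geomIso {C C' : Curve F} (h : C.Iso C') : C.GeomIso C' :=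
  h.map fun e => Algebra.TensorProduct.congr AlgEquiv.refl e

/-- The geometric isomorphism class of an isomorphism class. -/
noncomputable def IsoClass.geom (c : IsoClass F g) : GeomClass F g :=
  Quotient.mk (geomSetoid F g) (Quotient.out c)

lemma geomIso_out_iff (d : GeomClass F g) (c : IsoClass F g) :
    (Quotient.out d : HypCurve F g).1.GeomIso c.rep ↔ d = c.geom :=
  (Quotient.eq_mk_iff_out (s := geomSetoid F g)).symm

instance finite_geomClass [Finite F] : Finite (GeomClass F g) := by
  refine Finite.of_surjective (IsoClass.geom : IsoClass F g → GeomClass F g) fun d => ?_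
  refine ⟨Quotient.mk (isoSetoid F g) (Quotient.out d), ?_⟩
  refine ((geomIso_out_iff _ _).1 (Curve.Iso.geomIso ?_)).symm
  exact (isoSetoid F g).symm (Quotient.mk_out (s := isoSetoid F g) (Quotient.out d))

/-- The sum over the geometric classes of the sums over the twists is a sum over all curves. -/
lemma traceSum_eq [Finite F] [Fintype (IsoClass F g)] (n : ℕ) : traceSum F g n =
    ∑ c : IsoClass F g, ((Nat.card F : ℝ) + 1 - c.rep.numPoints) ^ n / Nat.card c.rep.Aut := by
  classical
  have := Fintype.ofFinite (GeomClass F g)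
  simp_rw [traceSum, twistSum, finsum_eq_if, finsum_eq_sum_of_fintype, geomIso_out_iff]
  -- After the exchange each isomorphism class meets exactly one geometric class, so the inner sum
  -- has a single term.
  rw [Finset.sum_comm]
  simp

lemma nonempty_isoClass (F : Type u) [Field F] [Finite F] (hg : 1 ≤ g) :
    Nonempty (IsoClass F g) := by
  obtain ⟨p, hp⟩ := exists_isSmoothPair F (show 2 ≤ g + 1 by omega)
  obtain ⟨C, x, y, hm⟩ := hp.exists_curve (by omega)
  exact ⟨Quotient.mk _ ⟨C, hm.isHyperelliptic, by rw [hm.genus_eq hp, Nat.add_sub_cancel]⟩⟩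

/-- Some curve has a trace of Frobenius of absolute value at least `aq * √q`. -/
lemma exists_aq_mul_sqrt_le (F : Type u) [Field F] [Finite F] (hg : 2 ≤ g) {n : ℕ} (hn : n ≠ 0)
    (hn' : Even n) : ∃ c : IsoClass F g,
      aq F g n * √(Nat.card F : ℝ) ≤ |(Nat.card F : ℝ) + 1 - c.rep.numPoints| := by
  have := Fintype.ofFinite (IsoClass F g)
  have := nonempty_isoClass F (g := g) (by omega)
  obtain ⟨c, hc⟩ := Finite.exists_max fun c : IsoClass F g =>
    |(Nat.card F : ℝ) + 1 - c.rep.numPoints|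
  refine ⟨c, ?_⟩
  set M := |(Nat.card F : ℝ) + 1 - c.rep.numPoints|
  have hM : 0 ≤ M := abs_nonneg _
  have hq : 0 < (Nat.card F : ℝ) := by exact_mod_cast Nat.card_pos
  set q : ℝ := (Nat.card F : ℝ)
  have h0 : 0 ≤ traceSum F g n := by
    rw [traceSum_eq]
    exact Finset.sum_nonneg fun c _ => div_nonneg (hn'.pow_nonneg _) (Nat.cast_nonneg _)
  have h1 : traceSum F g n ≤ M ^ n * q ^ (2 * g - 1) := by
    rw [traceSum_eq]
    calc _ ≤ ∑ c : IsoClass F g, M ^ n * (Nat.card c.rep.Aut : ℝ)⁻¹ := by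
          refine Finset.sum_le_sum fun c _ => ?_
          rw [div_eq_mul_inv, ← hn'.pow_abs]
          gcongr
          exact hc c
      _ ≤ _ := by
          rw [← Finset.mul_sum]
          gcongr
          exact sum_inv_card_aut_le hg
  have h2 : q ^ (2 * g - 1 + n / 2) = q ^ (2 * g - 1) * √q ^ n := by
    rw [pow_add, ← Nat.two_mul_div_two_of_even hn', pow_mul, Real.sq_sqrt hq.le,
      Nat.two_mul_div_two_of_even hn']
  have hs : 0 < √q := Real.sqrt_pos.2 hq
  rw [← le_div_iff₀ hs, aq]
  calc _ ≤ ((M / √q) ^ n) ^ (1 / (n : ℝ)) := by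
        refine Real.rpow_le_rpow (by positivity) ?_ (by positivity)
        rw [h2, div_le_iff₀ (by positivity), div_pow]
        refine h1.trans_eq ?_
        field_simp
    _ = M / √q := by rw [one_div, Real.pow_rpow_inv_natCast (by positivity) hn]

end TraceSum

end CurveCount

theorem theorem3p5 (F : Type u) [Field F] [Finite F] (q : ℕ) (hq : Nat.card F = q)
    (g : ℕ) (hg : 2 ≤ g) (n : ℕ) (hn : 2 ≤ n) (hn' : Even n) :
    -- the sums and cardinalities in the definition of `a_q` are finite
    (Finite (CurveCount.IsoClass F g) ∧
      ∀ C : CurveCount.Curve F, C.IsHyperelliptic → C.genus = g →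
        Finite C.RationalPoint ∧ Finite C.Aut) ∧
    (∃ C : CurveCount.Curve F, C.IsHyperelliptic ∧ C.genus = g ∧
      1 + (q : ℝ) + CurveCount.aq F g n * √(q : ℝ) ≤ (C.numPoints : ℝ)) ∧
    (∃ C' : CurveCount.Curve F, C'.IsHyperelliptic ∧ C'.genus = g ∧
      (C'.numPoints : ℝ) ≤ 1 + (q : ℝ) - CurveCount.aq F g n * √(q : ℝ)) := by
  subst hq
  refine ⟨⟨CurveCount.finite_isoClass,
    fun C hC hCg => CurveCount.finite_of_isHyperelliptic hg hC hCg⟩, ?_⟩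
  obtain ⟨c, hc⟩ := CurveCount.exists_aq_mul_sqrt_le F hg (n := n) (by omega) hn'
  obtain ⟨⟨p, hp, x, y, hm⟩, hmin⟩ := CurveCount.level_of_genus c.isHyperelliptic c.genus_rep
  obtain ⟨C', hC', hg', hsum⟩ := hm.exists_twist (hm.isSmoothPair hmin hp) (by omega)
  rw [c.genus_rep] at hg'
  have hsum' : (c.rep.numPoints : ℝ) + C'.numPoints = 2 * Nat.card F + 2 := by exact_mod_cast hsum
  -- The sign of the trace decides which of the curve and its twist has many points.
  rcases le_abs.1 hc with h | h
  · exact ⟨⟨C', hC', hg', by linarith⟩, ⟨c.rep, c.isHyperelliptic, c.genus_rep, by linarith⟩⟩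
  · exact ⟨⟨c.rep, c.isHyperelliptic, c.genus_rep, by linarith⟩, ⟨C', hC', hg', by linarith⟩⟩
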